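/- There are a fixed program for a unit-cost word RAM and a constant $C$ such that the following holds for every finite connected simple graph $G=(V,E)$ with $V=\{0,\dots,n-1\}$ and $m=|E|$ edges, and every positive integer $k$. A \emph{$k$-graphlet} of $G$ is a connected subgraph $G[S]$ induced by a set $S\subseteq V$ of exactly $k$ vertices; it is represented by $S$. Let $N$ be the number of $k$-graphlets of $G$. The input consists of $n$, $k$ and adjacency lists of $G$, in any order, stored in memory; the output is a write-only stream in which a graphlet is listed as its $k$ vertices, in some order. Started on this input, the program halts, having output every $k$-graphlet of $G$ exactly once and nothing else, and it uses - at most $C\,(n+m+k^2N)$ steps, that is, $O(n+m+k^2\cdot N)$ total time; - if $N\ge 1$, at most $C\,k^2N$ steps, that is, $O(k^2)$ amortized time per solution; - at most $C\,(n+m)$ memory cells (including the input, excluding the output stream), that is, $O(n+m)$ space, each cell being a word of at most $C\cdot\ell$ bits, where $\ell$ is the number of binary digits of $n+m+k$. Here the machine has a fixed finite set of word registers and random access memory; addition, truncated subtraction, loading a constant, reading or writing a cell, outputting a word, and testing a register for zero each take one step. -/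

import Mathlib

namespace GraphletEnum

/-! ### Graphlets -/

/-- The vertex set `S` is (the vertex set of) a `k`-graphlet of `G`: it has exactly `k` vertices
and the subgraph of `G` induced by it is connected. -/
def IsKGraphlet {V : Type*} (G : SimpleGraph V) (k : ℕ) (S : Finset V) : Prop :=
  S.card = k ∧ (G.induce (S : Set V)).Connected

/-- The number `N` of `k`-graphlets of `G`. -/
noncomputable def numGraphlets {V : Type*} (G : SimpleGraph V) (k : ℕ) : ℕ :=
  {S : Finset V | IsKGraphlet G k S}.ncard

/-- The number `m` of edges of `G`. -/
noncomputable def numEdges {V : Type*} (G : SimpleGraph V) : ℕ :=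
  G.edgeSet.ncard

/-! ### A word random access machine with unit cost -/

/-- Structured programs for a random access machine. The machine has registers (a program
mentions only finitely many of them), a memory of cells addressed by natural numbers, and a
write-only output stream. There is no built-in recursion and there are no compound data:
call stacks and data structures have to be laid out in memory. -/
inductive Cmd : Type
  /-- do nothing -/
  | skip : Cmd
  /-- `r := v`, for a fixed number `v` -/
  | const (r v : ℕ) : Cmd
  /-- `r := a + b` -/
  | add (r a b : ℕ) : Cmd
  /-- `r := a - b`, and `r := 0` if `a < b` -/
  | sub (r a b : ℕ) : Cmd
  /-- `r := memory[a]` -/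
  | load (r a : ℕ) : Cmd
  /-- `memory[a] := b` -/
  | store (a b : ℕ) : Cmd
  /-- append the content of register `a` to the output -/
  | emit (a : ℕ) : Cmd
  /-- first `c`, then `d` -/
  | seq (c d : Cmd) : Cmd
  /-- if register `a` is nonzero then `c` else `d` -/
  | cond (a : ℕ) (c d : Cmd) : Cmd
  /-- while register `a` is nonzero do `c` -/
  | loop (a : ℕ) (c : Cmd) : Cmd

/-- A configuration of the machine: registers, memory, and the output written so far. -/
structure State : Type where
  reg : ℕ → ℕ
  mem : ℕ → ℕ
  out : List ℕ

/-- Assign the value `v` to register `r`. -/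
def State.setReg (s : State) (r v : ℕ) : State :=
  { s with reg := Function.update s.reg r v }

/-- Write the value `v` to the memory cell `a`. -/
def State.setMem (s : State) (a v : ℕ) : State :=
  { s with mem := Function.update s.mem a v }

/-- Append the value `v` to the output. -/
def State.write (s : State) (v : ℕ) : State :=
  { s with out := s.out ++ [v] }

/-- The initial configuration: the input words stand in the memory from address `0` on,
every other cell and every register is `0`, and the output is empty. -/
def State.init (input : List ℕ) : State where
  reg := fun _ => 0
  mem := fun a => input.getD a 0
  out := []

/-- `Exec cells w c s t s'`: on the machine with `cells` memory cells (addresses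
`0, …, cells - 1`) and words of `w` bits, the program `c` started in configuration `s` halts
after `t` steps in configuration `s'`. Every elementary instruction and every evaluation of a
test costs one step. An access to an address that does not exist and an arithmetic
overflow have no rule: such a run does not halt properly. -/
inductive Exec (cells w : ℕ) : Cmd → State → ℕ → State → Prop
  | skip (s : State) : Exec cells w .skip s 1 s
  | const (s : State) (r v : ℕ) (hv : v < 2 ^ w) :
      Exec cells w (.const r v) s 1 (s.setReg r v)
  | add (s : State) (r a b : ℕ) (hv : s.reg a + s.reg b < 2 ^ w) :
      Exec cells w (.add r a b) s 1 (s.setReg r (s.reg a + s.reg b))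
  | sub (s : State) (r a b : ℕ) :
      Exec cells w (.sub r a b) s 1 (s.setReg r (s.reg a - s.reg b))
  | load (s : State) (r a : ℕ) (ha : s.reg a < cells) :
      Exec cells w (.load r a) s 1 (s.setReg r (s.mem (s.reg a)))
  | store (s : State) (a b : ℕ) (ha : s.reg a < cells) :
      Exec cells w (.store a b) s 1 (s.setMem (s.reg a) (s.reg b))
  | emit (s : State) (a : ℕ) :
      Exec cells w (.emit a) s 1 (s.write (s.reg a))
  | seq {c d : Cmd} {s s' s'' : State} {t t' : ℕ}
      (hc : Exec cells w c s t s') (hd : Exec cells w d s' t' s'') :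
      Exec cells w (.seq c d) s (t + t') s''
  | condTrue {a : ℕ} {c d : Cmd} {s s' : State} {t : ℕ} (ha : s.reg a ≠ 0)
      (hc : Exec cells w c s t s') :
      Exec cells w (.cond a c d) s (1 + t) s'
  | condFalse {a : ℕ} {c d : Cmd} {s s' : State} {t : ℕ} (ha : s.reg a = 0)
      (hd : Exec cells w d s t s') :
      Exec cells w (.cond a c d) s (1 + t) s'
  | loopDone {a : ℕ} {c : Cmd} {s : State} (ha : s.reg a = 0) :
      Exec cells w (.loop a c) s 1 s
  | loopStep {a : ℕ} {c : Cmd} {s s' s'' : State} {t t' : ℕ} (ha : s.reg a ≠ 0)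
      (hc : Exec cells w c s t s') (hl : Exec cells w (.loop a c) s' t' s'') :
      Exec cells w (.loop a c) s (1 + t + t') s''

/-! ### Input and output of graphlet enumeration -/

/-- `adj` is an adjacency list representation of `G`: `adj u` lists the neighbors of `u`, each
of them once, in an arbitrary order. -/
def IsAdjLists {n : ℕ} (G : SimpleGraph (Fin n)) (adj : Fin n → List (Fin n)) : Prop :=
  ∀ u, (adj u).Nodup ∧ ∀ v, v ∈ adj u ↔ G.Adj u v

/-- The input words: `n`, then `k`, then for each vertex `u = 0, …, n - 1` its degree followed
by its neighbors. -/
def inputWords {n : ℕ} (adj : Fin n → List (Fin n)) (k : ℕ) : List ℕ :=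
  n :: k :: (List.finRange n).flatMap fun u => (adj u).length :: (adj u).map Fin.val

/-- `out` is a listing of the `k`-graphlets of `G`: it is a concatenation of blocks, where each
block lists the vertices of a `k`-graphlet, each vertex once, and each `k`-graphlet of `G` is the
content of exactly one block. -/
def ListsGraphlets {n : ℕ} (G : SimpleGraph (Fin n)) (k : ℕ) (out : List ℕ) : Prop :=
  ∃ blocks : List (List (Fin n)),
    out = blocks.flatMap (fun b => b.map Fin.val) ∧
    (∀ b ∈ blocks, b.Nodup) ∧
    (blocks.map List.toFinset).Nodup ∧
    ∀ S : Finset (Fin n), S ∈ blocks.map List.toFinset ↔ IsKGraphlet G k S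

end GraphletEnum

/-!
The program `graphletC` enumerates the `k`-graphlets by binary partition. A subproblem `(A, S)`
consists of the alive vertices `A` and a connected set `S ⊆ A`; its solutions `Sol G k A S` are
the graphlets `T` with `S ⊆ T ⊆ A`. For a vertex `v` the solutions split into those of `(A, insert
v S)` and those of `(A.erase v, S)`. The program branches on `v` only when both parts are
nonempty, so that the tree of subproblems is a binary tree in which every leaf yields output, and
`O(k ^ 2)` time per node is `O(k ^ 2)` time per solution.

*Finding `v`* (`searchC`, `prepC_spec`). From `S` the program searches the graph of the alive
vertices, but sets the first new vertex `v` it meets aside. If the search reaches `k` vertices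
without `v`, then there are solutions without `v`; and since a connected set can be enlarged one
vertex at a time inside a larger connected set (`Conn.exists_between`), there are solutions with
`v` as soon as there is any solution. If the search ends before, every solution contains `v`
(`Sol_forced`); then `v` is added to `S`, and the search goes on with a new candidate. If it ends
without a candidate, the vertices reached are the only solution (`Sol_closed`). At most `k + 1`
distinct vertices are ever marked, so at most `k + 1` arcs are looked at per scanned vertex, and
the search takes `O(k ^ 2)` steps whatever the degrees are. When `S` lacks one vertex only, the
solutions correspond to the alive neighbors of `S` (`Sol_last`, `leafC_spec`).

*Deleting `v`* (`deleteC`, `undeleteC`). The alive graph is kept in doubly linked adjacency lists.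
Deletion unlinks the mates of the arcs of `v`; the deleted arcs keep their links, so that
deletions are reverted in the opposite order (`Dll.relink_unlink`). The time is proportional to
the degree of `v` among the alive vertices, which may exceed `k ^ 2`; but when `S` together with
`v` has fewer than `k` vertices, all but `k` of those neighbors lie in solutions with `v`, each of
which has `k` vertices, so that the degree is at most `k + k * f` for `f` solutions with `v`
(`degree_le_card_Sol`). Since the connected set grows by `v` on that branch, a solution is charged
`O(k)` at most `k` times. This is the second summand of `cost`, and `cost_branch` is the induction
step of `run_spec`.

*Roots* (`rootsC_spec`). Let the vertices be ordered so that every nonempty prefix is connected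
(`orderC`, a breadth-first search). The graphlets whose last vertex is `r` are the solutions of
`(A, {r})`, where `A` is the prefix that ends with `r`. If `A` has at least `k` vertices, there is
one. The vertices are treated from the last one on and deleted afterwards.

*Preprocessing* takes `O(n + m)` steps. For `2 ≤ k ≤ n` every edge lies in a graphlet and a
graphlet has at most `k ^ 2` edges, so `m ≤ k ^ 2 * N` (`numEdges_le`), and `n ≤ m + 1`. For `k =
1` the program outputs the vertices without reading the edges, and for `k > n` it stops at once.

The traversal of the tree is iterative, with a trail of the vertices branched on, see `stepC`.
Registers `0` to `13` hold constants (`Base`). Register `14` points to the end of `S`, register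
`15` to the end of the trail, register `16` tells whether a subproblem is to be treated or the
last entry of the trail to be resumed, register `17` is zero at the end of a traversal, register
`18` points to the current root in the order of the vertices, and register `19` holds the end of
the copy of `S` in the queue during a leaf. Registers from `20` on are temporary.
-/

namespace GraphletEnum

/-! ### Total correctness of programs with time bounds -/

infixr:60 " ;; " => Cmd.seq

@[simp] lemma State.setReg_reg (s : State) (r v : ℕ) :
    (s.setReg r v).reg = Function.update s.reg r v := rfl
@[simp] lemma State.setReg_mem (s : State) (r v : ℕ) : (s.setReg r v).mem = s.mem := rfl
@[simp] lemma State.setReg_out (s : State) (r v : ℕ) : (s.setReg r v).out = s.out := rfl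
@[simp] lemma State.setMem_reg (s : State) (a v : ℕ) : (s.setMem a v).reg = s.reg := rfl
@[simp] lemma State.setMem_mem (s : State) (a v : ℕ) :
    (s.setMem a v).mem = Function.update s.mem a v := rfl
@[simp] lemma State.setMem_out (s : State) (a v : ℕ) : (s.setMem a v).out = s.out := rfl
@[simp] lemma State.write_reg (s : State) (v : ℕ) : (s.write v).reg = s.reg := rfl
@[simp] lemma State.write_mem (s : State) (v : ℕ) : (s.write v).mem = s.mem := rfl
@[simp] lemma State.write_out (s : State) (v : ℕ) : (s.write v).out = s.out ++ [v] := rfl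

/-- Total correctness with a time bound: started in `s`, the program `c` halts after at most `B`
steps in a configuration that satisfies `P`. -/
def Halts (cells w : ℕ) (c : Cmd) (s : State) (B : ℕ) (P : State → Prop) : Prop :=
  ∃ t s', Exec cells w c s t s' ∧ t ≤ B ∧ P s'

variable {cells w : ℕ}

lemma Halts.mono {c : Cmd} {s : State} {B B' : ℕ} {P P' : State → Prop}
    (h : Halts cells w c s B P) (hB : B ≤ B') (hP : ∀ s', P s' → P' s') :
    Halts cells w c s B' P' := by
  obtain ⟨t, s', h1, h2, h3⟩ := h
  exact ⟨t, s', h1, h2.trans hB, hP _ h3⟩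

lemma Halts.seq {c d : Cmd} {s : State} {B B' : ℕ} {P Q : State → Prop}
    (h : Halts cells w c s B P) (h' : ∀ s', P s' → Halts cells w d s' B' Q) :
    Halts cells w (c ;; d) s (B + B') Q := by
  obtain ⟨t, s', h1, h2, h3⟩ := h
  obtain ⟨t', s'', h1', h2', h3'⟩ := h' _ h3
  exact ⟨_, _, h1.seq h1', by omega, h3'⟩

/-- The weakest precondition of a loop-free program; loops are assigned `False`. -/
def wp (cells w : ℕ) : Cmd → (State → Prop) → State → Prop
  | .skip, Q, s => Q s
  | .const r v, Q, s => v < 2 ^ w ∧ Q (s.setReg r v)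
  | .add r a b, Q, s => s.reg a + s.reg b < 2 ^ w ∧ Q (s.setReg r (s.reg a + s.reg b))
  | .sub r a b, Q, s => Q (s.setReg r (s.reg a - s.reg b))
  | .load r a, Q, s => s.reg a < cells ∧ Q (s.setReg r (s.mem (s.reg a)))
  | .store a b, Q, s => s.reg a < cells ∧ Q (s.setMem (s.reg a) (s.reg b))
  | .emit a, Q, s => Q (s.write (s.reg a))
  | .seq c d, Q, s => wp cells w c (wp cells w d Q) s
  | .cond a c d, Q, s => (s.reg a ≠ 0 → wp cells w c Q s) ∧ (s.reg a = 0 → wp cells w d Q s)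
  | .loop _ _, _, _ => False

/-- A bound on the running time of a loop-free program. -/
def Cmd.size : Cmd → ℕ
  | .seq c d => c.size + d.size
  | .cond _ c d => 1 + (c.size + d.size)
  | _ => 1

lemma Halts.of_wp {c : Cmd} {s : State} {P : State → Prop} (h : wp cells w c P s) :
    Halts cells w c s c.size P := by
  induction c generalizing s P with
  | skip => exact ⟨1, s, .skip s, le_rfl, h⟩
  | const r v => exact ⟨1, _, .const s r v h.1, le_rfl, h.2⟩
  | add r a b => exact ⟨1, _, .add s r a b h.1, le_rfl, h.2⟩
  | sub r a b => exact ⟨1, _, .sub s r a b, le_rfl, h⟩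
  | load r a => exact ⟨1, _, .load s r a h.1, le_rfl, h.2⟩
  | store a b => exact ⟨1, _, .store s a b h.1, le_rfl, h.2⟩
  | emit a => exact ⟨1, _, .emit s a, le_rfl, h⟩
  | seq c d hc hd => exact (hc h).seq fun s' hs' => hd hs'
  | cond a c d hc hd =>
    by_cases ha : s.reg a = 0
    · obtain ⟨t, s', h1, h2, h3⟩ := hd (h.2 ha)
      exact ⟨_, s', .condFalse ha h1, by simp only [Cmd.size]; omega, h3⟩
    · obtain ⟨t, s', h1, h2, h3⟩ := hc (h.1 ha)
      exact ⟨_, s', .condTrue ha h1, by simp only [Cmd.size]; omega, h3⟩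
  | loop a c => exact h.elim

/-- Symbolic execution of a loop-free initial part of a program. -/
lemma Halts.wp_seq {c d : Cmd} {s : State} {B : ℕ} {P : State → Prop}
    (h : wp cells w c (fun s' => Halts cells w d s' B P) s) :
    Halts cells w (c ;; d) s (c.size + B) P :=
  (Halts.of_wp h).seq fun _ h => h

lemma Halts.condTrue {a : ℕ} {c d : Cmd} {s : State} {B : ℕ} {P : State → Prop}
    (ha : s.reg a ≠ 0) (h : Halts cells w c s B P) : Halts cells w (.cond a c d) s (1 + B) P := by
  obtain ⟨t, s', h1, h2, h3⟩ := h
  exact ⟨_, s', .condTrue ha h1, by omega, h3⟩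

lemma Halts.condFalse {a : ℕ} {c d : Cmd} {s : State} {B : ℕ} {P : State → Prop}
    (ha : s.reg a = 0) (h : Halts cells w d s B P) : Halts cells w (.cond a c d) s (1 + B) P := by
  obtain ⟨t, s', h1, h2, h3⟩ := h
  exact ⟨_, s', .condFalse ha h1, by omega, h3⟩

/-- The rule for loops. The invariant `I T s` speaks of the time `T` spent in the loop so far; a
bound on that time, valid whenever the invariant holds, gives termination as well. -/
lemma Halts.loop {a : ℕ} {c : Cmd} {s : State} {B : ℕ} (I : ℕ → State → Prop) {T₀ : ℕ}
    (h0 : I T₀ s)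
    (hb : ∀ T s, I T s → T ≤ T₀ + B)
    (hs : ∀ T s, I T s → s.reg a ≠ 0 → ∃ b, Halts cells w c s b (I (T + b + 1))) :
    Halts cells w (.loop a c) s (B + 1) (fun s' => s'.reg a = 0 ∧ ∃ T, I T s') := by
  have key : ∀ d T s, I T s → T₀ + B = T + d →
      Halts cells w (.loop a c) s (d + 1) (fun s' => s'.reg a = 0 ∧ ∃ T, I T s') := by
    intro d
    induction d using Nat.strong_induction_on with
    | _ d ih =>
      intro T s hI hd
      by_cases ha : s.reg a = 0
      · exact ⟨1, s, .loopDone ha, by omega, ha, T, hI⟩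
      · obtain ⟨b, t, s', h1, h2, h3⟩ := hs T s hI ha
        have h4 := hb _ _ h3
        obtain ⟨t', s'', h1', h2', h3'⟩ := ih (d - (b + 1)) (by omega) _ s' h3 (by omega)
        exact ⟨_, s'', .loopStep ha h1 h1', by omega, h3'⟩
  exact key B _ s h0 rfl

/-- Some iterations of `while a ≠ 0 do c`, taking `T` steps in all. -/
inductive Iter (cells w : ℕ) (a : ℕ) (c : Cmd) : State → ℕ → State → Prop
  | refl (s : State) : Iter cells w a c s 0 s
  | step {s s' s'' : State} {t T : ℕ} (ha : s.reg a ≠ 0) (hc : Exec cells w c s t s')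
      (hl : Iter cells w a c s' T s'') : Iter cells w a c s (1 + t + T) s''

lemma Iter.trans {a : ℕ} {c : Cmd} {s s' s'' : State} {T T' : ℕ}
    (h : Iter cells w a c s T s') (h' : Iter cells w a c s' T' s'') :
    Iter cells w a c s (T + T') s'' := by
  induction h with
  | refl s => simpa using h'
  | step ha hc _ ih => rw [add_assoc]; exact .step ha hc (ih h')

lemma Iter.exec {a : ℕ} {c : Cmd} {s s' : State} {T : ℕ}
    (h : Iter cells w a c s T s') (h0 : s'.reg a = 0) :
    Exec cells w (.loop a c) s (T + 1) s' := by
  induction h with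
  | refl s => exact .loopDone h0
  | step ha hc _ ih => rw [add_assoc]; exact .loopStep ha hc (ih h0)

/-- Some iterations of `while a ≠ 0 do c`, taking at most `B` steps in all, lead from `s` to a
configuration that satisfies `P`. -/
def Reaches (cells w : ℕ) (a : ℕ) (c : Cmd) (s : State) (B : ℕ) (P : State → Prop) : Prop :=
  ∃ T s', Iter cells w a c s T s' ∧ T ≤ B ∧ P s'

lemma Reaches.mono {a : ℕ} {c : Cmd} {s : State} {B B' : ℕ} {P P' : State → Prop}
    (h : Reaches cells w a c s B P) (hB : B ≤ B') (hP : ∀ s', P s' → P' s') :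
    Reaches cells w a c s B' P' := by
  obtain ⟨t, s', h1, h2, h3⟩ := h
  exact ⟨t, s', h1, h2.trans hB, hP _ h3⟩

lemma Reaches.trans {a : ℕ} {c : Cmd} {s : State} {B B' : ℕ} {P Q : State → Prop}
    (h : Reaches cells w a c s B P) (h' : ∀ s', P s' → Reaches cells w a c s' B' Q) :
    Reaches cells w a c s (B + B') Q := by
  obtain ⟨t, s', h1, h2, h3⟩ := h
  obtain ⟨t', s'', h1', h2', h3'⟩ := h' _ h3
  exact ⟨_, _, h1.trans h1', by omega, h3'⟩

lemma Reaches.one {a : ℕ} {c : Cmd} {s : State} {B : ℕ} {P : State → Prop}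
    (ha : s.reg a ≠ 0) (h : Halts cells w c s B P) : Reaches cells w a c s (B + 1) P := by
  obtain ⟨t, s', h1, h2, h3⟩ := h
  exact ⟨_, _, .step ha h1 (.refl _), by omega, h3⟩

lemma Reaches.halts {a : ℕ} {c : Cmd} {s : State} {B : ℕ} {P : State → Prop}
    (h : Reaches cells w a c s B P) (h0 : ∀ s', P s' → s'.reg a = 0) :
    Halts cells w (.loop a c) s (B + 1) P := by
  obtain ⟨t, s', h1, h2, h3⟩ := h
  exact ⟨_, _, h1.exec (h0 _ h3), by omega, h3⟩

end GraphletEnum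

namespace GraphletEnum

/-! ### Connected vertex sets and subproblems -/

section Graph
variable {V : Type*} [DecidableEq V] {G : SimpleGraph V}

/-- The vertex set `S` induces a connected subgraph of `G`. -/
def Conn (G : SimpleGraph V) (S : Finset V) : Prop := (G.induce (S : Set V)).Connected

/-- A vertex set induces a connected subgraph iff it is nonempty and no proper nonempty part of
it is closed under adjacency. -/
lemma conn_iff {S : Finset V} : Conn G S ↔ S.Nonempty ∧ ∀ U ⊆ S, U.Nonempty →
    (∀ u ∈ U, ∀ x ∈ S, G.Adj u x → x ∈ U) → U = S := by
  classical
  unfold Conn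
  constructor
  · intro h
    obtain ⟨⟨x, hx⟩⟩ := h.nonempty
    refine ⟨⟨x, hx⟩, fun U hU ⟨u, hu⟩ hcl => ?_⟩
    refine Finset.Subset.antisymm hU fun y hy => ?_
    obtain ⟨p⟩ := h.preconnected ⟨u, hU hu⟩ ⟨y, hy⟩
    have key : ∀ (a b : (S : Set V)), (G.induce (S : Set V)).Walk a b → a.1 ∈ U → b.1 ∈ U := by
      intro a b p
      induction p with
      | nil => exact id
      | cons hadj _ ih => exact fun ha => ih (hcl _ ha _ (Finset.mem_coe.1 (Subtype.coe_prop _)) hadj)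
    exact key _ _ p hu
  · rintro ⟨⟨x, hx⟩, h⟩
    have : Nonempty (S : Set V) := ⟨⟨x, hx⟩⟩
    refine ⟨fun a ⟨b, hb⟩ => ?_⟩
    have key := h (S.filter fun y => ∃ hy : y ∈ S, (G.induce (S : Set V)).Reachable a ⟨y, hy⟩)
      (Finset.filter_subset _ _) ⟨a.1, by
        simp only [Finset.mem_filter]; exact ⟨a.2, a.2, SimpleGraph.Reachable.refl _⟩⟩ (by
        intro u hu y hy hadj
        simp only [Finset.mem_filter] at hu ⊢
        obtain ⟨-, hu, hr⟩ := hu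
        refine ⟨hy, hy, hr.trans (SimpleGraph.Adj.reachable ?_)⟩
        exact hadj)
    have hb' : b ∈ S := hb
    rw [← key, Finset.mem_filter] at hb'
    exact hb'.2.2

lemma Conn.nonempty {S : Finset V} (h : Conn G S) : S.Nonempty := (conn_iff.1 h).1

lemma conn_singleton (v : V) : Conn G {v} := by
  refine conn_iff.2 ⟨Finset.singleton_nonempty v, fun U hU hne _ => ?_⟩
  exact (Finset.Nonempty.subset_singleton_iff hne).1 hU

lemma Conn.insert_of_adj {S : Finset V} (h : Conn G S) {u v : V} (hu : u ∈ S) (huv : G.Adj u v) :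
    Conn G (insert v S) := by
  refine conn_iff.2 ⟨Finset.insert_nonempty _ _, fun U hU hne hcl => ?_⟩
  have hS : S ⊆ U := by
    have hne' : (U ∩ S).Nonempty := by
      obtain ⟨x, hx⟩ := hne
      rcases Finset.mem_insert.1 (hU hx) with rfl | hxS
      · exact ⟨u, Finset.mem_inter.2 ⟨hcl _ hx u (Finset.mem_insert_of_mem hu) huv.symm, hu⟩⟩
      · exact ⟨x, Finset.mem_inter.2 ⟨hx, hxS⟩⟩
    have := (conn_iff.1 h).2 (U ∩ S) Finset.inter_subset_right hne' (by
      intro a ha b hb hab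
      rw [Finset.mem_inter] at ha ⊢
      exact ⟨hcl a ha.1 b (Finset.mem_insert_of_mem hb) hab, hb⟩)
    exact Finset.inter_eq_right.1 this
  refine Finset.Subset.antisymm hU fun x hx => ?_
  rcases Finset.mem_insert.1 hx with rfl | hxS
  · exact hcl u (hS hu) _ hx huv
  · exact hS hxS

lemma Conn.subset_of_closed {T R : Finset V} (hT : Conn G T) (hne : (T ∩ R).Nonempty)
    (hcl : ∀ u ∈ R, u ∈ T → ∀ x ∈ T, G.Adj u x → x ∈ R) : T ⊆ R := by
  have := (conn_iff.1 hT).2 (T ∩ R) Finset.inter_subset_left hne (by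
    intro u hu x hx hux
    rw [Finset.mem_inter] at hu ⊢
    exact ⟨hx, hcl u hu.2 hu.1 x hx hux⟩)
  exact Finset.inter_eq_left.1 this

lemma Conn.exists_adj {S B : Finset V} (hB : Conn G B) (hS : S.Nonempty) (hSB : S ⊂ B) :
    ∃ u ∈ S, ∃ v ∈ B, v ∉ S ∧ G.Adj u v := by
  by_contra! hcon
  have := (conn_iff.1 hB).2 S hSB.1 hS (fun u hu x hx hux => by
    by_contra hxS; exact hcon u hu x hx hxS hux)
  exact hSB.ne this

/-- Between two connected vertex sets there is a connected set of every intermediate size. -/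
lemma Conn.exists_between {S B : Finset V} (hS : Conn G S) (hB : Conn G B) (hSB : S ⊆ B) {k : ℕ}
    (h1 : S.card ≤ k) (h2 : k ≤ B.card) : ∃ T, S ⊆ T ∧ T ⊆ B ∧ T.card = k ∧ Conn G T := by
  induction k, h1 using Nat.le_induction with
  | base => exact ⟨S, subset_rfl, hSB, rfl, hS⟩
  | succ k hk ih =>
    obtain ⟨T, h3, h4, h5, h6⟩ := ih (by omega)
    have hss : T ⊂ B := h4.ssubset_of_ne (by rintro rfl; omega)
    obtain ⟨u, hu, v, hv, hvT, huv⟩ := hB.exists_adj h6.nonempty hss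
    exact ⟨insert v T, h3.trans (Finset.subset_insert _ _), Finset.insert_subset hv h4,
      by rw [Finset.card_insert_of_notMem hvT, h5], h6.insert_of_adj hu huv⟩

open Classical in
/-- The solutions of the subproblem `(A, S)`: the `k`-graphlets that contain `S` and have all
their vertices among the alive vertices `A`. -/
noncomputable def Sol (G : SimpleGraph V) (k : ℕ) (A S : Finset V) : Finset (Finset V) :=
  A.powerset.filter fun T => S ⊆ T ∧ T.card = k ∧ Conn G T

lemma mem_Sol {k : ℕ} {A S T : Finset V} :
    T ∈ Sol G k A S ↔ T ⊆ A ∧ S ⊆ T ∧ T.card = k ∧ Conn G T := by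
  simp [Sol]

lemma Sol_insert_union (k : ℕ) (A S : Finset V) (v : V) :
    Sol G k A S = Sol G k A (insert v S) ∪ Sol G k (A.erase v) S := by
  ext T
  simp only [Finset.mem_union, mem_Sol, Finset.insert_subset_iff, Finset.subset_erase]
  tauto

lemma Sol_insert_disjoint (k : ℕ) (A S : Finset V) (v : V) :
    Disjoint (Sol G k A (insert v S)) (Sol G k (A.erase v) S) := by
  rw [Finset.disjoint_left]
  intro T h1 h2
  simp only [mem_Sol, Finset.insert_subset_iff, Finset.subset_erase] at h1 h2
  exact h2.1.2 h1.2.1.1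

lemma card_Sol_insert (k : ℕ) (A S : Finset V) (v : V) :
    (Sol G k A S).card = (Sol G k A (insert v S)).card + (Sol G k (A.erase v) S).card := by
  rw [Sol_insert_union k A S v, Finset.card_union_of_disjoint (Sol_insert_disjoint k A S v)]

/-- If all the alive neighbors of a set `R` of fewer than `k` vertices lie in `R` or are equal to
`v`, then every solution that meets `R` contains `v`. -/
lemma Sol_forced {k : ℕ} {A S R : Finset V} {v : V} (hS : S.Nonempty) (hSR : S ⊆ R)
    (hR : R.card < k) (hcl : ∀ u ∈ R, ∀ x ∈ A, G.Adj u x → x = v ∨ x ∈ R) :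
    Sol G k A (insert v S) = Sol G k A S := by
  ext T
  simp only [mem_Sol, Finset.insert_subset_iff]
  refine ⟨by tauto, fun ⟨h1, h2, h3, h4⟩ => ⟨h1, ⟨?_, h2⟩, h3, h4⟩⟩
  by_contra hv
  obtain ⟨x, hx⟩ := hS
  have := h4.subset_of_closed (R := R) ⟨x, Finset.mem_inter.2 ⟨h2 hx, hSR hx⟩⟩
    (fun u hu _ y hy huy => (hcl u hu y (h1 hy) huy).resolve_left (by rintro rfl; exact hv hy))
  have := Finset.card_le_card this
  omega

/-- A set `Q` of at most `k` vertices without alive neighbors outside is the only candidate. -/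
lemma Sol_closed {k : ℕ} {A S Q : Finset V} (hS : S.Nonempty) (hSQ : S ⊆ Q)
    (hne : (Sol G k A S).Nonempty) (hQ : Q.card ≤ k)
    (hcl : ∀ u ∈ Q, ∀ x ∈ A, G.Adj u x → x ∈ Q) : Sol G k A S = {Q} ∧ Q.card = k := by
  have key : ∀ T ∈ Sol G k A S, T = Q := by
    intro T hT
    obtain ⟨h1, h2, h3, h4⟩ := mem_Sol.1 hT
    obtain ⟨x, hx⟩ := hS
    have := h4.subset_of_closed (R := Q) ⟨x, Finset.mem_inter.2 ⟨h2 hx, hSQ hx⟩⟩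
      (fun u hu _ y hy huy => hcl u hu y (h1 hy) huy)
    exact Finset.eq_of_subset_of_card_le this (by omega)
  obtain ⟨T, hT⟩ := hne
  obtain rfl := key T hT
  refine ⟨Finset.eq_singleton_iff_unique_mem.2 ⟨hT, key⟩, (mem_Sol.1 hT).2.2.1⟩

lemma Sol_nonempty_of_subset {k : ℕ} {A S Q : Finset V} (hS : Conn G S) (hQ : Conn G Q)
    (hSQ : S ⊆ Q) (hQA : Q ⊆ A) (h1 : S.card ≤ k) (h2 : k ≤ Q.card) : (Sol G k A S).Nonempty := by
  obtain ⟨T, h3, h4, h5, h6⟩ := hS.exists_between hQ hSQ h1 h2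
  exact ⟨T, mem_Sol.2 ⟨h4.trans hQA, h3, h5, h6⟩⟩

/-- An alive neighbor of `S` can be added, as long as `S` has fewer than `k` vertices. -/
lemma Sol_insert_nonempty {k : ℕ} {A S : Finset V} {u v : V} (hS : Conn G S)
    (hne : (Sol G k A S).Nonempty) (hk : S.card < k) (hu : u ∈ S) (huv : G.Adj u v) (hv : v ∈ A) :
    (Sol G k A (insert v S)).Nonempty := by
  obtain ⟨T, hT⟩ := hne
  obtain ⟨h1, h2, h3, h4⟩ := mem_Sol.1 hT
  refine Sol_nonempty_of_subset (hS.insert_of_adj hu huv) (h4.insert_of_adj (h2 hu) huv)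
    (Finset.insert_subset_insert _ h2) (Finset.insert_subset hv h1)
    ((Finset.card_insert_le _ _).trans hk) ?_
  rw [← h3]; exact Finset.card_le_card (Finset.subset_insert _ _)

/-- The alive neighbors of `S` outside of `S`, when `S` lacks one vertex only, correspond to the
solutions. -/
lemma Sol_last {k : ℕ} {A S : Finset V} (hS : Conn G S) (hk : S.card + 1 = k) (hSA : S ⊆ A)
    (N : Finset V) (hN : ∀ x, x ∈ N ↔ x ∈ A ∧ x ∉ S ∧ ∃ u ∈ S, G.Adj u x) :
    Sol G k A S = N.image fun x => insert x S := by
  ext T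
  rw [mem_Sol, Finset.mem_image]
  constructor
  · rintro ⟨h1, h2, h3, h4⟩
    obtain ⟨u, hu, v, hv, hvS, huv⟩ := h4.exists_adj hS.nonempty
      (h2.ssubset_of_ne (by rintro rfl; omega))
    refine ⟨v, (hN v).2 ⟨h1 hv, hvS, u, hu, huv⟩, ?_⟩
    refine Finset.eq_of_subset_of_card_le (Finset.insert_subset hv h2) ?_
    rw [Finset.card_insert_of_notMem hvS]; omega
  · rintro ⟨x, hx, rfl⟩
    obtain ⟨h1, h2, u, hu, hux⟩ := (hN x).1 hx
    exact ⟨Finset.insert_subset h1 hSA, Finset.subset_insert _ _,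
      by rw [Finset.card_insert_of_notMem h2, hk], hS.insert_of_adj hu hux⟩

/-- The number of alive neighbors of a vertex of `S` is bounded in terms of the number of
solutions: each of them outside of `S` is contained in a solution, and a solution contains at most
`k` of them. -/
lemma degree_le_card_Sol {k : ℕ} {A S N : Finset V} {v : V} (hS : Conn G S)
    (hne : (Sol G k A S).Nonempty) (hk : S.card < k) (hv : v ∈ S)
    (hN : ∀ x ∈ N, x ∈ A ∧ G.Adj v x) : N.card ≤ k + k * (Sol G k A S).card := by
  have h1 : N ⊆ S ∪ (Sol G k A S).biUnion id := by
    intro x hx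
    obtain ⟨hxA, hvx⟩ := hN x hx
    obtain ⟨T, hT⟩ := Sol_insert_nonempty hS hne hk hv hvx hxA
    rw [mem_Sol, Finset.insert_subset_iff] at hT
    exact Finset.mem_union_right _ (Finset.mem_biUnion.2
      ⟨T, mem_Sol.2 ⟨hT.1, hT.2.1.2, hT.2.2⟩, hT.2.1.1⟩)
  refine (Finset.card_le_card h1).trans ((Finset.card_union_le _ _).trans ?_)
  refine Nat.add_le_add hk.le ?_
  rw [mul_comm]
  exact Finset.card_biUnion_le_card_mul _ _ _ fun T hT => (mem_Sol.1 hT).2.2.1.le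

end Graph
end GraphletEnum

namespace GraphletEnum

/-! ### Doubly linked lists in memory -/

section Dll

/-- The nodes of `l` form a circular doubly linked list with header `x`: a node `y` stores the
address of its successor in cell `y` and that of its predecessor in cell `y + 1`. -/
def Dll (m : ℕ → ℕ) (x : ℕ) (l : List ℕ) : Prop :=
  ∀ y ∈ List.zip (x :: l) (l ++ [x]), m y.1 = y.2 ∧ m (y.2 + 1) = y.1

/-- Take the node `b` out of its doubly linked list. -/
def unlink (m : ℕ → ℕ) (b : ℕ) : ℕ → ℕ :=
  Function.update (Function.update m (m (b + 1)) (m b)) (m b + 1) (m (b + 1))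

/-- Put the node `b` back to where its own links point. -/
def relink (m : ℕ → ℕ) (b : ℕ) : ℕ → ℕ :=
  Function.update (Function.update m (m (b + 1)) b) (m b + 1) b

variable {m m' : ℕ → ℕ} {x b : ℕ} {p q l : List ℕ}

lemma Dll.congr (h : Dll m x l) (h1 : ∀ y ∈ x :: l, m' y = m y)
    (h2 : ∀ y ∈ x :: l, m' (y + 1) = m (y + 1)) : Dll m' x l := by
  rintro ⟨y, z⟩ hyz
  obtain ⟨hy, hz⟩ := List.of_mem_zip hyz
  have hz' : z ∈ x :: l := by simpa [or_comm] using hz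
  rw [h1 y hy, h2 z hz']
  exact h _ hyz

lemma zip_split (x b : ℕ) (p q : List ℕ) :
    List.zip (x :: (p ++ b :: q)) ((p ++ b :: q) ++ [x]) =
      List.zip (x :: p) (p ++ [b]) ++ List.zip (b :: q) (q ++ [x]) := by
  rw [← List.zip_append (by simp)]
  simp

/-- The node that follows in a circular list with header `x`, when `l` remains. -/
def front (x : ℕ) (l : List ℕ) : ℕ := l.head?.getD x

/-- The node that precedes in a circular list with header `x`, when `l` has been passed. -/
def back (x : ℕ) (l : List ℕ) : ℕ := l.getLast?.getD x

@[simp] lemma front_nil (x : ℕ) : front x [] = x := rfl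
@[simp] lemma front_cons (x b : ℕ) (l : List ℕ) : front x (b :: l) = b := rfl
@[simp] lemma back_nil (x : ℕ) : back x [] = x := rfl
@[simp] lemma back_append (x b : ℕ) (l : List ℕ) : back x (l ++ [b]) = b := by simp [back]

lemma front_mem (x : ℕ) (l : List ℕ) : front x l ∈ x :: l := by
  cases l <;> simp

lemma back_mem (x : ℕ) (l : List ℕ) : back x l ∈ x :: l := by
  cases l using List.reverseRecOn <;> simp

lemma exists_eq_front (x : ℕ) (q : List ℕ) : ∃ r, q ++ [x] = front x q :: r := by
  cases q <;> simp

lemma exists_eq_back (x : ℕ) (p : List ℕ) : ∃ r, x :: p = r ++ [back x p] := by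
  cases p using List.reverseRecOn with
  | nil => exact ⟨[], rfl⟩
  | append_singleton p b => exact ⟨x :: p, by simp⟩

/-- The links around a node of the list. -/
lemma Dll.links (h : Dll m x (p ++ b :: q)) :
    m (back x p) = b ∧ m (b + 1) = back x p ∧ m b = front x q ∧ m (front x q + 1) = b := by
  rw [Dll, zip_split] at h
  obtain ⟨r, hr⟩ := exists_eq_front x q
  obtain ⟨r', hr'⟩ := exists_eq_back x p
  have h1 := h (back x p, b) (by
    rw [hr', List.mem_append, List.zip_append (by simpa using (congrArg List.length hr').symm)]
    simp)
  have h2 := h (b, front x q) (by rw [hr]; simp)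
  exact ⟨h1.1, h1.2, h2.1, h2.2⟩

lemma Dll.first (h : Dll m x l) : m x = front x l := by
  cases l with
  | nil => exact (h (x, x) (by simp)).1
  | cons b l => exact (h (x, b) (by simp)).1

lemma Dll.last (h : Dll m x l) : m (x + 1) = back x l := by
  obtain ⟨r', hr'⟩ := exists_eq_back x l
  refine (h (back x l, x) ?_).2
  rw [hr', List.zip_append (by simpa using (congrArg List.length hr').symm)]
  simp

/-- All nodes of the list with header `x` are aligned. -/
def Aligned (H : ℕ) (l : List ℕ) : Prop := ∀ y ∈ l, ∃ i, y = H + 4 * i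

lemma Dll.unlink {H : ℕ} (h : Dll m x (p ++ b :: q)) (hnd : (x :: (p ++ b :: q)).Nodup)
    (hal : Aligned H (x :: (p ++ b :: q))) : Dll (unlink m b) x (p ++ q) := by
  obtain ⟨h1, h2, h3, h4⟩ := h.links
  have hbp := back_mem x p
  have hfq := front_mem x q
  have hbA := hal (back x p) (by simp at hbp ⊢; tauto)
  have hfA := hal (front x q) (by simp at hfq ⊢; tauto)
  obtain ⟨r, hr⟩ := exists_eq_front x q
  obtain ⟨r', hr'⟩ := exists_eq_back x p
  have hlen : r'.length = p.length := by simpa using (congrArg List.length hr').symm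
  have hq : (q ++ [x]).Nodup := by
    rw [(List.perm_append_singleton x q).nodup_iff]
    simp only [List.nodup_append, List.nodup_cons] at hnd ⊢; simp at hnd ⊢; tauto
  have hp : (x :: p).Nodup := by
    simp only [List.nodup_append, List.nodup_cons] at hnd ⊢; simp at hnd ⊢; tauto
  have hdisj : ∀ y ∈ x :: p, y ∉ q := by
    simp [List.nodup_append] at hnd ⊢
    refine ⟨hnd.1.2.2, fun y hy hyq => ?_⟩
    exact (hnd.2.2.2 y hy).2 y hyq rfl
  have hdisj' : ∀ y ∈ q ++ [x], y ∉ p := by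
    simp [List.nodup_append] at hnd ⊢
    rintro y (hy | rfl) hyp
    · exact (hnd.2.2.2 y hyp).2 y hy rfl
    · exact hnd.1.1 hyp
  rw [hr, List.nodup_cons] at hq
  rw [hr'] at hp
  have hp' : back x p ∉ r' := by
    intro hmem; rw [List.nodup_append] at hp; exact hp.2.2 _ hmem _ (by simp) rfl
  have hnew : List.zip (x :: (p ++ q)) ((p ++ q) ++ [x]) =
      List.zip r' p ++ (back x p, front x q) :: List.zip q r := by
    rw [← List.cons_append, hr', List.append_assoc, List.append_assoc, hr,
      List.zip_append hlen]
    rfl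
  have hold : List.zip (x :: (p ++ b :: q)) ((p ++ b :: q) ++ [x]) =
      (List.zip r' p ++ [(back x p, b)]) ++ ((b, front x q) :: List.zip q r) := by
    rw [zip_split, hr, hr', List.zip_append hlen]; rfl
  rw [Dll, hold] at h
  rw [Dll, hnew]
  unfold GraphletEnum.unlink
  rw [h2, h3]
  have hA : ∀ y z, (y, z) ∈ List.zip r' p ++ List.zip q r →
      (∃ i, y = H + 4 * i) ∧ (∃ i, z = H + 4 * i) := by
    intro y z hyz
    have hyz' : (y, z) ∈ List.zip (x :: (p ++ b :: q)) ((p ++ b :: q) ++ [x]) := by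
      rw [hold]; simp at hyz ⊢; tauto
    obtain ⟨hy, hz⟩ := List.of_mem_zip hyz'
    exact ⟨hal y hy, hal z (by simp at hz ⊢; tauto)⟩
  obtain ⟨i, hi⟩ := hbA
  obtain ⟨j, hj⟩ := hfA
  have key : ∀ y z, (y, z) ∈ List.zip r' p ++ List.zip q r → y ≠ back x p → z ≠ front x q →
      Function.update (Function.update m (back x p) (front x q)) (front x q + 1) (back x p) y = z ∧
      Function.update (Function.update m (back x p) (front x q)) (front x q + 1) (back x p)
        (z + 1) = y := by
    intro y z hyz hy hz
    obtain ⟨⟨i', hi'⟩, j', hj'⟩ := hA y z hyz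
    have := h (y, z) (by simp at hyz ⊢; tauto)
    rw [Function.update_of_ne (by omega), Function.update_of_ne hy,
      Function.update_of_ne (by omega), Function.update_of_ne (by omega)]
    exact this
  rintro ⟨y, z⟩ hyz
  simp only [List.mem_append, List.mem_cons] at hyz
  rcases hyz with hyz | hyz | hyz
  · obtain ⟨hy, hz⟩ := List.of_mem_zip hyz
    refine key y z (by simp [hyz]) (by rintro rfl; exact hp' hy) ?_
    rintro rfl
    exact hdisj' _ (by simpa [or_comm] using hfq) hz
  · obtain ⟨rfl, rfl⟩ := Prod.mk.inj hyz
    refine ⟨?_, by simp⟩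
    simp only
    rw [Function.update_of_ne (by omega), Function.update_self]
  · obtain ⟨hy, hz⟩ := List.of_mem_zip hyz
    refine key y z (by simp [hyz]) ?_ (by rintro rfl; exact hq.1 hz)
    rintro rfl
    exact hdisj _ hbp hy

/-- A node that has been unlinked keeps its own links, so that unlinking can be reverted exactly. -/
lemma Dll.relink_unlink {H : ℕ} (h : Dll m x (p ++ b :: q)) (hnd : (x :: (p ++ b :: q)).Nodup)
    (hal : Aligned H (x :: (p ++ b :: q))) : relink (GraphletEnum.unlink m b) b = m := by
  obtain ⟨h1, h2, h3, h4⟩ := h.links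
  have hbp := back_mem x p
  have hfq := front_mem x q
  obtain ⟨i, hi⟩ := hal (back x p) (by simp at hbp ⊢; tauto)
  obtain ⟨j, hj⟩ := hal (front x q) (by simp at hfq ⊢; tauto)
  obtain ⟨l, hl⟩ := hal b (by simp)
  have hb1 : b ≠ back x p := by
    rintro he; rw [← he] at hbp
    simp [List.nodup_append] at hnd hbp
    rcases hbp with rfl | hbp
    · simp at hnd
    · exact (hnd.2.2.2 _ hbp).1 rfl
  have hb2 : b ≠ front x q := by
    rintro he; rw [← he] at hfq
    simp [List.nodup_append] at hnd hfq
    rcases hfq with rfl | hfq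
    · simp at hnd
    · exact hnd.2.2.1.1 hfq
  have e1 : GraphletEnum.unlink m b (b + 1) = back x p := by
    unfold GraphletEnum.unlink
    rw [h2, h3, Function.update_of_ne (by omega), Function.update_of_ne (by omega), h2]
  have e2 : GraphletEnum.unlink m b b = front x q := by
    unfold GraphletEnum.unlink
    rw [h2, h3, Function.update_of_ne (by omega), Function.update_of_ne (by omega), h3]
  unfold relink
  rw [e1, e2]
  funext y
  unfold GraphletEnum.unlink
  rw [h2, h3]
  by_cases hy1 : y = front x q + 1
  · subst hy1; rw [Function.update_self, h4]
  · rw [Function.update_of_ne hy1]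
    by_cases hy2 : y = back x p
    · rw [hy2, Function.update_self, h1]
    · rw [Function.update_of_ne hy2, Function.update_of_ne hy1, Function.update_of_ne hy2]

end Dll

/-- Insert the node `b` right after the header `x`. -/
def insertHead (m : ℕ → ℕ) (x b : ℕ) : ℕ → ℕ :=
  Function.update (Function.update (Function.update (Function.update m b (m x)) (b + 1) x)
    (m x + 1) b) x b

lemma Dll.insertHead {m : ℕ → ℕ} {x b H : ℕ} {l : List ℕ} (h : Dll m x l)
    (hnd : (b :: x :: l).Nodup) (hal : Aligned H (b :: x :: l)) :
    Dll (insertHead m x b) x (b :: l) := by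
  have hf := h.first
  have hfm := front_mem x l
  obtain ⟨i, hi⟩ := hal b (by simp)
  obtain ⟨j, hj⟩ := hal x (by simp)
  obtain ⟨j', hj'⟩ := hal (front x l) (List.mem_cons_of_mem _ hfm)
  have hbx : b ≠ x := by rintro rfl; simp at hnd
  have hbf : b ≠ front x l := by
    rintro he; rw [List.nodup_cons] at hnd; rw [he] at hnd; exact hnd.1 hfm
  unfold GraphletEnum.insertHead
  rw [hf]
  intro y hy
  obtain ⟨r, hr⟩ := exists_eq_front x l
  rw [List.cons_append, List.zip_cons_cons, List.mem_cons, hr, List.zip_cons_cons,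
    List.mem_cons] at hy
  rcases hy with rfl | rfl | hy
  · simp only
    refine ⟨by simp, ?_⟩
    rw [Function.update_of_ne (by omega), Function.update_of_ne (by omega), Function.update_self]
  · simp only
    constructor
    · rw [Function.update_of_ne (by omega), Function.update_of_ne (by omega),
        Function.update_of_ne (by omega), Function.update_self]
    · rw [Function.update_of_ne (by omega), Function.update_self]
  · obtain ⟨y, z⟩ := y
    obtain ⟨hy1, hz1⟩ := List.of_mem_zip hy
    have hz2 : z ∈ x :: l := by
      have : z ∈ l ++ [x] := by rw [hr]; exact List.mem_cons_of_mem _ hz1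
      simpa [or_comm] using this
    obtain ⟨i1, hi1⟩ := hal y (by simp [hy1])
    obtain ⟨i2, hi2⟩ := hal z (List.mem_cons_of_mem _ hz2)
    have hlx : (l ++ [x]).Nodup := by
      rw [(List.perm_append_singleton x l).nodup_iff]
      exact (List.nodup_cons.1 hnd).2
    rw [hr, List.nodup_cons] at hlx
    have hyx : y ≠ x := by rintro rfl; simp [hy1] at hnd
    have hyb : y ≠ b := by rintro rfl; simp [hy1] at hnd
    have hzb : z ≠ b := by rintro rfl; exact (List.nodup_cons.1 hnd).1 hz2
    have hzf : z ≠ front x l := by rintro rfl; exact hlx.1 hz1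
    have hold := h (y, z) (by rw [hr, List.zip_cons_cons]; exact List.mem_cons_of_mem _ hy)
    simp only at hold ⊢
    rw [Function.update_of_ne hyx, Function.update_of_ne (by omega),
      Function.update_of_ne (by omega), Function.update_of_ne hyb,
      Function.update_of_ne (by omega), Function.update_of_ne (by omega),
      Function.update_of_ne (by omega), Function.update_of_ne (by omega)]
    exact hold

end GraphletEnum

namespace GraphletEnum

/-! ### The graph in memory, and deletion of vertices -/

/-- The graph `G` as it is laid out in memory. From address `H` on there is a record of four cells
for each vertex, followed by a record of four cells for each of the `M` arcs (an edge gives two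
arcs, which are mates of each other). Four arrays follow: the order of the vertices, the current
connected set, the queue, and the trail. -/
structure Layout {n : ℕ} (G : SimpleGraph (Fin n)) where
  /-- the address of the first record -/
  H : ℕ
  /-- the number of arcs -/
  M : ℕ
  /-- the size of the graphlets -/
  k : ℕ
  /-- the vertex an arc starts from -/
  src : ℕ → Fin n
  /-- the vertex an arc leads to -/
  tgt : ℕ → Fin n
  /-- the reversed arc -/
  mate : ℕ → ℕ
  mate_lt : ∀ a < M, mate a < M
  mate_mate : ∀ a < M, mate (mate a) = a
  src_mate : ∀ a < M, src (mate a) = tgt a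
  tgt_mate : ∀ a < M, tgt (mate a) = src a
  inj : ∀ a < M, ∀ b < M, src a = src b → tgt a = tgt b → a = b
  adj_iff : ∀ u v, G.Adj u v ↔ ∃ a < M, src a = u ∧ tgt a = v

namespace Layout
variable {n : ℕ} {G : SimpleGraph (Fin n)} (L : Layout G)

/-- The address of the record of a vertex: link to the first arc, link to the last arc, mark,
number of the vertex. -/
def va (u : Fin n) : ℕ := L.H + 4 * u.val
/-- The address of the record of an arc: link to the next arc, link to the previous arc, address
of the target, address of the mate. -/
def na (a : ℕ) : ℕ := L.H + 4 * n + 4 * a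
/-- The base address of the array that holds the order of the vertices. -/
def ord : ℕ := L.H + 4 * n + 4 * L.M
/-- The base address of the stack that holds the current connected set. -/
def st : ℕ := L.H + 4 * n + 4 * L.M + n
/-- The base address of the queue. -/
def qb : ℕ := L.H + 4 * n + 4 * L.M + n + n
/-- The base address of the trail. -/
def tr : ℕ := L.H + 4 * n + 4 * L.M + n + n + n

lemma va_inj {u v : Fin n} : L.va u = L.va v ↔ u = v := by
  simp only [va, Fin.ext_iff]; omega

/-- The alive arcs that start from `u`, in the order of their list. -/
def arcs (A : Finset (Fin n)) (u : Fin n) : List ℕ :=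
  (List.range L.M).reverse.filter fun a => L.src a = u ∧ L.tgt a ∈ A

lemma mem_arcs {A : Finset (Fin n)} {u : Fin n} {a : ℕ} :
    a ∈ L.arcs A u ↔ a < L.M ∧ L.src a = u ∧ L.tgt a ∈ A := by
  simp [arcs]

lemma arcs_nodup (A : Finset (Fin n)) (u : Fin n) : (L.arcs A u).Nodup :=
  (List.nodup_reverse.2 List.nodup_range).filter _

lemma map_tgt_nodup {A : Finset (Fin n)} {u : Fin n} : ((L.arcs A u).map L.tgt).Nodup := by
  refine (L.arcs_nodup A u).map_on fun a ha b hb hab => ?_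
  rw [mem_arcs] at ha hb
  exact L.inj a ha.1 b hb.1 (ha.2.1.trans hb.2.1.symm) hab

lemma adj_of_mem_arcs {A : Finset (Fin n)} {u : Fin n} {a : ℕ} (h : a ∈ L.arcs A u) :
    G.Adj u (L.tgt a) := by
  rw [mem_arcs] at h
  exact (L.adj_iff _ _).2 ⟨a, h.1, h.2.1, rfl⟩

lemma exists_mem_arcs {A : Finset (Fin n)} {u v : Fin n} (h : G.Adj u v) (hv : v ∈ A) :
    ∃ a ∈ L.arcs A u, L.tgt a = v := by
  obtain ⟨a, h1, h2, h3⟩ := (L.adj_iff _ _).1 h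
  exact ⟨a, L.mem_arcs.2 ⟨h1, h2, h3 ▸ hv⟩, h3⟩

/-- The list of arcs of `u` in memory is `l`. -/
def ArcList (m : ℕ → ℕ) (u : Fin n) (l : List ℕ) : Prop := Dll m (L.va u) (l.map L.na)

/-- The memory represents the subgraph of `G` that is induced by the alive vertices `A`. -/
structure GraphMem (A : Finset (Fin n)) (m : ℕ → ℕ) : Prop where
  label : ∀ u, m (L.va u + 3) = u
  target : ∀ a < L.M, m (L.na a + 2) = L.va (L.tgt a)
  twin : ∀ a < L.M, m (L.na a + 3) = L.na (L.mate a)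
  lists : ∀ u ∈ A, L.ArcList m u (L.arcs A u)

/-- The node where a traversal of the list of `u` stands, when the arcs `l` remain. -/
def cur (u : Fin n) (l : List ℕ) : ℕ := front (L.va u) (l.map L.na)

/-- The node where a backward traversal of the list of `u` stands, when the arcs `l` remain. -/
def rcur (u : Fin n) (l : List ℕ) : ℕ := back (L.va u) (l.map L.na)

variable {L}

@[simp] lemma cur_nil (u : Fin n) : L.cur u [] = L.va u := rfl
@[simp] lemma cur_cons (u : Fin n) (a : ℕ) (l : List ℕ) : L.cur u (a :: l) = L.na a := rfl
@[simp] lemma rcur_nil (u : Fin n) : L.rcur u [] = L.va u := rfl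
@[simp] lemma rcur_append (u : Fin n) (a : ℕ) (l : List ℕ) : L.rcur u (l ++ [a]) = L.na a := by
  simp [rcur]

lemma ArcList.first {m : ℕ → ℕ} {u : Fin n} {l : List ℕ} (h : L.ArcList m u l) :
    m (L.va u) = L.cur u l := Dll.first h

lemma ArcList.last {m : ℕ → ℕ} {u : Fin n} {l : List ℕ} (h : L.ArcList m u l) :
    m (L.va u + 1) = L.rcur u l := Dll.last h

lemma ArcList.next {m : ℕ → ℕ} {u : Fin n} {p q : List ℕ} {a : ℕ}
    (h : L.ArcList m u (p ++ a :: q)) : m (L.na a) = L.cur u q := by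
  rw [ArcList, List.map_append, List.map_cons] at h; exact h.links.2.2.1

lemma ArcList.prev {m : ℕ → ℕ} {u : Fin n} {p q : List ℕ} {a : ℕ}
    (h : L.ArcList m u (p ++ a :: q)) : m (L.na a + 1) = L.rcur u p := by
  rw [ArcList, List.map_append, List.map_cons] at h; exact h.links.2.1

lemma ArcList.congr {m m' : ℕ → ℕ} {u : Fin n} {l : List ℕ} (h : L.ArcList m u l)
    (h1 : m' (L.va u) = m (L.va u) ∧ m' (L.va u + 1) = m (L.va u + 1))
    (h2 : ∀ a ∈ l, m' (L.na a) = m (L.na a) ∧ m' (L.na a + 1) = m (L.na a + 1)) :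
    L.ArcList m' u l := by
  refine Dll.congr h ?_ ?_
  · intro y hy
    rcases List.mem_cons.1 hy with rfl | hy
    · exact h1.1
    · obtain ⟨a, ha, rfl⟩ := List.mem_map.1 hy; exact (h2 a ha).1
  · intro y hy
    rcases List.mem_cons.1 hy with rfl | hy
    · exact h1.2
    · obtain ⟨a, ha, rfl⟩ := List.mem_map.1 hy; exact (h2 a ha).2

lemma na_inj {a b : ℕ} : L.na a = L.na b ↔ a = b := by simp only [na]; omega

lemma nodes_nodup {u : Fin n} {l : List ℕ} (h : l.Nodup) : (L.va u :: l.map L.na).Nodup := by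
  refine List.nodup_cons.2 ⟨?_, h.map fun a b hab => na_inj.1 hab⟩
  simp only [List.mem_map, not_exists, not_and, na, va]
  intro a _ ha
  have := u.2
  omega

lemma nodes_aligned (u : Fin n) (l : List ℕ) : Aligned L.H (L.va u :: l.map L.na) := by
  intro y hy
  rcases List.mem_cons.1 hy with rfl | hy
  · exact ⟨u, rfl⟩
  · obtain ⟨a, ha, rfl⟩ := List.mem_map.1 hy
    exact ⟨n + a, by simp only [na]; ring⟩

/-- Unlinking writes to link cells of records only. -/
lemma unlink_apply {m : ℕ → ℕ} {u : Fin n} {l : List ℕ} {b : ℕ} (h : L.ArcList m u l)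
    (hb : b ∈ l) {y : ℕ} (hy : unlink m (L.na b) y ≠ m y) :
    y = L.va u ∨ y = L.va u + 1 ∨ ∃ a ∈ l, y = L.na a ∨ y = L.na a + 1 := by
  obtain ⟨p, q, rfl⟩ := List.append_of_mem hb
  rw [ArcList, List.map_append, List.map_cons] at h
  obtain ⟨h1, h2, h3, h4⟩ := h.links
  have hbm := back_mem (L.va u) (p.map L.na)
  have hfm := front_mem (L.va u) (q.map L.na)
  unfold unlink at hy
  rw [h2, h3] at hy
  by_cases hy1 : y = front (L.va u) (q.map L.na) + 1
  · rcases List.mem_cons.1 hfm with he | he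
    · right; left; omega
    · obtain ⟨a, ha, hae⟩ := List.mem_map.1 he
      exact Or.inr (Or.inr ⟨a, by simp [ha], Or.inr (by omega)⟩)
  · rw [Function.update_of_ne hy1] at hy
    by_cases hy2 : y = back (L.va u) (p.map L.na)
    · rcases List.mem_cons.1 hbm with he | he
      · left; omega
      · obtain ⟨a, ha, hae⟩ := List.mem_map.1 he
        exact Or.inr (Or.inr ⟨a, by simp [ha], Or.inl (by omega)⟩)
    · rw [Function.update_of_ne hy2] at hy; exact absurd rfl hy

lemma ArcList.unlink {m : ℕ → ℕ} {u : Fin n} {l : List ℕ} {b : ℕ} (h : L.ArcList m u l)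
    (hl : l.Nodup) (hb : b ∈ l) :
    L.ArcList (unlink m (L.na b)) u (l.filter (· ≠ b)) := by
  obtain ⟨p, q, rfl⟩ := List.append_of_mem hb
  have e : (p ++ b :: q).filter (· ≠ b) = p ++ q := by
    have hl' := hl
    rw [List.nodup_append, List.nodup_cons] at hl'
    rw [List.filter_append, List.filter_cons_of_neg (by simp),
      List.filter_eq_self.2 fun a ha => ?_, List.filter_eq_self.2 fun a ha => ?_]
    · simp only [ne_eq, decide_not, Bool.not_eq_eq_eq_not, Bool.not_true, decide_eq_false_iff_not]
      rintro rfl; exact hl'.2.1.1 ha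
    · simp only [ne_eq, decide_not, Bool.not_eq_eq_eq_not, Bool.not_true, decide_eq_false_iff_not]
      rintro rfl; exact hl'.2.2 _ ha _ (by simp) rfl
  have h1 := nodes_nodup (L := L) (u := u) hl
  have h2 := nodes_aligned (L := L) u (p ++ b :: q)
  rw [e, ArcList, List.map_append]
  rw [ArcList] at h
  rw [List.map_append, List.map_cons] at h h1 h2
  exact h.unlink h1 h2

lemma ArcList.relink_unlink {m : ℕ → ℕ} {u : Fin n} {l : List ℕ} {b : ℕ}
    (h : L.ArcList m u l) (hl : l.Nodup) (hb : b ∈ l) :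
    relink (GraphletEnum.unlink m (L.na b)) (L.na b) = m := by
  obtain ⟨p, q, rfl⟩ := List.append_of_mem hb
  have h1 := nodes_nodup (L := L) (u := u) hl
  have h2 := nodes_aligned (L := L) u (p ++ b :: q)
  rw [ArcList] at h
  rw [List.map_append, List.map_cons] at h h1 h2
  exact h.relink_unlink h1 h2

/-- The memory after the mates of the arcs `l` have been unlinked one after the other. -/
def delMem (L : Layout G) (m : ℕ → ℕ) (l : List ℕ) : ℕ → ℕ :=
  l.foldl (fun m a => GraphletEnum.unlink m (L.na (L.mate a))) m

@[simp] lemma delMem_nil (m : ℕ → ℕ) : L.delMem m [] = m := rfl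

lemma delMem_append (m : ℕ → ℕ) (l : List ℕ) (a : ℕ) :
    L.delMem m (l ++ [a]) = GraphletEnum.unlink (L.delMem m l) (L.na (L.mate a)) := by
  simp [delMem]

/-- A cell that is no link of an arc list of a vertex other than `v`. -/
def NoLink (L : Layout G) (v : Fin n) (y : ℕ) : Prop :=
  (∀ u ≠ v, y ≠ L.va u ∧ y ≠ L.va u + 1) ∧
    ∀ a < L.M, L.src a ≠ v → y ≠ L.na a ∧ y ≠ L.na a + 1

/-- What a partial deletion of the vertex `v` does: its own list stays as it was, and the mates of
the arcs treated so far are missing in the other lists. -/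
lemma delMem_spec {m : ℕ → ℕ} {A : Finset (Fin n)} {v : Fin n} (hv : v ∈ A)
    (h : ∀ u ∈ A, L.ArcList m u (L.arcs A u)) {done rest : List ℕ}
    (hl : L.arcs A v = done ++ rest) :
    (∀ y, L.NoLink v y → L.delMem m done y = m y) ∧
    ∀ u ∈ A, L.ArcList (L.delMem m done) u ((L.arcs A u).filter fun b => L.mate b ∉ done) := by
  induction done using List.reverseRecOn generalizing rest with
  | nil => refine ⟨fun _ _ => rfl, fun u hu => ?_⟩; simpa using h u hu
  | append_singleton done a ih =>
    obtain ⟨ih1, ih2⟩ := ih (rest := a :: rest) (by simpa using hl)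
    have ha : a ∈ L.arcs A v := by rw [hl]; simp
    have ha' := L.mem_arcs.1 ha
    have hnd := L.arcs_nodup A v
    rw [hl, List.append_assoc, List.nodup_append] at hnd
    have hne : L.tgt a ≠ v := fun e => by
      have := L.adj_of_mem_arcs ha; rw [e] at this; exact G.loopless.irrefl _ this
    have hmem : L.mate a ∈ (L.arcs A (L.tgt a)).filter fun b => L.mate b ∉ done := by
      rw [List.mem_filter, L.mem_arcs, L.mate_mate a ha'.1, L.src_mate a ha'.1, L.tgt_mate a ha'.1]
      refine ⟨⟨L.mate_lt a ha'.1, rfl, ha'.2.1 ▸ hv⟩, ?_⟩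
      simp only [decide_eq_true_eq]
      intro hd; exact hnd.2.2 a hd a (by simp) rfl
    have hli := ih2 _ ha'.2.2
    have hfr : ∀ y, L.NoLink (L.tgt a) y ∨ L.NoLink v y →
        GraphletEnum.unlink (L.delMem m done) (L.na (L.mate a)) y = L.delMem m done y ∨
        ¬ L.NoLink v y := by
      intro y hy
      by_contra! hcon
      obtain ⟨h1, h2⟩ := hcon
      rcases unlink_apply hli hmem h1 with h3 | h3 | ⟨b, hb, h3⟩
      · exact (h2.1 _ hne).1 h3
      · exact (h2.1 _ hne).2 h3
      · obtain ⟨hb, -⟩ := List.mem_filter.1 hb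
        rw [L.mem_arcs] at hb
        have := h2.2 b hb.1 (hb.2.1 ▸ hne)
        tauto
    have hmid : ∀ u, u ≠ L.tgt a → ∀ y, (y = L.va u ∨ y = L.va u + 1 ∨
        ∃ b, b < L.M ∧ L.src b = u ∧ (y = L.na b ∨ y = L.na b + 1)) →
        GraphletEnum.unlink (L.delMem m done) (L.na (L.mate a)) y = L.delMem m done y := by
      intro u hu y hy
      by_contra hcon
      have hu' : (u : ℕ) ≠ (L.tgt a : ℕ) := fun e => hu (Fin.ext e)
      have hub := u.2
      have htb := (L.tgt a).2
      rcases unlink_apply hli hmem hcon with h3 | h3 | ⟨c, hc, h3⟩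
      · rcases hy with h4 | h4 | ⟨b, hb, -, h4⟩ <;> simp only [va, na] at h3 h4 <;> omega
      · rcases hy with h4 | h4 | ⟨b, hb, -, h4⟩ <;> simp only [va, na] at h3 h4 <;> omega
      · obtain ⟨hc, -⟩ := List.mem_filter.1 hc
        rw [L.mem_arcs] at hc
        rcases hy with h4 | h4 | ⟨b, hb, hbu, h4⟩
        · simp only [va, na] at h3 h4; omega
        · simp only [va, na] at h3 h4; omega
        · have : b = c := by simp only [na] at h3 h4; omega
          subst this
          exact hu (hbu.symm.trans hc.2.1)
    rw [delMem_append]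
    constructor
    · intro y hy
      rw [← ih1 y hy]
      rcases hfr y (Or.inr hy) with h1 | h1
      · exact h1
      · exact absurd hy h1
    · intro u hu
      have hfilt : (L.arcs A u).filter (fun b => L.mate b ∉ done ++ [a]) =
          ((L.arcs A u).filter fun b => L.mate b ∉ done).filter (· ≠ L.mate a) := by
        rw [List.filter_filter]
        refine List.filter_congr fun b hb => ?_
        rw [L.mem_arcs] at hb
        have : L.mate b = a ↔ b = L.mate a := by
          constructor
          · rintro rfl; rw [L.mate_mate b hb.1]
          · rintro rfl; rw [L.mate_mate a ha'.1]
        simp [this, and_comm]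
      rw [hfilt]
      by_cases hua : u = L.tgt a
      · subst hua
        exact hli.unlink ((L.arcs_nodup _ _).filter _) hmem
      · rw [List.filter_eq_self.2 fun b hb => ?_]
        · refine (ih2 u hu).congr ⟨hmid u hua _ (by tauto), hmid u hua _ (by tauto)⟩ fun b hb => ?_
          obtain ⟨hb, -⟩ := List.mem_filter.1 hb
          rw [L.mem_arcs] at hb
          exact ⟨hmid u hua _ (Or.inr (Or.inr ⟨b, hb.1, hb.2.1, Or.inl rfl⟩)),
            hmid u hua _ (Or.inr (Or.inr ⟨b, hb.1, hb.2.1, Or.inr rfl⟩))⟩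
        · obtain ⟨hb, -⟩ := List.mem_filter.1 hb
          rw [L.mem_arcs] at hb
          simp only [ne_eq, decide_not, Bool.not_eq_eq_eq_not, Bool.not_true,
            decide_eq_false_iff_not]
          rintro rfl
          exact hua (hb.2.1.symm.trans (L.src_mate a ha'.1))

lemma noLink_of_mod {v : Fin n} {y : ℕ} (h : (∃ i, y = L.H + 4 * i + 2) ∨ (∃ i,
  y = L.H + 4 * i + 3) ∨
    L.ord ≤ y ∨ y < L.H) : L.NoLink v y := by
  constructor
  · intro u _
    have := u.2
    rcases h with ⟨i, h⟩ | ⟨i, h⟩ | h | h <;> simp only [va, ord] at h ⊢ <;> omega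
  · intro a ha _
    rcases h with ⟨i, h⟩ | ⟨i, h⟩ | h | h <;> simp only [na, ord] at h ⊢ <;> omega

lemma noLink_self {v : Fin n} : L.NoLink v (L.va v) ∧ L.NoLink v (L.va v + 1) := by
  have hv := v.2
  refine ⟨⟨fun u hu => ?_, fun a ha _ => ?_⟩, ⟨fun u hu => ?_, fun a ha _ => ?_⟩⟩
  all_goals simp only [na, va]; omega

lemma noLink_arc {v : Fin n} {a : ℕ} (hs : L.src a = v) :
    L.NoLink v (L.na a) ∧ L.NoLink v (L.na a + 1) := by
  refine ⟨⟨fun u hu => ?_, fun b hb hbs => ?_⟩, ⟨fun u hu => ?_, fun b hb hbs => ?_⟩⟩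
  all_goals first
    | (have := u.2; simp only [na, va]; omega)
    | (have : a ≠ b := by
         rintro rfl; exact hbs hs
       simp only [na]; omega)

/-- Throughout the deletion of `v` its own list is intact. -/
lemma delMem_self {m : ℕ → ℕ} {A : Finset (Fin n)} {v : Fin n} (hv : v ∈ A)
    (h : ∀ u ∈ A, L.ArcList m u (L.arcs A u)) {done rest : List ℕ}
    (hl : L.arcs A v = done ++ rest) : L.ArcList (L.delMem m done) v (L.arcs A v) := by
  obtain ⟨h1, -⟩ := delMem_spec hv h hl
  refine (h v hv).congr ⟨h1 _ noLink_self.1, h1 _ noLink_self.2⟩ fun a ha => ?_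
  have := noLink_arc (L.mem_arcs.1 ha).2.1
  exact ⟨h1 _ this.1, h1 _ this.2⟩

/-- The list of the mate of an arc of `v` that has not been treated yet. -/
lemma delMem_target {m : ℕ → ℕ} {A : Finset (Fin n)} {v : Fin n} (hv : v ∈ A)
    (h : ∀ u ∈ A, L.ArcList m u (L.arcs A u)) {done rest : List ℕ} {a : ℕ}
    (hl : L.arcs A v = done ++ a :: rest) :
    ∃ l, L.ArcList (L.delMem m done) (L.tgt a) l ∧ l.Nodup ∧ L.mate a ∈ l ∧ ∀ b ∈ l, b < L.M := by
  have ha : a ∈ L.arcs A v := by rw [hl]; simp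
  have ha' := L.mem_arcs.1 ha
  have hnd := L.arcs_nodup A v
  rw [hl, List.nodup_append] at hnd
  refine ⟨_, (delMem_spec hv h hl).2 _ ha'.2.2, (L.arcs_nodup _ _).filter _, ?_, ?_⟩
  · rw [List.mem_filter, L.mem_arcs, L.mate_mate a ha'.1, L.src_mate a ha'.1, L.tgt_mate a ha'.1]
    refine ⟨⟨L.mate_lt a ha'.1, rfl, ha'.2.1 ▸ hv⟩, ?_⟩
    simp only [decide_eq_true_eq]
    intro hd; exact hnd.2.2 a hd a (by simp) rfl
  · intro b hb; exact (L.mem_arcs.1 (List.mem_filter.1 hb).1).1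

/-- Unlinking the mates of the arcs of `v` deletes `v`. The list of `v` itself stays; it is of no
concern once `v` is not alive. -/
lemma GraphMem.delete {m : ℕ → ℕ} {A : Finset (Fin n)} {v : Fin n} (hv : v ∈ A)
    (h : L.GraphMem A m) : L.GraphMem (A.erase v) (L.delMem m (L.arcs A v)) := by
  obtain ⟨h1, h2⟩ := delMem_spec hv h.lists (rest := []) (List.append_nil _).symm
  refine ⟨fun u => ?_, fun a ha => ?_, fun a ha => ?_, fun u hu => ?_⟩
  · rw [h1 (L.va u + 3) (noLink_of_mod (Or.inr (Or.inl ⟨u, rfl⟩))), h.label]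
  · rw [h1 _ (noLink_of_mod (Or.inl ⟨n + a, by simp only [na]; ring⟩)), h.target a ha]
  · rw [h1 _ (noLink_of_mod (Or.inr (Or.inl ⟨n + a, by simp only [na]; ring⟩))), h.twin a ha]
  · convert h2 u (Finset.mem_of_mem_erase hu) using 1
    unfold arcs
    rw [List.filter_filter]
    refine List.filter_congr fun b hb => ?_
    have hb : b < L.M := by simpa using hb
    have := Finset.mem_of_mem_erase hu
    simp only [Finset.mem_erase, List.mem_filter, List.mem_reverse, List.mem_range,
      L.src_mate b hb, L.tgt_mate b hb, decide_eq_true_eq, ← Bool.decide_and]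
    congr 1
    have := L.mate_lt b hb
    simp only [eq_iff_iff]
    constructor
    · rintro ⟨rfl, h3, h4⟩; exact ⟨by tauto, rfl, h4⟩
    · rintro ⟨h3, rfl, h4⟩; exact ⟨rfl, by tauto, h4⟩

end Layout
end GraphletEnum

namespace GraphletEnum

/-! ### Deletion and its reversal as programs -/

/-- The registers that hold constants during the enumeration. -/
structure Base {n : ℕ} {G : SimpleGraph (Fin n)} (L : Layout G) (s : State) : Prop where
  r0 : s.reg 0 = 0
  r1 : s.reg 1 = 1
  r2 : s.reg 2 = n
  r3 : s.reg 3 = L.k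
  r4 : s.reg 4 = L.H
  r5 : s.reg 5 = L.H + 4 * n - 1
  r6 : s.reg 6 = L.ord
  r7 : s.reg 7 = L.st
  r8 : s.reg 8 = L.qb
  r9 : s.reg 9 = L.tr
  r10 : s.reg 10 = L.st + (L.k - 1)
  r11 : s.reg 11 = L.qb + L.k
  r12 : s.reg 12 = 2
  r13 : s.reg 13 = 3

/-- The machine is large enough. -/
structure Fits {n : ℕ} {G : SimpleGraph (Fin n)} (L : Layout G) (cells w : ℕ) : Prop where
  mem_le : L.tr + 2 * n + 8 ≤ cells
  word_le : cells + L.k + 8 ≤ 2 ^ w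
  two_le : 2 ≤ L.k
  le : L.k ≤ n

variable {n : ℕ} {G : SimpleGraph (Fin n)} {L : Layout G} {cells w : ℕ}

lemma Base.congr {s s' : State} (h : Base L s) (h' : ∀ r < 14, s'.reg r = s.reg r) :
    Base L s' := by
  constructor <;> rw [h' _ (by norm_num)]
  exacts [h.r0, h.r1, h.r2, h.r3, h.r4, h.r5, h.r6, h.r7, h.r8, h.r9, h.r10, h.r11, h.r12, h.r13]

lemma Layout.va_lt (L : Layout G) (u : Fin n) : L.va u + 3 < L.H + 4 * n := by
  have := u.2; simp only [Layout.va]; omega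

lemma Layout.le_va (L : Layout G) (u : Fin n) : L.H ≤ L.va u := by
  simp only [Layout.va]; omega

lemma Layout.na_lt (L : Layout G) {a : ℕ} (h : a < L.M) : L.na a + 3 < L.ord := by
  simp only [Layout.na, Layout.ord]; omega

lemma Layout.le_na (L : Layout G) (a : ℕ) : L.H + 4 * n ≤ L.na a := by
  simp only [Layout.na]; omega

lemma Layout.hdr_le_ord (L : Layout G) : L.H + 4 * n ≤ L.ord := by
  simp only [Layout.ord]; omega

lemma Layout.cur_lt {u : Fin n} {l : List ℕ} (h : ∀ a ∈ l, a < L.M) : L.cur u l + 3 < L.ord := by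
  cases l with
  | nil => exact (L.va_lt u).trans_le L.hdr_le_ord
  | cons a l => exact L.na_lt (h a (by simp))

lemma Layout.rcur_lt {u : Fin n} {l : List ℕ} (h : ∀ a ∈ l, a < L.M) : L.rcur u l + 3 < L.ord := by
  cases l using List.reverseRecOn with
  | nil => exact (L.va_lt u).trans_le L.hdr_le_ord
  | append_singleton l a => rw [Layout.rcur_append]; exact L.na_lt (h a (by simp))

lemma Layout.cur_sub {u : Fin n} {l : List ℕ} :
    L.cur u l - (L.H + 4 * n - 1) = 0 ↔ l = [] := by
  cases l with
  | nil => have := L.va_lt u; simp; omega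
  | cons a l => have := L.le_na a; have := u.2; simp; omega

lemma Layout.rcur_sub {u : Fin n} {l : List ℕ} :
    L.rcur u l - (L.H + 4 * n - 1) = 0 ↔ l = [] := by
  cases l using List.reverseRecOn with
  | nil => have := L.va_lt u; simp; omega
  | append_singleton l a => have := L.le_na a; have := u.2; simp; omega

lemma Layout.ord_lt (hF : Fits L cells w) : L.ord < cells ∧ cells + 8 ≤ 2 ^ w := by
  have := hF.mem_le; have := hF.word_le
  simp only [Layout.ord, Layout.tr] at *; omega

lemma Layout.ArcList.links_lt {m : ℕ → ℕ} {u : Fin n} {l : List ℕ} {b : ℕ}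
    (h : L.ArcList m u l) (hb : b ∈ l) (hl : ∀ a ∈ l, a < L.M) :
    m (L.na b) + 3 < L.ord ∧ m (L.na b + 1) + 3 < L.ord := by
  obtain ⟨p, q, rfl⟩ := List.append_of_mem hb
  rw [h.next, h.prev]
  exact ⟨Layout.cur_lt fun a ha => hl a (by simp [ha]),
    Layout.rcur_lt fun a ha => hl a (by simp [ha])⟩

/-- Delete the vertex whose record has its address in register 25: unlink the mates of its
arcs. -/
def deleteC : Cmd :=
  (.load 20 25 ;; .sub 24 20 5) ;; .loop 24
    (.add 26 20 13 ;; .load 27 26 ;; .load 28 27 ;; .add 26 27 1 ;; .load 29 26 ;;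
      .store 29 28 ;; .add 26 28 1 ;; .store 26 29 ;; .load 20 20 ;; .sub 24 20 5)

lemma deleteC_spec (hF : Fits L cells w) {s : State} (hB : Base L s) {A : Finset (Fin n)}
    (hG : L.GraphMem A s.mem) {v : Fin n} (hv : v ∈ A) (hr : s.reg 25 = L.va v) :
    Halts cells w deleteC s (11 * (L.arcs A v).length + 3) (fun s' =>
      s'.mem = L.delMem s.mem (L.arcs A v) ∧ s'.out = s.out ∧ ∀ r < 20, s'.reg r = s.reg r) := by
  have hv1 := L.va_lt v
  have hord := Layout.ord_lt hF
  have hh := L.hdr_le_ord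
  have hM : ∀ a ∈ L.arcs A v, a < L.M := fun a ha => (L.mem_arcs.1 ha).1
  refine (Halts.wp_seq (B := 11 * (L.arcs A v).length + 1) (P := fun s' =>
      s'.mem = L.delMem s.mem (L.arcs A v) ∧ s'.out = s.out ∧ ∀ r < 20, s'.reg r = s.reg r)
      ?_).mono (by simp only [Cmd.size]; omega) (fun _ h => h)
  simp only [wp, hr]
  refine ⟨by omega, ?_⟩
  refine (Halts.loop (T₀ := 0) (B := 11 * (L.arcs A v).length)
    (fun T s' => ∃ done rest, L.arcs A v = done ++ rest ∧ T = 11 * done.length ∧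
      s'.mem = L.delMem s.mem done ∧ s'.out = s.out ∧ (∀ r < 20, s'.reg r = s.reg r) ∧
      s'.reg 20 = L.cur v rest ∧ s'.reg 24 = L.cur v rest - (L.H + 4 * n - 1)) ?_ ?_ ?_).mono
      le_rfl ?_
  · refine ⟨[], L.arcs A v, rfl, rfl, rfl, rfl, ?_, ?_, ?_⟩
    · intro r hr
      simp [show r ≠ 24 by omega, show r ≠ 20 by omega]
    · simp [(hG.lists v hv).first]
    · simp [(hG.lists v hv).first, hB.r5]
  · rintro T s' ⟨done, rest, h1, rfl, -⟩
    rw [h1]; simp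
  · rintro T s' ⟨done, rest, h1, rfl, h2, h3, h4, h5, h6⟩ h7
    have hB' : Base L s' := hB.congr fun r hr => h4 r (by omega)
    cases rest with
    | nil => exact absurd (h6.trans (Layout.cur_sub.2 rfl)) h7
    | cons a rest =>
      have ha : a ∈ L.arcs A v := by rw [h1]; simp
      have ha' := L.mem_arcs.1 ha
      obtain ⟨e1, -⟩ := Layout.delMem_spec hv hG.lists h1
      obtain ⟨l, l1, l2, l3, l4⟩ := Layout.delMem_target hv hG.lists h1
      have l5 := l1.links_lt l3 l4
      have hself := Layout.delMem_self (done := done ++ [a]) (rest := rest) hv hG.lists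
        (by simpa using h1)
      rw [show L.arcs A v = done ++ a :: rest from h1] at hself
      have hnext := hself.next
      rw [Layout.delMem_append] at hnext
      have htw : s'.mem (L.na a + 3) = L.na (L.mate a) := by
        rw [h2, e1 (L.na a + 3) (Layout.noLink_of_mod (Or.inr (Or.inl ⟨n + a,
          by simp only [Layout.na]; ring⟩))),
          hG.twin a ha'.1]
      have na1 := L.na_lt ha'.1
      have na2 := L.na_lt (L.mate_lt a ha'.1)
      rw [← h2] at l5 hnext
      refine ⟨_, Halts.of_wp ?_⟩
      rw [Layout.cur_cons] at h5
      simp [wp, h5, hB'.r13, hB'.r1, hB'.r5, htw]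
      have hun : Function.update (Function.update s'.mem (s'.mem (L.na (L.mate a) + 1))
        (s'.mem (L.na (L.mate a)))) (s'.mem (L.na (L.mate a)) + 1)
        (s'.mem (L.na (L.mate a) + 1)) = unlink s'.mem (L.na (L.mate a)) := rfl
      refine ⟨by omega, by omega, by omega, by omega, by omega, by omega, by omega, by omega,
        by omega, done ++ [a], rest, by simpa using h1, ?_, ?_, h3, ?_, ?_, ?_⟩
      · simp [Cmd.size]; ring
      · rw [hun, Layout.delMem_append, h2]
      · intro r hr
        repeat rw [Function.update_of_ne (by omega)]
        exact h4 r hr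
      · rw [hun, hnext]
      · rw [hun, hnext]
  · rintro s' ⟨h0, T, done, rest, h1, rfl, h2, h3, h4, h5, h6⟩
    rw [h0] at h6
    have := Layout.cur_sub.1 h6.symm
    subst this
    rw [List.append_nil] at h1
    exact ⟨by rw [h2, h1], h3, h4⟩

/-- Revert the deletion of the vertex whose record has its address in register 25, by putting the
mates of its arcs back in the opposite order. -/
def undeleteC : Cmd :=
  (.add 26 25 1 ;; .load 20 26 ;; .sub 24 20 5) ;; .loop 24
    (.add 26 20 13 ;; .load 27 26 ;; .load 28 27 ;; .add 26 27 1 ;; .load 29 26 ;;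
      .store 29 27 ;; .add 26 28 1 ;; .store 26 27 ;; .add 26 20 1 ;; .load 20 26 ;; .sub 24 20 5)

/-- The cells below the order are restored exactly to what they were before the deletion. -/
lemma undeleteC_spec (hF : Fits L cells w) {s : State} (hB : Base L s) {A : Finset (Fin n)}
    {m : ℕ → ℕ} (hG : L.GraphMem A m) {v : Fin n} (hv : v ∈ A) (hr : s.reg 25 = L.va v)
    (hm : ∀ y < L.ord, s.mem y = L.delMem m (L.arcs A v) y) :
    Halts cells w undeleteC s (12 * (L.arcs A v).length + 4) (fun s' =>
      (∀ y < L.ord, s'.mem y = m y) ∧ (∀ y, L.ord ≤ y → s'.mem y = s.mem y) ∧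
      s'.out = s.out ∧ ∀ r < 20, s'.reg r = s.reg r) := by
  have hv1 := L.va_lt v
  have hord := Layout.ord_lt hF
  have hh := L.hdr_le_ord
  have hM : ∀ a ∈ L.arcs A v, a < L.M := fun a ha => (L.mem_arcs.1 ha).1
  have hlast : s.mem (L.va v + 1) = L.rcur v (L.arcs A v) := by
    rw [hm _ (by omega)]
    exact (Layout.delMem_self hv hG.lists (List.append_nil _).symm).last
  refine (Halts.wp_seq (B := 12 * (L.arcs A v).length + 1) (P := fun s' =>
      (∀ y < L.ord, s'.mem y = m y) ∧ (∀ y, L.ord ≤ y → s'.mem y = s.mem y) ∧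
      s'.out = s.out ∧ ∀ r < 20, s'.reg r = s.reg r)
      ?_).mono (by simp only [Cmd.size]; omega) (fun _ h => h)
  simp [wp, hr, hB.r1]
  refine ⟨by omega, by omega, ?_⟩
  refine (Halts.loop (T₀ := 0) (B := 12 * (L.arcs A v).length)
    (fun T s' => ∃ done rest, L.arcs A v = done ++ rest ∧ T = 12 * rest.length ∧
      (∀ y < L.ord, s'.mem y = L.delMem m done y) ∧ (∀ y, L.ord ≤ y → s'.mem y = s.mem y) ∧
      s'.out = s.out ∧ (∀ r < 20, s'.reg r = s.reg r) ∧
      s'.reg 20 = L.rcur v done ∧ s'.reg 24 = L.rcur v done - (L.H + 4 * n - 1)) ?_ ?_ ?_).mono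
      le_rfl ?_
  · refine ⟨L.arcs A v, [], by simp, rfl, hm, fun _ _ => rfl, rfl, ?_, ?_, ?_⟩
    · intro r hr
      simp [show r ≠ 24 by omega, show r ≠ 20 by omega,
        show r ≠ 26 by omega]
    · simp [hlast]
    · simp [hlast, hB.r5]
  · rintro T s' ⟨done, rest, h1, rfl, -⟩
    rw [h1]; simp
  · rintro T s' ⟨done, rest, h1, rfl, h2, h2', h3, h4, h5, h6⟩ h7
    have hB' : Base L s' := hB.congr fun r hr => h4 r (by omega)
    cases done using List.reverseRecOn with
    | nil => exact absurd (h6.trans (Layout.rcur_sub.2 rfl)) h7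
    | append_singleton done a =>
      have h1' : L.arcs A v = done ++ a :: rest := by simpa using h1
      have ha : a ∈ L.arcs A v := by rw [h1]; simp
      have ha' := L.mem_arcs.1 ha
      obtain ⟨e1, -⟩ := Layout.delMem_spec hv hG.lists h1
      obtain ⟨l, l1, l2, l3, l4⟩ := Layout.delMem_target hv hG.lists h1'
      have l5 := l1.links_lt l3 l4
      have hself := Layout.delMem_self hv hG.lists h1'
      have hrel := l1.relink_unlink l2 l3
      rw [← Layout.delMem_append] at hrel
      have na1 := L.na_lt ha'.1
      have na2 := L.na_lt (L.mate_lt a ha'.1)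
      have htw : s'.mem (L.na a + 3) = L.na (L.mate a) := by
        rw [h2 _ na1, e1 (L.na a + 3) (Layout.noLink_of_mod (Or.inr (Or.inl ⟨n + a,
          by simp only [Layout.na]; ring⟩))),
          hG.twin a ha'.1]
      have hlk : s'.mem (L.na (L.mate a)) = L.delMem m done (L.na (L.mate a)) ∧
          s'.mem (L.na (L.mate a) + 1) = L.delMem m done (L.na (L.mate a) + 1) := by
        rw [h2 _ (by omega), h2 _ (by omega)]
        obtain ⟨p, q, rfl⟩ := List.append_of_mem l3
        have hnd := Layout.nodes_nodup (L := L) (u := L.tgt a) l2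
        have hal := Layout.nodes_aligned (L := L) (L.tgt a) (p ++ L.mate a :: q)
        rw [Layout.delMem_append]
        have l1' := l1
        rw [Layout.ArcList] at l1'
        rw [List.map_append, List.map_cons] at l1' hnd hal
        obtain ⟨g1, g2, g3, g4⟩ := l1'.links
        obtain ⟨i1, hi1⟩ := hal (L.na (L.mate a)) (by simp)
        have hb1 := back_mem (L.va (L.tgt a)) (p.map L.na)
        have hf1 := front_mem (L.va (L.tgt a)) (q.map L.na)
        obtain ⟨i2, hi2⟩ := hal (back (L.va (L.tgt a)) (p.map L.na)) (by
          rw [List.mem_cons] at hb1 ⊢; rw [List.mem_append]; tauto)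
        obtain ⟨i3, hi3⟩ := hal (front (L.va (L.tgt a)) (q.map L.na)) (by
          rw [List.mem_cons] at hf1 ⊢; rw [List.mem_append, List.mem_cons]; tauto)
        have n1 : L.na (L.mate a) ≠ back (L.va (L.tgt a)) (p.map L.na) := by
          intro he
          rw [← he, List.mem_cons] at hb1
          rw [List.nodup_cons, List.nodup_append] at hnd
          rcases hb1 with hb1 | hb1
          · apply hnd.1; rw [← hb1]; simp
          · exact hnd.2.2.2 _ hb1 _ (by simp) rfl
        have n2 : L.na (L.mate a) ≠ front (L.va (L.tgt a)) (q.map L.na) := by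
          intro he
          rw [← he, List.mem_cons] at hf1
          rw [List.nodup_cons, List.nodup_append, List.nodup_cons] at hnd
          rcases hf1 with hf1 | hf1
          · apply hnd.1; rw [← hf1]; simp
          · exact hnd.2.2.1.1 hf1
        unfold unlink
        rw [g2, g3]
        constructor
        · rw [Function.update_of_ne (by omega), Function.update_of_ne n1, g3]
        · rw [Function.update_of_ne (by omega), Function.update_of_ne (by omega), g2]
      rw [← hlk.1, ← hlk.2] at l5
      have hprev : s'.mem (L.na a + 1) = L.delMem m (done ++ [a]) (L.na a + 1) := h2 _ (by omega)
      have hfin : ∀ y < L.ord, relink s'.mem (L.na (L.mate a)) y = L.delMem m done y := by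
        intro y hy
        rw [← hrel]
        unfold relink
        rw [← h2 _ (show L.na (L.mate a) < L.ord by omega),
          ← h2 _ (show L.na (L.mate a) + 1 < L.ord by omega)]
        simp only [Function.update_apply]
        rw [h2 y hy]
      have hfin' : ∀ y, L.ord ≤ y → relink s'.mem (L.na (L.mate a)) y = s'.mem y := by
        intro y hy
        unfold relink
        rw [Function.update_of_ne (by omega), Function.update_of_ne (by omega)]
      have hnext : relink s'.mem (L.na (L.mate a)) (L.na a + 1) = L.rcur v done := by
        rw [hfin _ (by omega)]
        have := hself
        rw [h1'] at this
        exact this.prev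
      rw [Layout.rcur_append] at h5
      refine ⟨_, Halts.of_wp ?_⟩
      simp [wp, h5, hB'.r13, hB'.r1, hB'.r5, htw]
      have hun : Function.update (Function.update s'.mem (s'.mem (L.na (L.mate a) + 1))
        (L.na (L.mate a))) (s'.mem (L.na (L.mate a)) + 1)
        (L.na (L.mate a)) = relink s'.mem (L.na (L.mate a)) := rfl
      refine ⟨by omega, by omega, by omega, by omega, by omega, by omega, by omega, by omega,
        by omega, by omega, done, a :: rest, h1', ?_, ?_, ?_, h3, ?_, ?_, ?_⟩
      · simp [Cmd.size]; ring
      · rw [hun]; exact hfin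
      · intro y hy
        rw [hun, hfin' y hy, h2' y hy]
      · intro r hr
        repeat rw [Function.update_of_ne (by omega)]
        exact h4 r hr
      · rw [hun, hnext]
      · rw [hun, hnext]
  · rintro s' ⟨h0, T, done, rest, h1, rfl, h2, h2', h3, h4, h5, h6⟩
    rw [h0] at h6
    have := Layout.rcur_sub.1 h6.symm
    subst this
    exact ⟨h2, h2', h3, h4⟩

end GraphletEnum

namespace GraphletEnum

/-! ### Arrays, marks and output -/

variable {n : ℕ} {G : SimpleGraph (Fin n)} {L : Layout G} {cells w : ℕ}

namespace Layout

/-- From address `b` on, the memory holds the addresses of the records of the vertices in `l`. -/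
def Arr (L : Layout G) (m : ℕ → ℕ) (b : ℕ) (l : List (Fin n)) : Prop :=
  ∀ i (h : i < l.length), m (b + i) = L.va l[i]

/-- The marked vertices are those in `D`. -/
def Marks (L : Layout G) (m : ℕ → ℕ) (D : Finset (Fin n)) : Prop :=
  ∀ u, m (L.va u + 2) = if u ∈ D then 1 else 0

/-- The memories agree outside of the marks and of the cells from `p` up to the trail. -/
def Frame (L : Layout G) (p : ℕ) (m m' : ℕ → ℕ) : Prop :=
  ∀ x, x < p ∨ L.tr ≤ x → (∀ u, x ≠ L.va u + 2) → m' x = m x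

lemma Frame.rfl {p : ℕ} {m : ℕ → ℕ} : L.Frame p m m := fun _ _ _ => Eq.refl _

lemma Frame.trans {p p' : ℕ} {m m' m'' : ℕ → ℕ} (h : L.Frame p m m') (h' : L.Frame p' m' m'')
    (hp : p ≤ p') : L.Frame p m m'' := fun x hx hu => by
  rw [h' x (by omega) hu, h x hx hu]

lemma Frame.mono {p p' : ℕ} {m m' : ℕ → ℕ} (h : L.Frame p m m') (hp : p' ≤ p) :
    L.Frame p' m m' := fun x hx hu => h x (by omega) hu

/-- A write to a mark or to a cell of the scratch area. -/
lemma Frame.update {p x v : ℕ} {m m' : ℕ → ℕ} (h : L.Frame p m m')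
    (hx : (p ≤ x ∧ x < L.tr) ∨ ∃ u, x = L.va u + 2) :
    L.Frame p m (Function.update m' x v) := fun y hy hu => by
  rw [Function.update_of_ne, h y hy hu]
  rintro rfl
  rcases hx with hx | ⟨u, hx⟩
  · omega
  · exact hu u hx

lemma Arr.nil (m : ℕ → ℕ) (b : ℕ) : L.Arr m b [] := fun i h => by simp at h

lemma Arr.congr {m m' : ℕ → ℕ} {b : ℕ} {l : List (Fin n)} (h : L.Arr m b l)
    (h' : ∀ i < l.length, m' (b + i) = m (b + i)) : L.Arr m' b l := fun i hi => by
  rw [h' i hi, h i hi]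

lemma Arr.update {m : ℕ → ℕ} {b x v : ℕ} {l : List (Fin n)} (h : L.Arr m b l)
    (h' : x < b ∨ b + l.length ≤ x) : L.Arr (Function.update m x v) b l :=
  h.congr fun i hi => Function.update_of_ne (by omega) _ _

lemma Arr.concat {m : ℕ → ℕ} {b : ℕ} {l : List (Fin n)} {u : Fin n} (h : L.Arr m b l)
    (h' : m (b + l.length) = L.va u) : L.Arr m b (l ++ [u]) := fun i hi => by
  rw [List.length_append, List.length_singleton] at hi
  by_cases hi' : i < l.length
  · rw [List.getElem_append_left hi', h i hi']
  · obtain rfl : i = l.length := by omega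
    simp [h']

lemma Arr.push {m : ℕ → ℕ} {b x : ℕ} {l : List (Fin n)} {u : Fin n} (h : L.Arr m b l)
    (hx : x = b + l.length) : L.Arr (Function.update m x (L.va u)) b (l ++ [u]) :=
  (h.update (Or.inr hx.ge)).concat (by rw [hx, Function.update_self])

lemma Arr.of_prefix {m : ℕ → ℕ} {b : ℕ} {l l' : List (Fin n)} (h : L.Arr m b l)
    (hp : l' <+: l) : L.Arr m b l' := by
  obtain ⟨r, rfl⟩ := hp
  intro i hi
  rw [h i (by rw [List.length_append]; omega), List.getElem_append_left hi]

lemma Arr.frame {m m' : ℕ → ℕ} {b p : ℕ} {l : List (Fin n)} (h : L.Arr m b l)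
    (hf : L.Frame p m m') (hb : L.ord ≤ b) (hp : b + l.length ≤ p) : L.Arr m' b l :=
  h.congr fun i hi => hf _ (by omega) fun u => by
    have := L.va_lt u; have := L.hdr_le_ord; omega

lemma Marks.frame_update {m : ℕ → ℕ} {D : Finset (Fin n)} (h : L.Marks m D) {x v : ℕ}
    (hx : L.ord ≤ x) : L.Marks (Function.update m x v) D := fun u => by
  have := L.va_lt u; have := L.hdr_le_ord
  rw [Function.update_of_ne (by omega), h u]

lemma Marks.insert {m : ℕ → ℕ} {D : Finset (Fin n)} (h : L.Marks m D) (u : Fin n) :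
    L.Marks (Function.update m (L.va u + 2) 1) (insert u D) := fun v => by
  by_cases hv : v = u
  · subst hv; simp
  · have : L.va v ≠ L.va u := fun e => hv (L.va_inj.1 e)
    rw [Function.update_of_ne (by omega), h v]
    simp [hv]

lemma Marks.erase {m : ℕ → ℕ} {D : Finset (Fin n)} (h : L.Marks m D) (u : Fin n) :
    L.Marks (Function.update m (L.va u + 2) 0) (D.erase u) := fun v => by
  by_cases hv : v = u
  · subst hv; simp
  · have : L.va v ≠ L.va u := fun e => hv (L.va_inj.1 e)
    rw [Function.update_of_ne (by omega), h v]
    simp [hv]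

lemma GraphMem.congr {A : Finset (Fin n)} {m m' : ℕ → ℕ} (h : L.GraphMem A m)
    (h' : ∀ x < L.ord, (∀ u, x ≠ L.va u + 2) → m' x = m x) : L.GraphMem A m' := by
  have h1 := L.hdr_le_ord
  have hva : ∀ u, ∀ i < 4, i ≠ 2 → m' (L.va u + i) = m (L.va u + i) := fun u i hi hi2 => by
    have := L.va_lt u
    refine h' _ (by omega) fun v => ?_
    simp only [Layout.va]; omega
  have hna : ∀ a < L.M, ∀ i < 4, m' (L.na a + i) = m (L.na a + i) := fun a ha i hi => by
    have := L.na_lt ha; have := L.le_na a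
    refine h' _ (by omega) fun v => ?_
    have := L.va_lt v; omega
  refine ⟨fun u => ?_, fun a ha => ?_, fun a ha => ?_, fun u hu => ?_⟩
  · rw [hva u 3 (by norm_num) (by norm_num), h.label]
  · rw [hna a ha 2 (by norm_num), h.target a ha]
  · rw [hna a ha 3 (by norm_num), h.twin a ha]
  · refine (h.lists u hu).congr ⟨hva u 0 (by norm_num) (by norm_num),
      hva u 1 (by norm_num) (by norm_num)⟩ fun a ha => ?_
    have ha := (L.mem_arcs.1 ha).1
    exact ⟨hna a ha 0 (by norm_num), hna a ha 1 (by norm_num)⟩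

lemma GraphMem.frame {A : Finset (Fin n)} {m m' : ℕ → ℕ} {p : ℕ} (h : L.GraphMem A m)
    (h' : L.Frame p m m') (hp : L.ord ≤ p) : L.GraphMem A m' :=
  h.congr fun x hx hu => h' x (by omega) hu

lemma order (L : Layout G) : L.st = L.ord + n ∧ L.qb = L.st + n ∧ L.tr = L.qb + n :=
  ⟨rfl, rfl, rfl⟩

end Layout

open Layout

/-- Copy the current connected set to the queue, and mark its vertices. -/
def copyC : Cmd :=
  (.add 30 7 0 ;; .add 22 8 0 ;; .sub 24 14 30) ;; .loop 24
    (.load 27 30 ;; .add 26 27 12 ;; .store 26 1 ;; .store 22 27 ;; .add 30 30 1 ;;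
      .add 22 22 1 ;; .sub 24 14 30)

lemma copyC_spec (hF : Fits L cells w) {s : State} (hB : Base L s) {S : List (Fin n)}
    (hS : L.Arr s.mem L.st S) (hn : S.length ≤ n) (h14 : s.reg 14 = L.st + S.length)
    (hM : L.Marks s.mem ∅) :
    Halts cells w copyC s (8 * S.length + 4) (fun s' =>
      L.Arr s'.mem L.qb S ∧ L.Marks s'.mem S.toFinset ∧ L.Frame L.qb s.mem s'.mem ∧
      s'.reg 22 = L.qb + S.length ∧ s'.out = s.out ∧ ∀ r < 20, s'.reg r = s.reg r) := by
  have h1 := hF.mem_le; have h2 := hF.word_le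
  obtain ⟨o1, o2, o3⟩ := L.order
  have hh := L.hdr_le_ord
  refine (Halts.wp_seq (B := 8 * S.length + 1) (P := fun s' =>
      L.Arr s'.mem L.qb S ∧ L.Marks s'.mem S.toFinset ∧ L.Frame L.qb s.mem s'.mem ∧
      s'.reg 22 = L.qb + S.length ∧ s'.out = s.out ∧ ∀ r < 20, s'.reg r = s.reg r)
      ?_).mono (by simp only [Cmd.size]; omega) (fun _ h => h)
  simp [wp, hB.r0, hB.r7, hB.r8, h14]
  refine ⟨by omega, by omega, ?_⟩
  refine (Halts.loop (T₀ := 0) (B := 8 * S.length)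
    (fun T s' => ∃ p q, S = p ++ q ∧ T = 8 * p.length ∧ L.Arr s'.mem L.qb p ∧
      L.Marks s'.mem p.toFinset ∧ L.Frame L.qb s.mem s'.mem ∧
      s'.reg 22 = L.qb + p.length ∧ s'.reg 30 = L.st + p.length ∧ s'.reg 24 = q.length ∧
      s'.out = s.out ∧ ∀ r < 20, s'.reg r = s.reg r) ?_ ?_ ?_).mono le_rfl ?_
  · refine ⟨[], S, rfl, rfl, Arr.nil _ _, by simpa using hM, Frame.rfl, by simp, by simp, by simp,
      rfl, fun r hr => ?_⟩
    simp [show r ≠ 24 by omega, show r ≠ 22 by omega, show r ≠ 30 by omega]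
  · rintro T s' ⟨p, q, rfl, rfl, -⟩
    simp
  · rintro T s' ⟨p, q, hpq, rfl, i1, i2, i3, i4, i5, i6, i7, i8⟩ h7
    have hB' : Base L s' := hB.congr fun r hr => i8 r (by omega)
    cases q with
    | nil => simp at i6; omega
    | cons x q =>
      have hlen := congrArg List.length hpq
      simp only [List.length_append, List.length_cons] at hlen
      have hx : s'.mem (L.st + p.length) = L.va x := by
        have := hS.frame i3 (by omega) (by omega) p.length (by omega)
        simpa [hpq] using this
      have hxlt := L.va_lt x
      refine ⟨_, Halts.of_wp ?_⟩
      simp [wp, i5, hx, hB'.r12, hB'.r1, i4, i8 14]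
      refine ⟨by omega, by omega, by omega, by omega, by omega, by omega, p ++ [x], q,
        by simpa using hpq, ?_, ?_, ?_, ?_, ?_, ?_, ?_, ?_, ?_⟩
      · simp [Cmd.size]; ring
      · exact (i1.update (by omega)).push rfl
      · rw [List.toFinset_append]
        have := (i2.insert x).frame_update (x := L.qb + p.length) (v := L.va x) (by omega)
        convert this using 1
        ext; simp
      · exact (i3.update (Or.inr ⟨x, rfl⟩)).update (Or.inl (by omega))
      · simp; omega
      · simp; omega
      · omega
      · exact i7
      · intro r hr
        repeat rw [Function.update_of_ne (by omega)]
        exact i8 r hr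
  · rintro s' ⟨h0, T, p, q, hpq, rfl, i1, i2, i3, i4, i5, i6, i7, i8⟩
    rw [h0] at i6
    obtain rfl := List.length_eq_zero_iff.1 i6.symm
    rw [List.append_nil] at hpq
    subst hpq
    exact ⟨i1, i2, i3, i4, i7, i8⟩

/-- Remove the marks of the vertices in the queue. -/
def clearC : Cmd :=
  (.add 30 8 0 ;; .sub 24 22 30) ;; .loop 24
    (.load 27 30 ;; .add 26 27 12 ;; .store 26 0 ;; .add 30 30 1 ;; .sub 24 22 30)

lemma clearC_spec (hF : Fits L cells w) {s : State} (hB : Base L s) {Q : List (Fin n)}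
    (hQ : L.Arr s.mem L.qb Q) (hn : Q.length ≤ n) (h22 : s.reg 22 = L.qb + Q.length)
    {D : Finset (Fin n)} (hM : L.Marks s.mem D) :
    Halts cells w clearC s (6 * Q.length + 3) (fun s' =>
      L.Arr s'.mem L.qb Q ∧ L.Marks s'.mem (D \ Q.toFinset) ∧ L.Frame L.qb s.mem s'.mem ∧
      s'.out = s.out ∧ (∀ r < 24, s'.reg r = s.reg r)) := by
  have h1 := hF.mem_le; have h2 := hF.word_le
  obtain ⟨o1, o2, o3⟩ := L.order
  have hh := L.hdr_le_ord
  refine (Halts.wp_seq (B := 6 * Q.length + 1) (P := fun s' =>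
      L.Arr s'.mem L.qb Q ∧ L.Marks s'.mem (D \ Q.toFinset) ∧ L.Frame L.qb s.mem s'.mem ∧
      s'.out = s.out ∧ (∀ r < 24, s'.reg r = s.reg r))
      ?_).mono (by simp only [Cmd.size]; omega) (fun _ h => h)
  simp [wp, hB.r0, hB.r8, h22]
  refine ⟨by omega, ?_⟩
  refine (Halts.loop (T₀ := 0) (B := 6 * Q.length)
    (fun T s' => ∃ p q, Q = p ++ q ∧ T = 6 * p.length ∧ L.Arr s'.mem L.qb Q ∧
      L.Marks s'.mem (D \ p.toFinset) ∧ L.Frame L.qb s.mem s'.mem ∧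
      s'.reg 30 = L.qb + p.length ∧ s'.reg 24 = q.length ∧
      s'.out = s.out ∧ ∀ r < 24, s'.reg r = s.reg r) ?_ ?_ ?_).mono le_rfl ?_
  · refine ⟨[], Q, rfl, rfl, hQ, by simpa using hM, Frame.rfl, by simp, by simp,
      rfl, fun r hr => ?_⟩
    simp [show r ≠ 24 by omega, show r ≠ 30 by omega]
  · rintro T s' ⟨p, q, rfl, rfl, -⟩
    simp
  · rintro T s' ⟨p, q, hpq, rfl, i1, i2, i3, i5, i6, i7, i8⟩ h7
    have hB' : Base L s' := hB.congr fun r hr => i8 r (by omega)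
    cases q with
    | nil => simp at i6; omega
    | cons x q =>
      have hlen := congrArg List.length hpq
      simp only [List.length_append, List.length_cons] at hlen
      have hx : s'.mem (L.qb + p.length) = L.va x := by
        have := i1 p.length (by omega)
        simpa [hpq] using this
      have hxlt := L.va_lt x
      refine ⟨_, Halts.of_wp ?_⟩
      simp [wp, i5, hx, hB'.r12, hB'.r1, hB'.r0, i8 22]
      refine ⟨by omega, by omega, by omega, by omega, p ++ [x], q,
        by simpa using hpq, ?_, ?_, ?_, ?_, ?_, ?_, ?_, ?_⟩
      · simp [Cmd.size]; ring
      · exact i1.update (by omega)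
      · rw [List.toFinset_append]
        convert i2.erase x using 1
        ext; simp; tauto
      · exact i3.update (Or.inr ⟨x, rfl⟩)
      · simp; omega
      · rw [h22]; omega
      · exact i7
      · intro r hr
        repeat rw [Function.update_of_ne (by omega)]
        exact i8 r hr
  · rintro s' ⟨h0, T, p, q, hpq, rfl, i1, i2, i3, i5, i6, i7, i8⟩
    rw [h0] at i6
    obtain rfl := List.length_eq_zero_iff.1 i6.symm
    rw [List.append_nil] at hpq
    subst hpq
    exact ⟨i1, i2, i3, i7, i8⟩

/-- Output the vertices in the array between the addresses in the registers 30 and 31. -/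
def emitC : Cmd :=
  .sub 24 31 30 ;; .loop 24
    (.load 27 30 ;; .add 26 27 13 ;; .load 27 26 ;; .emit 27 ;; .add 30 30 1 ;; .sub 24 31 30)

lemma emitC_spec (hF : Fits L cells w) {s : State} (hB : Base L s) {A : Finset (Fin n)}
    (hG : L.GraphMem A s.mem) {b : ℕ} {S : List (Fin n)}
    (hS : L.Arr s.mem b S) (hn : b + S.length ≤ L.tr) (h30 : s.reg 30 = b)
    (h31 : s.reg 31 = b + S.length) :
    Halts cells w emitC s (7 * S.length + 2) (fun s' =>
      s'.mem = s.mem ∧ s'.out = s.out ++ S.map Fin.val ∧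
      ∀ r, r < 24 ∨ 31 < r → s'.reg r = s.reg r) := by
  have h1 := hF.mem_le; have h2 := hF.word_le
  obtain ⟨o1, o2, o3⟩ := L.order
  have hh := L.hdr_le_ord
  refine (Halts.wp_seq (B := 7 * S.length + 1) (P := fun s' =>
      s'.mem = s.mem ∧ s'.out = s.out ++ S.map Fin.val ∧
      ∀ r, r < 24 ∨ 31 < r → s'.reg r = s.reg r)
      ?_).mono (by simp only [Cmd.size]; omega) (fun _ h => h)
  simp only [wp, h30, h31]
  refine (Halts.loop (T₀ := 0) (B := 7 * S.length)
    (fun T s' => ∃ p q, S = p ++ q ∧ T = 7 * p.length ∧ s'.mem = s.mem ∧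
      s'.reg 30 = b + p.length ∧ s'.reg 24 = q.length ∧ s'.reg 31 = b + S.length ∧
      s'.out = s.out ++ p.map Fin.val ∧ ∀ r, r < 24 ∨ 31 < r → s'.reg r = s.reg r)
      ?_ ?_ ?_).mono le_rfl ?_
  · refine ⟨[], S, rfl, rfl, rfl, by simp [h30], by simp, by simp [h31], by simp, fun r hr => ?_⟩
    simp [show r ≠ 24 by omega]
  · rintro T s' ⟨p, q, rfl, rfl, -⟩
    simp
  · rintro T s' ⟨p, q, hpq, rfl, i1, i5, i6, i6', i7, i8⟩ h7
    have hB' : Base L s' := hB.congr fun r hr => i8 r (by omega)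
    cases q with
    | nil => simp at i6; omega
    | cons x q =>
      have hlen := congrArg List.length hpq
      simp only [List.length_append, List.length_cons] at hlen
      have hx : s.mem (b + p.length) = L.va x := by
        have := hS p.length (by omega)
        simpa [hpq] using this
      have hxlt := L.va_lt x
      refine ⟨_, Halts.of_wp ?_⟩
      simp [wp, i5, i1, hx, hB'.r13, hB'.r1, i6', hG.label]
      refine ⟨by omega, by omega, by omega, by omega, p ++ [x], q,
        by simpa using hpq, ?_, ?_, ?_, ?_, ?_⟩
      · simp [Cmd.size]; ring
      · simp; omega
      · omega
      · simp [i7]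
      · intro r hr
        repeat rw [Function.update_of_ne (by omega)]
        exact i8 r hr
  · rintro s' ⟨h0, T, p, q, hpq, rfl, i1, i5, i6, i6', i7, i8⟩
    rw [h0] at i6
    obtain rfl := List.length_eq_zero_iff.1 i6.symm
    rw [List.append_nil] at hpq
    subst hpq
    exact ⟨i1, i7, i8⟩

end GraphletEnum

namespace GraphletEnum

/-! ### Breadth-first scan -/

variable {n : ℕ} {G : SimpleGraph (Fin n)} {L : Layout G} {cells w : ℕ}

namespace Layout

/-- The address `e` is where the traversal of the list of some scanned vertex stands, when the arcs
`done` have been treated and the arcs `rest` remain; before the first scan no arc remains. -/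
def Cursor (L : Layout G) (A : Finset (Fin n)) (scanned : List (Fin n)) (done rest : List ℕ)
    (e : ℕ) : Prop :=
  (done = [] ∧ rest = [] ∧ e < L.H + 4 * n) ∨
    ∃ u ∈ scanned, L.arcs A u = done ++ rest ∧ e = L.cur u rest

lemma Cursor.lt {A : Finset (Fin n)} {scanned : List (Fin n)} {done rest : List ℕ} {e : ℕ}
    (h : L.Cursor A scanned done rest e) : e < L.ord := by
  have := L.hdr_le_ord
  rcases h with ⟨-, -, h⟩ | ⟨u, -, h1, rfl⟩
  · omega
  · have := Layout.cur_lt (L := L) (u := u) (l := rest) fun a ha =>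
      (L.mem_arcs.1 (show a ∈ L.arcs A u by rw [h1]; simp [ha])).1
    omega

lemma Cursor.sub_eq_zero {A : Finset (Fin n)} {scanned : List (Fin n)} {done rest : List ℕ} {e : ℕ}
    (h : L.Cursor A scanned done rest e) : e - (L.H + 4 * n - 1) = 0 ↔ rest = [] := by
  rcases h with ⟨-, h1, h⟩ | ⟨u, -, h1, rfl⟩
  · simp [h1]; omega
  · exact Layout.cur_sub

lemma Cursor.cons {A : Finset (Fin n)} {scanned : List (Fin n)} {done rest : List ℕ} {a e : ℕ}
    (h : L.Cursor A scanned done (a :: rest) e) :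
    ∃ u ∈ scanned, L.arcs A u = done ++ a :: rest ∧ e = L.na a := by
  rcases h with ⟨-, h1, h⟩ | ⟨u, hu, h1, rfl⟩
  · simp at h1
  · exact ⟨u, hu, h1, rfl⟩

lemma getElem_append_eq {α : Type*} {p : List α} {x : α} {q : List α} {l : List α}
    (h : l = p ++ x :: q) (hl : p.length < l.length) : l[p.length] = x := by
  subst h; simp

end Layout

open Layout

/-- The test of the scanning loop: an arc remains, or the queue from the address in register 21 on
has not reached the address in register `lim`. -/
def scanTest (lim : ℕ) : Cmd := .sub 28 20 5 ;; .sub 29 lim 21 ;; .add 24 28 29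

/-- Scan the alive neighbors of the vertices in the queue up to the address in register `lim`, and
append those without a mark to the queue, with a mark. -/
def scanC (lim : ℕ) : Cmd :=
  (.add 21 8 0 ;; .const 20 0 ;; scanTest lim) ;; .loop 24
    (.sub 28 20 5 ;;
      .cond 28
        (.add 26 20 12 ;; .load 25 26 ;; .add 26 25 12 ;; .load 27 26 ;;
          .cond 27 .skip (.store 26 1 ;; .store 22 25 ;; .add 22 22 1) ;; .load 20 20)
        (.load 25 21 ;; .add 21 21 1 ;; .load 20 25) ;;
      scanTest lim)

/-- The invariant of the scanning loop: `Q` is the queue, `P` its scanned part. -/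
structure ScanInv (L : Layout G) (A : Finset (Fin n)) (lim : ℕ) (s : State) (S : List (Fin n))
    (Q P : List (Fin n)) (done rest : List ℕ) (s' : State) : Prop where
  pre : S <+: Q
  nodup : Q.Nodup
  alive : ∀ x ∈ Q, x ∈ A
  arr : L.Arr s'.mem L.qb Q
  marks : L.Marks s'.mem Q.toFinset
  frame : L.Frame L.qb s.mem s'.mem
  scanned : P <+: Q
  r22 : s'.reg 22 = L.qb + Q.length
  r21 : s'.reg 21 = L.qb + P.length
  lim_eq : lim < 20 → s'.reg lim = s.reg lim
  r21_le : s'.reg 21 ≤ s'.reg lim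
  cursor : L.Cursor A P done rest (s'.reg 20)
  test : s'.reg 24 = (s'.reg 20 - (L.H + 4 * n - 1)) + (s'.reg lim - s'.reg 21)
  closed : ∀ u ∈ P, ∀ x ∈ A, G.Adj u x → x ∈ Q ∨ ∃ a ∈ rest, L.tgt a = x
  new : ∀ x ∈ Q, x ∉ S → ∃ u ∈ P, G.Adj u x
  conn : ∀ p, p <+: Q → S.length ≤ p.length → Conn G p.toFinset
  out : s'.out = s.out
  regs : ∀ r < 20, s'.reg r = s.reg r

lemma length_le_of_nodup {l : List (Fin n)} (h : l.Nodup) : l.length ≤ n := by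
  simpa using h.length_le_card

lemma toFinset_concat {α : Type*} [DecidableEq α] (l : List α) (x : α) :
    (l ++ [x]).toFinset = insert x l.toFinset := by
  ext; simp

/-- With the moving limit in register `22`, the end of the queue, this is a breadth-first search;
with a limit that stays at the end of `S`, it appends the alive neighbors of `S` to `S`. The bound `B` is
for the numbers of arcs, and of vertices, that are scanned. -/
lemma scanC_spec (hF : Fits L cells w) {s : State} (hB : Base L s) {A : Finset (Fin n)}
    (hG : L.GraphMem A s.mem) {S : List (Fin n)} (hS : L.Arr s.mem L.qb S) (hnd : S.Nodup)
    (hSA : ∀ x ∈ S, x ∈ A) (hconn : Conn G S.toFinset)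
    (hM : L.Marks s.mem S.toFinset) (h22 : s.reg 22 = L.qb + S.length)
    {lim : ℕ} (hlim : lim = 22 ∨ (14 ≤ lim ∧ lim < 20)) (hlim' : s.reg lim = L.qb + S.length)
    {B : ℕ} (hBd : ∀ P : List (Fin n), P.Nodup → (lim < 20 → P ⊆ S) →
      (P.map fun u => (L.arcs A u).length + 1).sum ≤ B) :
    Halts cells w (scanC lim) s (19 * B + 6) (fun s' =>
      ∃ Q P, ScanInv L A lim s S Q P [] [] s' ∧ (lim < 20 → P = S) ∧ (lim = 22 → P = Q)) := by
  have h1 := hF.mem_le; have h2 := hF.word_le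
  obtain ⟨o1, o2, o3⟩ := L.order
  have hh := L.hdr_le_ord
  have hlen := length_le_of_nodup hnd
  have hn0 : 0 < n := by have := hF.two_le; have := hF.le; omega
  refine (Halts.wp_seq (B := 19 * B + 1) (P := fun s' =>
      ∃ Q P, ScanInv L A lim s S Q P [] [] s' ∧ (lim < 20 → P = S) ∧ (lim = 22 → P = Q))
      ?_).mono (by simp only [Cmd.size, scanTest]; omega) (fun _ h => h)
  have hl1 : lim ≠ 20 := by omega
  have hl2 : lim ≠ 21 := by omega
  have hl3 : lim ≠ 28 := by omega
  have hl4 : lim ≠ 29 := by omega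
  have hl5 : lim ≠ 24 := by omega
  have hl6 : lim ≠ 25 := by omega
  have hl7 : lim ≠ 26 := by omega
  have hl8 : lim ≠ 27 := by omega
  simp [wp, scanTest, hB.r0, hB.r8, hlim', hl1, hl2, hl3, hB.r5]
  refine ⟨by omega, by omega, ?_⟩
  refine (Halts.loop (T₀ := 0) (B := 19 * B)
    (fun T s' => ∃ Q P done rest, ScanInv L A lim s S Q P done rest s' ∧
      T + 19 * rest.length ≤ 19 * (P.map fun u => (L.arcs A u).length + 1).sum)
      ?_ ?_ ?_).mono le_rfl ?_
  · refine ⟨S, [], [], [], ⟨List.prefix_rfl, hnd, hSA, hS, hM, Frame.rfl, List.nil_prefix,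
      by simp [h22],
      by simp, by simp [hl1, hl2, hl3, hl4, hl5], by simp [hl1, hl2, hl3, hl4, hl5, hlim'], ?_,
        ?_, by simp,
      fun x hx hxS => absurd hx hxS, fun p hp hpl => ?_, rfl, ?_⟩, by simp⟩
    · left; simp; omega
    · simp [hl1, hl2, hl3, hl4, hl5, hlim']
    · rw [hp.eq_of_length_le hpl]; exact hconn
    · intro r hr
      simp [show r ≠ 24 by omega, show r ≠ 29 by omega, show r ≠ 28 by omega,
        show r ≠ 20 by omega, show r ≠ 21 by omega]
  · rintro T s' ⟨Q, P, done, rest, hI, hT⟩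
    have := hBd P (hI.nodup.sublist hI.scanned.sublist) (fun h20 => by
      have h21 := hI.r21_le
      rw [hI.lim_eq h20, hlim', hI.r21] at h21
      have := List.prefix_of_prefix_length_le hI.scanned hI.pre (by omega)
      exact this.subset)
    omega
  · rintro T s' ⟨Q, P, done, rest, hI, hT⟩ h7
    have hB' : Base L s' := hB.congr fun r hr => hI.regs r (by omega)
    have hGm := hG.frame hI.frame (by omega)
    have hQn := length_le_of_nodup hI.nodup
    have hlq : s'.reg lim ≤ L.qb + Q.length := by
      rcases hlim with rfl | hl
      · exact hI.r22.le
      · rw [hI.lim_eq hl.2, hlim']; have := hI.pre.length_le; omega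
    have hPQ := hI.scanned.length_le
    have hcl := hI.cursor.lt
    cases rest with
    | cons a rest =>
      -- an arc is treated
      obtain ⟨u, hu, hau, he⟩ := hI.cursor.cons
      have ha : a ∈ L.arcs A u := by rw [hau]; simp
      have ha' := L.mem_arcs.1 ha
      have hna := L.na_lt ha'.1
      have hva := L.va_lt (L.tgt a)
      have hsub : L.na a - (L.H + 4 * n - 1) ≠ 0 := by have := L.le_na a; omega
      have htgt := hGm.target a ha'.1
      have hmk := hI.marks (L.tgt a)
      have hli := hGm.lists u (hI.alive u (hI.scanned.subset hu))
      rw [hau] at hli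
      have hnext := hli.next
      have hnext' : ∀ x v v', L.qb ≤ x → Function.update (Function.update s'.mem
          (L.va (L.tgt a) + 2) v) x v' (L.na a) = L.cur u rest := by
        intro x v v' hx
        have := L.le_na a
        rw [Function.update_of_ne (by omega), Function.update_of_ne (by omega), hnext]
      have hcur : L.Cursor A P (done ++ [a]) rest (L.cur u rest) :=
        Or.inr ⟨u, hu, by simpa using hau, rfl⟩
      have hcl' := hcur.lt
      refine ⟨18, (Halts.of_wp ?_).mono (B := Cmd.size _) ?_ fun _ h => h⟩
      rotate_left
      · simp [Cmd.size]
      simp only [wp, State.setReg_reg, State.setReg_mem, State.setMem_reg,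
        State.setMem_mem]
      by_cases hin : L.tgt a ∈ Q
      · rw [if_pos (by simpa using hin)] at hmk
        simp [he, hB'.r12, hB'.r5, hB'.r1, htgt, hmk, hnext, hsub, hl1, hl2, hl3, hl6,
          hl7, hl8, hI.r21]
        refine ⟨by omega, by omega, by omega, by omega, by omega, by omega, Q, P, done ++ [a], rest,
          ⟨hI.pre, hI.nodup, hI.alive, hI.arr, hI.marks, hI.frame, hI.scanned, by simp [hI.r22],
            by simp [hI.r21], ?_, ?_, by simpa using hcur, ?_, ?_, hI.new, hI.conn, hI.out, ?_⟩, ?_⟩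
        · simpa [hl1, hl2, hl3, hl4, hl5, hl6, hl7, hl8] using hI.lim_eq
        · simpa [hl1, hl2, hl3, hl4, hl5, hl6, hl7, hl8] using hI.r21_le
        · simp [hl1, hl3, hl4, hl5, hl6, hl7, hl8, hI.r21]
        · intro v hv x hx hvx
          rcases hI.closed v hv x hx hvx with h | ⟨b, hb, rfl⟩
          · exact Or.inl h
          · rcases List.mem_cons.1 hb with rfl | hb
            · exact Or.inl hin
            · exact Or.inr ⟨b, hb, rfl⟩
        · intro r hr
          simp only [State.setReg_reg]
          repeat rw [Function.update_of_ne (by omega)]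
          exact hI.regs r hr
        · simp at hT; omega
      · rw [if_neg (by simpa using hin)] at hmk
        have hQn' : (Q ++ [L.tgt a]).length ≤ n := by
          refine length_le_of_nodup ?_
          rw [List.nodup_append]
          exact ⟨hI.nodup, List.nodup_singleton _, by simp; rintro b hb rfl; exact hin hb⟩
        rw [List.length_append, List.length_singleton] at hQn'
        have hlim22 : ∀ (f : ℕ → ℕ) z, Function.update f 22 z lim = if lim =
          22 then z else f lim := by
          intro f z; rw [Function.update_apply]
        simp [he, hB'.r12, hB'.r5, hB'.r1, htgt, hmk, hnext, hsub, hl1, hl2, hl3, hl6,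
          hl7, hl8, hI.r21, hI.r22, hlim22]
        rw [hnext' _ _ _ (by omega)]
        have hpre : Q <+: Q ++ [L.tgt a] := List.prefix_append _ _
        refine ⟨by omega, by omega, by omega, by omega, by omega, by omega, by omega,
          by split_ifs <;> omega, Q ++ [L.tgt a], P, done ++ [a], rest,
          ⟨hI.pre.trans hpre, ?_, ?_, ?_, ?_, ?_, hI.scanned.trans hpre, ?_,
            by simp [hI.r21], ?_, ?_, ?_, ?_, ?_, ?_, ?_, hI.out, ?_⟩, ?_⟩
        · rw [List.nodup_append]
          exact ⟨hI.nodup, List.nodup_singleton _, by simp; rintro b hb rfl; exact hin hb⟩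
        · simp only [List.mem_append, List.mem_singleton]
          rintro x (hx | rfl)
          · exact hI.alive x hx
          · exact ha'.2.2
        · exact (hI.arr.update (by omega)).push rfl
        · have := (hI.marks.insert (L.tgt a)).frame_update (x := L.qb + Q.length)
            (v := L.va (L.tgt a)) (by omega)
          rwa [toFinset_concat]
        · exact (hI.frame.update (Or.inr ⟨_, rfl⟩)).update (Or.inl (by omega))
        · simp; omega
        · intro h20
          have := hI.lim_eq h20
          simp [hl1, hl3, hl4, hl5, hl6, hl7, hl8, hlim22, this]
          omega
        · have := hI.r21_le
          have := hI.r21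
          simp [hl1, hl3, hl4, hl5, hl6, hl7, hl8, hlim22]
          split_ifs <;> omega
        · simpa [hnext' _ _ _ (show L.qb ≤ L.qb + Q.length by omega)] using hcur
        · simp [hl1, hl3, hl4, hl5, hl6, hl7, hl8, hlim22, hI.r21]
        · intro v hv x hx hvx
          rcases hI.closed v hv x hx hvx with h | ⟨b, hb, rfl⟩
          · exact Or.inl (by simp [h])
          · rcases List.mem_cons.1 hb with rfl | hb
            · exact Or.inl (by simp)
            · exact Or.inr ⟨b, hb, rfl⟩
        · simp only [List.mem_append, List.mem_singleton]
          rintro x (hx | rfl) hxS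
          · exact hI.new x hx hxS
          · exact ⟨u, hu, L.adj_of_mem_arcs ha⟩
        · intro p hp hpl
          rcases List.prefix_concat_iff.1 hp with rfl | hp
          · rw [toFinset_concat]
            exact (hI.conn Q List.prefix_rfl hI.pre.length_le).insert_of_adj
              (List.mem_toFinset.2 (hI.scanned.subset hu)) (L.adj_of_mem_arcs ha)
          · exact hI.conn p hp hpl
        · intro r hr
          simp only [State.setReg_reg, State.setMem_reg]
          repeat rw [Function.update_of_ne (by omega)]
          exact hI.regs r hr
        · simp at hT; omega
    | nil =>
      -- the next vertex in the queue is scanned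
      have hsub := hI.cursor.sub_eq_zero.2 rfl
      have htest := hI.test
      rw [hsub, hI.r21] at htest
      obtain ⟨r, hr⟩ := hI.scanned
      cases r with
      | nil =>
        rw [List.append_nil] at hr; subst hr
        omega
      | cons x r =>
        have hlr := congrArg List.length hr
        simp only [List.length_append, List.length_cons] at hlr
        have hxQ : x ∈ Q := by rw [← hr]; simp
        have hx : s'.mem (L.qb + P.length) = L.va x := by
          rw [hI.arr P.length (by omega), Layout.getElem_append_eq hr.symm]
        have hxv := L.va_lt x
        have hli := hGm.lists x (hI.alive x hxQ)
        have hfirst := hli.first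
        have hcur : L.Cursor A (P ++ [x]) [] (L.arcs A x) (L.cur x (L.arcs A x)) :=
          Or.inr ⟨x, by simp, rfl, rfl⟩
        have hcl' := hcur.lt
        refine ⟨18, (Halts.of_wp ?_).mono (B := Cmd.size _) ?_ fun _ h => h⟩
        rotate_left
        · simp [Cmd.size]
        simp [wp, hB'.r5, hsub, hB'.r1, hI.r21, hx, hfirst, hl1, hl2, hl3, hl6,
          hl7, hl8]
        refine ⟨by omega, by omega, by omega, by omega, Q, P ++ [x], [], L.arcs A x,
          ⟨hI.pre, hI.nodup, hI.alive, hI.arr, hI.marks, hI.frame, ⟨r, by simpa using hr⟩,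
            by simp [hI.r22], ?_, ?_, ?_, by simpa using hcur, ?_, ?_, ?_, hI.conn, hI.out, ?_⟩, ?_⟩
        · simp; omega
        · simpa [hl1, hl2, hl3, hl4, hl5, hl6, hl7, hl8] using hI.lim_eq
        · have := hI.r21
          simp [hl1, hl2, hl3, hl4, hl5, hl6]; omega
        · simp [hl1, hl2, hl3, hl4, hl5, hl6]
        · simp only [List.mem_append, List.mem_singleton]
          rintro v (hv | rfl) y hy hvy
          · rcases hI.closed v hv y hy hvy with h | ⟨b, hb, rfl⟩
            · exact Or.inl h
            · simp at hb
          · exact Or.inr (L.exists_mem_arcs hvy hy)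
        · intro y hy hyS
          obtain ⟨v, hv, hvy⟩ := hI.new y hy hyS
          exact ⟨v, by simp [hv], hvy⟩
        · intro i hi
          simp only [State.setReg_reg]
          repeat rw [Function.update_of_ne (by omega)]
          exact hI.regs i hi
        · simp at hT ⊢; omega
  · rintro s' ⟨h0, T, Q, P, done, rest, hI, hT⟩
    have htest := hI.test
    rw [h0] at htest
    have hsub : s'.reg 20 - (L.H + 4 * n - 1) = 0 := by omega
    obtain rfl := hI.cursor.sub_eq_zero.1 hsub
    have hcur : L.Cursor A P [] [] (s'.reg 20) := by
      left; refine ⟨rfl, rfl, by omega⟩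
    have hle := hI.r21_le
    have h21 := hI.r21
    refine ⟨Q, P, { hI with cursor := hcur }, fun h20 => ?_, fun h => ?_⟩
    · have := hI.lim_eq h20
      rw [hlim'] at this
      have hp := List.prefix_of_prefix_length_le hI.scanned hI.pre (by omega)
      exact hp.eq_of_length (by omega)
    · subst h
      have := hI.r22
      exact hI.scanned.eq_of_length (by omega)

end GraphletEnum

namespace GraphletEnum

/-! ### Search for a candidate vertex -/

variable {n : ℕ} {G : SimpleGraph (Fin n)} {L : Layout G} {cells w : ℕ}

open Layout

/-- The test of the search loop. The loop ends if the connected set lacks one vertex only, if the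
queue has `k` vertices beside the candidate in register 23, or if register 34 reports that the
queue is exhausted without a candidate. -/
def searchTest : Cmd :=
  .sub 28 10 14 ;; .cond 28 (.cond 23 (.sub 24 11 22) (.sub 24 1 34)) (.const 24 0)

/-- One step of the search: treat an arc, or scan the next vertex of the queue, or, when the queue
is exhausted, move the candidate to the connected set. -/
def searchStep : Cmd :=
  .sub 28 20 5 ;;
    .cond 28
      (.add 26 20 12 ;; .load 25 26 ;; .add 26 25 12 ;; .load 27 26 ;;
        .cond 27 .skip
          (.store 26 1 ;; .cond 23 (.store 22 25 ;; .add 22 22 1) (.add 23 25 0)) ;;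
        .load 20 20)
      (.sub 28 22 21 ;; .cond 28
        (.load 25 21 ;; .add 21 21 1 ;; .load 20 25)
        (.cond 23
          (.store 22 23 ;; .add 22 22 1 ;; .store 14 23 ;; .add 14 14 1 ;; .const 23 0)
          (.const 34 1)))

/-- Search the component of the connected set while avoiding a candidate vertex; a candidate
without which fewer than `k` vertices can be reached is added to the connected set, and the search
goes on from there with a new candidate. -/
def searchC : Cmd :=
  (.add 21 8 0 ;; .const 20 0 ;; .const 23 0 ;; .const 34 0 ;; searchTest) ;; .loop 24
    (searchStep ;; searchTest)

/-- The value computed by the test of the search loop. -/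
def searchVal (k : ℕ) (S Q : List (Fin n)) (h : Option (Fin n)) (z : ℕ) : ℕ :=
  if S.length < k - 1 then (if h = none then 1 - z else k - Q.length) else 0

/-- The invariant of the search from the connected set `S₀`: `S` is the current connected set, `Q`
the queue, `P` its scanned part, `h` the candidate, and `z` the flag for an exhausted queue. The
list of the vertex under scan splits into the arcs `done` and `rest`. -/
structure SearchInv (L : Layout G) (A : Finset (Fin n)) (s : State) (S₀ S Q P : List (Fin n))
    (h : Option (Fin n)) (done rest : List ℕ) (z : ℕ) (s' : State) : Prop where
  pre : S₀ <+: S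
  nodupS : S.Nodup
  subset : ∀ x ∈ S, x ∈ Q
  nodup : Q.Nodup
  alive : ∀ x ∈ Q, x ∈ A
  hole : ∀ v, h = some v → v ∈ A ∧ v ∉ Q ∧ ∃ u ∈ S, G.Adj u v
  arrS : L.Arr s'.mem L.st S
  arr : L.Arr s'.mem L.qb Q
  marks : L.Marks s'.mem (h.toFinset ∪ Q.toFinset)
  frame : L.Frame (L.st + S₀.length) s.mem s'.mem
  scanned : P <+: Q
  r14 : s'.reg 14 = L.st + S.length
  r22 : s'.reg 22 = L.qb + Q.length
  r21 : s'.reg 21 = L.qb + P.length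
  r23 : s'.reg 23 = h.elim 0 L.va
  r34 : s'.reg 34 = z
  cursor : L.Cursor A P done rest (s'.reg 20)
  closed : ∀ u ∈ P, ∀ x ∈ A, G.Adj u x → x ∈ Q ∨ h = some x ∨ ∃ a ∈ rest, L.tgt a = x
  done_mem : ∀ a ∈ done, L.tgt a ∈ Q ∨ h = some (L.tgt a)
  no_cand : h = none → (∀ a ∈ rest, L.src a ∈ S) ∧ ∀ x ∈ Q, x ∉ P → x ∈ S
  connS : Conn G S.toFinset
  conn : Conn G Q.toFinset
  lenS : S.length ≤ L.k - 1
  len : Q.length ≤ L.k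
  sol : Sol G L.k A S.toFinset = Sol G L.k A S₀.toFinset
  flag : z = 0 ∨ z = 1 ∧ h = none ∧ rest = [] ∧ P = Q
  out : s'.out = s.out
  regs : ∀ r < 20, r ≠ 14 → s'.reg r = s.reg r

lemma SearchInv.congr {A : Finset (Fin n)} {s s₁ s₂ : State} {S₀ S Q P : List (Fin n)}
    {h : Option (Fin n)} {done rest : List ℕ} {z : ℕ}
    (hI : SearchInv L A s S₀ S Q P h done rest z s₁) (hm : s₂.mem = s₁.mem)
    (ho : s₂.out = s₁.out) (hr : ∀ r, r ≠ 24 → r ≠ 28 → s₂.reg r = s₁.reg r) :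
    SearchInv L A s S₀ S Q P h done rest z s₂ :=
  { hI with
    arrS := hm ▸ hI.arrS
    arr := hm ▸ hI.arr
    marks := hm ▸ hI.marks
    frame := hm ▸ hI.frame
    r14 := by rw [hr _ (by norm_num) (by norm_num), hI.r14]
    r22 := by rw [hr _ (by norm_num) (by norm_num), hI.r22]
    r21 := by rw [hr _ (by norm_num) (by norm_num), hI.r21]
    r23 := by rw [hr _ (by norm_num) (by norm_num), hI.r23]
    r34 := by rw [hr _ (by norm_num) (by norm_num), hI.r34]
    cursor := by rw [hr _ (by norm_num) (by norm_num)]; exact hI.cursor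
    out := ho.trans hI.out
    regs := fun r h1 h2 => by rw [hr _ (by omega) (by omega), hI.regs r h1 h2] }

lemma SearchInv.base {A : Finset (Fin n)} {s s₁ : State} {S₀ S Q P : List (Fin n)}
    {h : Option (Fin n)} {done rest : List ℕ} {z : ℕ}
    (hI : SearchInv L A s S₀ S Q P h done rest z s₁) (hB : Base L s) : Base L s₁ :=
  hB.congr fun r hr => hI.regs r (by omega) (by omega)

lemma SearchInv.r23_eq_zero {A : Finset (Fin n)} {s s₁ : State} {S₀ S Q P : List (Fin n)}
    {h : Option (Fin n)} {done rest : List ℕ} {z : ℕ} (hH : 0 < L.H)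
    (hI : SearchInv L A s S₀ S Q P h done rest z s₁) : s₁.reg 23 = 0 ↔ h = .none := by
  rw [hI.r23]
  cases h with
  | none => simp
  | some v => have := L.le_va v; simp; omega

/-- The arcs treated in the list of one vertex lead to different marked vertices. -/
lemma SearchInv.done_le {A : Finset (Fin n)} {s s₁ : State} {S₀ S Q P : List (Fin n)}
    {h : Option (Fin n)} {done rest : List ℕ} {z : ℕ}
    (hI : SearchInv L A s S₀ S Q P h done rest z s₁) : done.length ≤ L.k + 1 := by
  have h3 : (done.map L.tgt).Nodup := by
    rcases hI.cursor with ⟨h4, -⟩ | ⟨u, -, h4, -⟩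
    · simp [h4]
    · have := L.map_tgt_nodup (A := A) (u := u)
      rw [h4, List.map_append] at this
      exact this.of_append_left
  have h4 : (done.map L.tgt).toFinset ⊆ h.toFinset ∪ Q.toFinset := by
    intro y hy
    rw [List.mem_toFinset, List.mem_map] at hy
    obtain ⟨b, hb, rfl⟩ := hy
    rw [Finset.mem_union, Option.mem_toFinset, Option.mem_def, List.mem_toFinset]
    exact (hI.done_mem b hb).symm
  have h5 := (Finset.card_le_card h4).trans (Finset.card_union_le _ _)
  rw [List.toFinset_card_of_nodup h3, List.toFinset_card_of_nodup hI.nodup, List.length_map] at h5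
  have h6 : h.toFinset.card ≤ 1 := by cases h <;> simp
  have := hI.len
  omega

lemma searchTest_wp (hH : 0 < L.H) {A : Finset (Fin n)} {s s₁ : State} (hB : Base L s)
    {S₀ S Q P : List (Fin n)} {h : Option (Fin n)} {done rest : List ℕ} {z : ℕ}
    (hI : SearchInv L A s S₀ S Q P h done rest z s₁) {Post : State → Prop}
    (hP : ∀ s₂, SearchInv L A s S₀ S Q P h done rest z s₂ →
      s₂.reg 24 = searchVal L.k S Q h z → Post s₂) :
    wp cells w searchTest Post s₁ := by
  have hB' := hI.base hB
  have h0 := hI.r23_eq_zero hH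
  have key : ∀ x y, SearchInv L A s S₀ S Q P h done rest z ((s₁.setReg 28 x).setReg 24 y) :=
    fun x y => hI.congr rfl rfl fun r h1 h2 => by simp [h1, h2]
  have hlS := hI.lenS
  simp only [wp, searchTest, State.setReg_reg, hI.r14, hB'.r10, hB'.r11, hB'.r1,
    Function.update_self, Function.update_of_ne (show (22:ℕ) ≠ 28 by norm_num),
    Function.update_of_ne (show (23:ℕ) ≠ 28 by norm_num),
    Function.update_of_ne (show (34:ℕ) ≠ 28 by norm_num),
    Function.update_of_ne (show (11:ℕ) ≠ 28 by norm_num),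
    Function.update_of_ne (show (1:ℕ) ≠ 28 by norm_num), hI.r22, hI.r34]
  refine ⟨fun h1 => ⟨fun h2 => ?_, fun h2 => ?_⟩, fun h1 => ⟨by positivity, ?_⟩⟩
  · refine hP _ (key _ _) ?_
    rw [Ne, h0] at h2
    simp [searchVal, h2, show S.length < L.k - 1 by omega]
    omega
  · refine hP _ (key _ _) ?_
    rw [h0] at h2
    simp [searchVal, h2, show S.length < L.k - 1 by omega]
  · refine hP _ (key _ _) ?_
    simp [searchVal, show ¬ S.length < L.k - 1 by omega]

/-- The time spent is bounded by a potential that every step increases: a scanned vertex counts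
`k + 2`, since at most `k + 1` arcs of it have been treated by `SearchInv.done_le`. -/
lemma searchStep_spec (hH : 0 < L.H) (hF : Fits L cells w) {s : State} (hB : Base L s)
    {A : Finset (Fin n)} (hG : L.GraphMem A s.mem) {s' : State}
    {S₀ S Q P : List (Fin n)} {h : Option (Fin n)} {done rest : List ℕ} {z T : ℕ}
    (hI : SearchInv L A s S₀ S Q P h done rest z s')
    (hT : T ≤ 33 * (P.length * (L.k + 2) + done.length + S.length + z))
    (hv : searchVal L.k S Q h z ≠ 0) :
    wp cells w searchStep (fun s₁ => ∃ S Q P h done rest z,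
      SearchInv L A s S₀ S Q P h done rest z s₁ ∧
      T + 33 ≤ 33 * (P.length * (L.k + 2) + done.length + S.length + z)) s' := by
  have h1 := hF.mem_le; have h2 := hF.word_le; have hk2 := hF.two_le; have hkn := hF.le
  obtain ⟨o1, o2, o3⟩ := L.order
  have hh := L.hdr_le_ord
  have hB' := hI.base hB
  have hpreS := hI.pre.length_le
  have hGm := hG.frame hI.frame (by omega)
  have hQn := length_le_of_nodup hI.nodup
  have hSn := length_le_of_nodup hI.nodupS
  have hPQ := hI.scanned.length_le
  have hcl := hI.cursor.lt
  have hlQ := hI.len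
  have hS1 : S.length < L.k - 1 := by
    by_contra hc; exact hv (by simp [searchVal, hc])
  have hv1 : h = none → z = 0 := fun hn => by
    rcases hI.flag with hz | ⟨hz, -⟩
    · exact hz
    · exact absurd (by simp [searchVal, hn, hz]) hv
  have hv2 : h ≠ none → Q.length < L.k := fun hn => by
    by_contra hc
    exact hv (by simp [searchVal, hn]; omega)
  have h23 := hI.r23_eq_zero hH
  cases rest with
  | cons a rest =>
    have hz : z = 0 := by
      rcases hI.flag with hz | ⟨-, -, hz, -⟩
      · exact hz
      · simp at hz
    obtain ⟨u, hu, hau, he⟩ := hI.cursor.cons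
    have ha : a ∈ L.arcs A u := by rw [hau]; simp
    have ha' := L.mem_arcs.1 ha
    have hna := L.na_lt ha'.1
    have hva := L.va_lt (L.tgt a)
    have hva' := L.le_va (L.tgt a)
    have hsub : L.na a - (L.H + 4 * n - 1) ≠ 0 := by have := L.le_na a; omega
    have htgt := hGm.target a ha'.1
    have hmk := hI.marks (L.tgt a)
    have hli := hGm.lists u (hI.alive u (hI.scanned.subset hu))
    rw [hau] at hli
    have hnext := hli.next
    have hnext1 : ∀ v, Function.update s'.mem
        (L.va (L.tgt a) + 2) v (L.na a) = L.cur u rest := by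
      intro v
      have := L.le_na a
      rw [Function.update_of_ne (by omega), hnext]
    have hnext2 : ∀ x v v', L.qb ≤ x → Function.update (Function.update s'.mem
        (L.va (L.tgt a) + 2) v) x v' (L.na a) = L.cur u rest := by
      intro x v v' hx
      rw [Function.update_of_ne (by omega), hnext1]
    have hcur : L.Cursor A P (done ++ [a]) rest (L.cur u rest) :=
      Or.inr ⟨u, hu, by simpa using hau, rfl⟩
    have hclosed : ∀ (Q' : List (Fin n)) (h' : Option (Fin n)), (∀ x ∈ Q, x ∈ Q') →
        (∀ x, h = some x → x ∈ Q' ∨ h' = some x) → (L.tgt a ∈ Q' ∨ h' = some (L.tgt a)) →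
        ∀ u ∈ P, ∀ x ∈ A, G.Adj u x → x ∈ Q' ∨ h' = some x ∨ ∃ a ∈ rest, L.tgt a = x := by
      intro Q' h' h3 h4 h5 v hv x hx hvx
      rcases hI.closed v hv x hx hvx with h6 | h6 | ⟨b, hb, rfl⟩
      · exact Or.inl (h3 x h6)
      · rcases h4 x h6 with h7 | h7 <;> simp [h7]
      · rcases List.mem_cons.1 hb with rfl | hb
        · rcases h5 with h7 | h7 <;> simp [h7]
        · exact Or.inr (Or.inr ⟨b, hb, rfl⟩)
    have hdone : ∀ (Q' : List (Fin n)) (h' : Option (Fin n)), (∀ x ∈ Q, x ∈ Q') →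
        (∀ x, h = some x → x ∈ Q' ∨ h' = some x) → (L.tgt a ∈ Q' ∨ h' = some (L.tgt a)) →
        ∀ b ∈ done ++ [a], L.tgt b ∈ Q' ∨ h' = some (L.tgt b) := by
      intro Q' h' h3 h4 h5 b hb
      rcases List.mem_append.1 hb with hb | hb
      · rcases hI.done_mem b hb with h6 | h6
        · exact Or.inl (h3 _ h6)
        · exact h4 _ h6
      · rw [List.mem_singleton.1 hb]; exact h5
    have htime : T + 33 ≤ 33 * (P.length * (L.k + 2) + (done ++ [a]).length + S.length + z) := by
      simp only [List.length_append, List.length_singleton]; omega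
    by_cases hin : L.tgt a ∈ Q ∨ h = some (L.tgt a)
    · rw [if_pos (by simp only [Finset.mem_union, Option.mem_toFinset, Option.mem_def,
        List.mem_toFinset]; exact hin.symm)] at hmk
      simp [wp, searchStep, he, hB'.r12, hB'.r5, hB'.r1, htgt, hmk, hnext, hsub]
      refine ⟨by omega, by omega, by omega, by omega, by omega, S, Q, P, h, done ++ [a], rest, z,
        { hI with
          cursor := by simpa using hcur
          closed := hclosed Q h (fun _ h => h) (fun _ h => Or.inr h) hin
          done_mem := hdone Q h (fun _ h => h) (fun _ h => Or.inr h) hin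
          no_cand := fun hn => ⟨fun b hb => (hI.no_cand hn).1 b (by simp [hb]), (hI.no_cand hn).2⟩
          r14 := by simp [hI.r14]
          r22 := by simp [hI.r22]
          r21 := by simp [hI.r21]
          r23 := by simp [hI.r23]
          r34 := by simp [hI.r34]
          flag := Or.inl hz
          regs := ?_ }, htime⟩
      intro r hr hr'
      simp only [State.setReg_reg]
      repeat rw [Function.update_of_ne (by omega)]
      exact hI.regs r hr hr'
    · rw [if_neg (by simp only [Finset.mem_union, Option.mem_toFinset, Option.mem_def,
        List.mem_toFinset]; tauto)] at hmk
      rw [not_or] at hin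
      cases h with
      | some v =>
        -- an unmarked vertex is queued
        have hQk := hv2 (by simp)
        have hnd : (Q ++ [L.tgt a]).Nodup := by
          rw [List.nodup_append]
          exact ⟨hI.nodup, List.nodup_singleton _, by simp; rintro b hb rfl; exact hin.1 hb⟩
        have hQn' := length_le_of_nodup hnd
        rw [List.length_append, List.length_singleton] at hQn'
        have hvQ := hI.hole v rfl
        have hrv : s'.reg 23 ≠ 0 := by rw [Ne, h23]; simp
        have hpre : Q <+: Q ++ [L.tgt a] := List.prefix_append _ _
        simp [wp, searchStep, he, hB'.r12, hB'.r5, hB'.r1, htgt, hmk, hsub, hrv, hI.r22]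
        rw [hnext2 _ _ _ (by omega)]
        refine ⟨by omega, by omega, by omega, by omega, by omega, by omega, by omega, S,
          Q ++ [L.tgt a], P, some v, done ++ [a], rest, z,
          { hI with
            subset := fun x hx => hpre.subset (hI.subset x hx)
            nodup := hnd
            alive := ?_
            hole := ?_
            arrS := ?_
            arr := (hI.arr.update (by omega)).push rfl
            marks := ?_
            frame := (hI.frame.update (Or.inr ⟨_, rfl⟩)).update (Or.inl (by omega))
            scanned := hI.scanned.trans hpre
            cursor := by simpa [hnext2 _ _ _ (show L.qb ≤ L.qb + Q.length by omega)] using hcur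
            closed := hclosed _ _ (fun x hx => hpre.subset hx) (fun _ h => Or.inr h) (by simp)
            done_mem := hdone _ _ (fun x hx => hpre.subset hx) (fun _ h => Or.inr h) (by simp)
            no_cand := fun hn => by simp at hn
            conn := ?_
            len := by simp; omega
            r14 := by simp [hI.r14]
            r22 := by simp; omega
            r21 := by simp [hI.r21]
            r23 := by simp [hI.r23]
            r34 := by simp [hI.r34]
            flag := Or.inl hz
            regs := ?_ }, htime⟩
        · simp only [List.mem_append, List.mem_singleton]
          rintro x (hx | rfl)
          · exact hI.alive x hx
          · exact ha'.2.2
        · rintro v' hv'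
          obtain rfl := Option.some.inj hv'
          refine ⟨hvQ.1, ?_, hvQ.2.2⟩
          simp only [List.mem_append, List.mem_singleton, not_or]
          exact ⟨hvQ.2.1, fun e => hin.2 (by rw [e])⟩
        · simp only [State.setReg_mem, State.setMem_mem]
          exact (hI.arrS.update (by omega)).update (by omega)
        · have := (hI.marks.insert (L.tgt a)).frame_update (x := L.qb + Q.length)
            (v := L.va (L.tgt a)) (by omega)
          rw [toFinset_concat, Finset.union_insert]
          exact this
        · rw [toFinset_concat]
          exact hI.conn.insert_of_adj
            (List.mem_toFinset.2 (hI.scanned.subset hu)) (L.adj_of_mem_arcs ha)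
        · intro r hr hr'
          simp only [State.setReg_reg, State.setMem_reg]
          repeat rw [Function.update_of_ne (by omega)]
          exact hI.regs r hr hr'
      | none =>
        -- an unmarked vertex becomes the candidate
        have hrv : s'.reg 23 = 0 := h23.2 rfl
        simp [wp, searchStep, he, hB'.r12, hB'.r5, hB'.r1, hB'.r0, htgt, hmk, hsub, hrv]
        rw [hnext1]
        refine ⟨by omega, by omega, by omega, by omega, by omega, by omega, S,
          Q, P, some (L.tgt a), done ++ [a], rest, z,
          { hI with
            hole := ?_
            arrS := hI.arrS.update (by omega)
            arr := hI.arr.update (by omega)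
            marks := ?_
            frame := hI.frame.update (Or.inr ⟨_, rfl⟩)
            cursor := by simpa [hnext1] using hcur
            closed := hclosed _ _ (fun x hx => hx) (by simp) (by simp)
            done_mem := hdone _ _ (fun x hx => hx) (by simp) (by simp)
            no_cand := fun hn => by simp at hn
            r14 := by simp [hI.r14]
            r22 := by simp [hI.r22]
            r21 := by simp [hI.r21]
            r23 := by simp
            r34 := by simp [hI.r34]
            flag := Or.inl hz
            regs := ?_ }, htime⟩
        · rintro v' hv'
          obtain rfl := Option.some.inj hv'
          refine ⟨ha'.2.2, hin.1, u, ?_, L.adj_of_mem_arcs ha⟩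
          have := (hI.no_cand rfl).1 a (by simp)
          rwa [ha'.2.1] at this
        · have := hI.marks.insert (L.tgt a)
          simpa using this
        · intro r hr hr'
          simp only [State.setReg_reg, State.setMem_reg]
          repeat rw [Function.update_of_ne (by omega)]
          exact hI.regs r hr hr'
  | nil =>
    have hsub := hI.cursor.sub_eq_zero.2 rfl
    have hlS := hI.lenS
    obtain ⟨r, hr⟩ := hI.scanned
    cases r with
    | cons x r =>
      -- the next vertex in the queue is scanned
      have hlr := congrArg List.length hr
      simp only [List.length_append, List.length_cons] at hlr
      have hxQ : x ∈ Q := by rw [← hr]; simp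
      have hxP : x ∉ P := by
        have := hI.nodup
        rw [← hr, List.nodup_append] at this
        exact fun hx => this.2.2 x hx x (by simp) rfl
      have hx : s'.mem (L.qb + P.length) = L.va x := by
        rw [hI.arr P.length (by omega), Layout.getElem_append_eq hr.symm]
      have hxv := L.va_lt x
      have hli := hGm.lists x (hI.alive x hxQ)
      have hfirst := hli.first
      have hcur : L.Cursor A (P ++ [x]) [] (L.arcs A x) (L.cur x (L.arcs A x)) :=
        Or.inr ⟨x, by simp, rfl, rfl⟩
      have hz : z = 0 := by
        rcases hI.flag with hz | ⟨-, -, -, rfl⟩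
        · exact hz
        · exact absurd hxQ hxP
      have hdlen := hI.done_le
      have hP' : L.qb + Q.length - (L.qb + P.length) ≠ 0 := by omega
      simp [wp, searchStep, hB'.r5, hsub, hB'.r1, hI.r21, hI.r22, hx, hfirst, hP']
      refine ⟨by omega, by omega, by omega, S, Q, P ++ [x], h, [], L.arcs A x, z,
        { hI with
          scanned := ⟨r, by simpa using hr⟩
          cursor := by simpa using hcur
          closed := ?_
          done_mem := by simp
          no_cand := ?_
          r14 := by simp [hI.r14]
          r22 := by simp [hI.r22]
          r21 := by simp; omega
          r23 := by simp [hI.r23]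
          r34 := by simp [hI.r34]
          flag := Or.inl hz
          regs := ?_ }, ?_⟩
      · simp only [List.mem_append, List.mem_singleton]
        rintro v (hv | rfl) y hy hvy
        · rcases hI.closed v hv y hy hvy with h | h | ⟨b, hb, rfl⟩
          · exact Or.inl h
          · exact Or.inr (Or.inl h)
          · simp at hb
        · exact Or.inr (Or.inr (L.exists_mem_arcs hvy hy))
      · intro hn
        refine ⟨fun b hb => ?_, fun y hy hyP => (hI.no_cand hn).2 y hy (fun h => hyP (by simp [h]))⟩
        rw [(L.mem_arcs.1 hb).2.1]
        exact (hI.no_cand hn).2 x hxQ hxP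
      · intro i hi hi'
        simp only [State.setReg_reg]
        repeat rw [Function.update_of_ne (by omega)]
        exact hI.regs i hi hi'
      · simp only [List.length_append, List.length_singleton, List.length_nil]
        have : (P.length + 1) * (L.k + 2) = P.length * (L.k + 2) + (L.k + 2) := by ring
        omega
    | nil =>
      rw [List.append_nil] at hr
      subst hr
      have hP' : L.qb + P.length - (L.qb + P.length) = 0 := by omega
      cases h with
      | some v =>
        -- the queue is exhausted, so the candidate is part of every solution
        have hQk := hv2 (by simp)
        obtain ⟨hvA, hvQ, u, huS, huv⟩ := hI.hole v rfl
        have hrv : s'.reg 23 = L.va v := hI.r23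
        have hvv := L.va_lt v
        have hvl := L.le_va v
        have hrv' : L.va v ≠ 0 := by omega
        have hnd : (P ++ [v]).Nodup := by
          rw [List.nodup_append]
          exact ⟨hI.nodup, List.nodup_singleton _, by simp; rintro b hb rfl; exact hvQ hb⟩
        have hvS : v ∉ S := fun h => hvQ (hI.subset v h)
        have hndS : (S ++ [v]).Nodup := by
          rw [List.nodup_append]
          exact ⟨hI.nodupS, List.nodup_singleton _, by simp; rintro b hb rfl; exact hvS hb⟩
        have hQn' := length_le_of_nodup hnd
        have hSn' := length_le_of_nodup hndS
        rw [List.length_append, List.length_singleton] at hQn' hSn'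
        have hz : z = 0 := by
          rcases hI.flag with hz | ⟨-, hz, -⟩
          · exact hz
          · simp at hz
        simp [wp, searchStep, hB'.r5, hsub, hB'.r1, hI.r21, hI.r22, hrv, hrv', hI.r14]
        have hpre : P <+: P ++ [v] := List.prefix_append _ _
        refine ⟨by omega, by omega, by omega, by omega, S ++ [v], P ++ [v], P, none, done, [],
          z,
          { hI with
            pre := hI.pre.trans (List.prefix_append _ _)
            nodupS := hndS
            subset := ?_
            nodup := hnd
            alive := ?_
            hole := by simp
            arrS := ?_
            arr := ?_
            marks := ?_
            frame := (hI.frame.update (Or.inl (by omega))).update (Or.inl (by omega))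
            scanned := hpre
            closed := ?_
            cursor := by simpa using hI.cursor
            done_mem := ?_
            no_cand := ?_
            connS := ?_
            conn := ?_
            len := by simp; omega
            lenS := by simp; omega
            sol := ?_
            r14 := by simp; omega
            r22 := by simp; omega
            r21 := by simp [hI.r21]
            r23 := by simp
            r34 := by simp [hI.r34]
            flag := Or.inl hz
            regs := ?_ }, ?_⟩
        · simp only [List.mem_append, List.mem_singleton]
          rintro x (hx | rfl)
          · exact Or.inl (hI.subset x hx)
          · simp
        · simp only [List.mem_append, List.mem_singleton]
          rintro x (hx | rfl)
          · exact hI.alive x hx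
          · exact hvA
        · simp only [State.setReg_mem, State.setMem_mem]
          exact (hI.arrS.update (by omega)).push rfl
        · simp only [State.setReg_mem, State.setMem_mem]
          exact (hI.arr.push rfl).update (by omega)
        · have := (hI.marks.frame_update (x := L.qb + P.length) (v := L.va v)
            (by omega)).frame_update (x := L.st + S.length) (v := L.va v) (by omega)
          rw [toFinset_concat]
          simpa using this
        · intro x hx y hy hxy
          rcases hI.closed x hx y hy hxy with h | h | ⟨b, hb, -⟩
          · exact Or.inl (by simp [h])
          · rw [Option.some.inj h]; simp
          · simp at hb
        · intro b hb
          rcases hI.done_mem b hb with h | h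
          · exact Or.inl (by simp [h])
          · rw [Option.some.inj h]; simp
        · refine fun _ => ⟨by simp, fun x hx hxP => ?_⟩
          rw [List.mem_append, List.mem_singleton] at hx ⊢
          exact Or.inr (hx.resolve_left hxP)
        · rw [toFinset_concat]
          exact hI.connS.insert_of_adj (List.mem_toFinset.2 huS) huv
        · rw [toFinset_concat]
          exact hI.conn.insert_of_adj (List.mem_toFinset.2 (hI.subset u huS)) huv
        · rw [toFinset_concat, ← hI.sol]
          refine Sol_forced (R := P.toFinset) hI.connS.nonempty ?_ ?_ ?_
          · intro x hx
            rw [List.mem_toFinset] at hx ⊢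
            exact hI.subset x hx
          · rwa [List.toFinset_card_of_nodup hI.nodup]
          · intro x hx y hy hxy
            rw [List.mem_toFinset] at hx ⊢
            rcases hI.closed x hx y hy hxy with h | h | ⟨b, hb, -⟩
            · exact Or.inr h
            · exact Or.inl (Option.some.inj h).symm
            · simp at hb
        · intro i hi hi'
          simp only [State.setReg_reg, State.setMem_reg]
          repeat rw [Function.update_of_ne (by omega)]
          exact hI.regs i hi hi'
        · simp only [List.length_append, List.length_singleton]
          omega
      | none =>
        have hrv : s'.reg 23 = 0 := h23.2 rfl
        have hz := hv1 rfl
        simp [wp, searchStep, hB'.r5, hsub, hI.r21, hI.r22, hrv]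
        refine ⟨by rintro rfl; omega, S, P, P, none, done, [], 1,
          { hI with
            cursor := by simpa using hI.cursor
            r14 := by simp [hI.r14]
            r22 := by simp [hI.r22]
            r21 := by simp [hI.r21]
            r23 := by simp [hI.r23]
            r34 := by simp
            flag := Or.inr ⟨rfl, rfl, rfl, rfl⟩
            regs := ?_ }, by omega⟩
        intro i hi hi'
        simp only [State.setReg_reg]
        repeat rw [Function.update_of_ne (by omega)]
        exact hI.regs i hi hi'

end GraphletEnum

namespace GraphletEnum

/-! ### Subproblems: search, leaves and unique solutions -/

variable {n : ℕ} {G : SimpleGraph (Fin n)} {L : Layout G} {cells w : ℕ}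

open Layout

/-- The machine is about to treat the subproblem `(A, S)`. -/
structure Node (L : Layout G) (A : Finset (Fin n)) (S : List (Fin n)) (s : State) : Prop where
  base : Base L s
  graph : L.GraphMem A s.mem
  arr : L.Arr s.mem L.st S
  nodup : S.Nodup
  alive : ∀ x ∈ S, x ∈ A
  conn : Conn G S.toFinset
  r14 : s.reg 14 = L.st + S.length
  marks : L.Marks s.mem ∅
  len : S.length ≤ L.k - 1

lemma searchC_spec (hH : 0 < L.H) (hF : Fits L cells w) {s₀ s : State} (hB : Base L s₀)
    {A : Finset (Fin n)} (hG : L.GraphMem A s₀.mem) {S : List (Fin n)} (hN : Node L A S s₀)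
    (hQ : L.Arr s.mem L.qb S) (hM : L.Marks s.mem S.toFinset) (hf : L.Frame L.qb s₀.mem s.mem)
    (h22 : s.reg 22 = L.qb + S.length) (ho : s.out = s₀.out) (hr : ∀ r < 20, s.reg r = s₀.reg r) :
    Halts cells w searchC s (33 * (L.k * L.k + 4 * L.k + 1) + 11) (fun s' =>
      ∃ S' Q P h done rest z, SearchInv L A s₀ S S' Q P h done rest z s' ∧
        searchVal L.k S' Q h z = 0) := by
  have h1 := hF.mem_le; have h2 := hF.word_le; have hk2 := hF.two_le; have hkn := hF.le
  obtain ⟨o1, o2, o3⟩ := L.order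
  have hh := L.hdr_le_ord
  have hB' : Base L s := hB.congr fun r h => hr r (by omega)
  have hSn := length_le_of_nodup hN.nodup
  have hlS := hN.len
  refine (Halts.wp_seq (B := 33 * (L.k * L.k + 4 * L.k + 1) + 1) (P := fun s' =>
      ∃ S' Q P h done rest z, SearchInv L A s₀ S S' Q P h done rest z s' ∧
        searchVal L.k S' Q h z = 0)
      ?_).mono (by simp only [Cmd.size, searchTest]; omega) (fun _ h => h)
  simp only [wp]
  refine ⟨by rw [hB'.r8, hB'.r0]; omega, by positivity, by positivity, by positivity, ?_⟩
  refine searchTest_wp hH hB (S₀ := S) (S := S) (Q := S) (P := []) (h := none) (done := [])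
    (rest := []) (z := 0) (A := A) ?_ fun s₂ hI h24 => ?_
  · refine ⟨List.prefix_rfl, hN.nodup, fun _ h => h, hN.nodup, hN.alive, by simp, ?_, hQ,
      by simpa using hM, hf.mono (by omega), List.nil_prefix, ?_, by simp [h22], ?_, by simp,
        by simp,
      ?_, by simp, by simp, by simp, hN.conn, hN.conn, hN.len, by omega, rfl, Or.inl rfl, ho, ?_⟩
    · exact hN.arr.frame hf (by omega) (by omega)
    · simp [hr, hN.r14]
    · simp [hB'.r8, hB'.r0]
    · left; refine ⟨rfl, rfl, ?_⟩; simp; omega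
    · intro r h14 _
      simp only [State.setReg_reg]
      repeat rw [Function.update_of_ne (by omega)]
      exact hr r h14
  · refine (Halts.loop (T₀ := 0) (B := 33 * (L.k * L.k + 4 * L.k + 1))
      (fun T s' => ∃ S' Q P h done rest z, SearchInv L A s₀ S S' Q P h done rest z s' ∧
        s'.reg 24 = searchVal L.k S' Q h z ∧
        T ≤ 33 * (P.length * (L.k + 2) + done.length + S'.length + z)) ?_ ?_ ?_).mono le_rfl ?_
    · exact ⟨S, S, [], none, [], [], 0, hI, h24, by simp⟩
    · rintro T s' ⟨S', Q, P, h, done, rest, z, hI, -, hT⟩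
      have d1 := hI.done_le
      have d2 := hI.lenS
      have d3 := hI.scanned.length_le.trans hI.len
      have d4 : z ≤ 1 := by rcases hI.flag with h | h <;> omega
      have d5 := Nat.mul_le_mul_right (L.k + 2) d3
      have d6 : L.k * (L.k + 2) = L.k * L.k + 2 * L.k := by ring
      omega
    · rintro T s' ⟨S', Q, P, h, done, rest, z, hI, h24, hT⟩ h7
      have := searchStep_spec hH hF hB hG hI hT (h24 ▸ h7)
      refine ⟨32, ((Halts.of_wp this).seq fun s₁ hs₁ => ?_).mono
        (B := searchStep.size + searchTest.size) (by simp [Cmd.size, searchStep, searchTest])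
        fun _ h => h⟩
      obtain ⟨S', Q, P, h, done, rest, z, hI, hT⟩ := hs₁
      exact Halts.of_wp (searchTest_wp hH hB hI fun s₂ hI₂ h24 =>
        ⟨S', Q, P, h, done, rest, z, hI₂, h24, by omega⟩)
    · rintro s' ⟨h0, T, S', Q, P, h, done, rest, z, hI, h24, hT⟩
      exact ⟨S', Q, P, h, done, rest, z, hI, by rw [← h24, h0]⟩

/-- Search for a candidate, and remove all marks. -/
def prepC : Cmd :=
  copyC ;; searchC ;; clearC ;; .cond 23 (.add 26 23 12 ;; .store 26 0) .skip

/-- The outcome of the search: the connected set `S₀` has been extended by forced vertices to `S`.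
Then `S` lacks one vertex only, or there is a vertex `h` such that there are solutions with and
without it, or the queue `Q` is the only solution. -/
structure PrepOut (L : Layout G) (A : Finset (Fin n)) (s : State) (S₀ S Q : List (Fin n))
    (h : Option (Fin n)) (s' : State) : Prop where
  pre : S₀ <+: S
  node : Node L A S s'
  nodupQ : Q.Nodup
  arrQ : L.Arr s'.mem L.qb Q
  frame : L.Frame (L.st + S₀.length) s.mem s'.mem
  r22 : s'.reg 22 = L.qb + Q.length
  r23 : s'.reg 23 = h.elim 0 L.va
  sol : Sol G L.k A S.toFinset = Sol G L.k A S₀.toFinset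
  out : s'.out = s.out
  regs : ∀ r < 20, r ≠ 14 → s'.reg r = s.reg r
  cases : S.length = L.k - 1 ∨
    (S.length < L.k - 1 ∧ ∃ v, h = some v ∧ v ∈ A ∧ v ∉ S ∧ (∃ u ∈ S, G.Adj u v) ∧
      (Sol G L.k (A.erase v) S.toFinset).Nonempty) ∨
    (S.length < L.k - 1 ∧ h = none ∧ Q.length = L.k ∧
      Sol G L.k A S.toFinset = {Q.toFinset})

/-- What the end of the search says about the solutions. If there is a candidate, the queue has `k`
vertices; it is connected and avoids the candidate. -/
lemma SearchInv.cases {A : Finset (Fin n)} {s s₁ : State} {S₀ S Q P : List (Fin n)}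
    {h : Option (Fin n)} {done rest : List ℕ} {z : ℕ}
    (hI : SearchInv L A s S₀ S Q P h done rest z s₁) (hv : searchVal L.k S Q h z = 0)
    (hne : (Sol G L.k A S₀.toFinset).Nonempty) :
    S.length = L.k - 1 ∨
    (S.length < L.k - 1 ∧ ∃ v, h = some v ∧ v ∈ A ∧ v ∉ S ∧ (∃ u ∈ S, G.Adj u v) ∧
      (Sol G L.k (A.erase v) S.toFinset).Nonempty) ∨
    (S.length < L.k - 1 ∧ h = none ∧ Q.length = L.k ∧
      Sol G L.k A S.toFinset = {Q.toFinset}) := by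
  have hlS := hI.lenS
  have hlQ := hI.len
  have hsub : S.toFinset ⊆ Q.toFinset := fun x hx => by
    rw [List.mem_toFinset] at hx ⊢; exact hI.subset x hx
  by_cases hS : S.length < L.k - 1
  swap
  · left; omega
  right
  rw [searchVal, if_pos hS] at hv
  cases h with
  | some v =>
    left
    rw [if_neg (by simp)] at hv
    obtain ⟨h1, h2, h3⟩ := hI.hole v rfl
    refine ⟨hS, v, rfl, h1, fun h => h2 (hI.subset v h), h3, ?_⟩
    refine Sol_nonempty_of_subset hI.connS hI.conn hsub ?_ ?_ ?_
    · intro x hx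
      rw [List.mem_toFinset] at hx
      rw [Finset.mem_erase]
      exact ⟨by rintro rfl; exact h2 hx, hI.alive x hx⟩
    · rw [List.toFinset_card_of_nodup hI.nodupS]; omega
    · rw [List.toFinset_card_of_nodup hI.nodup]; omega
  | none =>
    right
    rw [if_pos rfl] at hv
    rcases hI.flag with h1 | ⟨-, -, rfl, rfl⟩
    · omega
    · have := Sol_closed (k := L.k) (A := A) hI.connS.nonempty hsub (by rwa [hI.sol])
        (by rwa [List.toFinset_card_of_nodup hI.nodup]) (by
          intro x hx y hy hxy
          rw [List.mem_toFinset] at hx ⊢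
          rcases hI.closed x hx y hy hxy with h | h | ⟨b, hb, -⟩
          · exact h
          · simp at h
          · simp at hb)
      rw [List.toFinset_card_of_nodup hI.nodup] at this
      exact ⟨hS, rfl, this.2, this.1⟩

lemma prepC_spec (hH : 0 < L.H) (hF : Fits L cells w) {s : State} {A : Finset (Fin n)}
    {S : List (Fin n)} (hN : Node L A S s) (hne : (Sol G L.k A S.toFinset).Nonempty) :
    Halts cells w prepC s (150 * (L.k * L.k)) (fun s' =>
      ∃ S' Q h, PrepOut L A s S S' Q h s') := by
  have h1 := hF.mem_le; have h2 := hF.word_le; have hk2 := hF.two_le; have hkn := hF.le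
  obtain ⟨o1, o2, o3⟩ := L.order
  have hh := L.hdr_le_ord
  have hSn := length_le_of_nodup hN.nodup
  have hlS := hN.len
  have hkk : 2 * L.k ≤ L.k * L.k := Nat.mul_le_mul_right _ hk2
  refine ((copyC_spec hF hN.base hN.arr hSn hN.r14 hN.marks).seq (B' := 33 * (L.k * L.k + 4 * L.k + 1) + 11 +
    (6 * L.k + 3 + 4)) ?_).mono (B' := 150 * (L.k * L.k)) (by omega) (fun _ h => h)
  rintro s₁ ⟨i1, i2, i3, i4, i5, i6⟩
  refine (searchC_spec hH hF hN.base hN.graph hN i1 i2 i3 i4 i5 i6).seq ?_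
  rintro s₂ ⟨S', Q, P, h, done, rest, z, hI, hv⟩
  have hQk := hI.len
  have hQn := length_le_of_nodup hI.nodup
  have hS'n := length_le_of_nodup hI.nodupS
  have hpre := hI.pre.length_le
  have hB2 := hI.base hN.base
  refine ((clearC_spec hF hB2 hI.arr hQn hI.r22 hI.marks).mono
    (B' := 6 * L.k + 3) (by omega) fun _ h => h).seq ?_
  rintro s₃ ⟨j1, j2, j3, j4, j5⟩
  have hB3 : Base L s₃ := hB2.congr fun r hr => j5 r (by omega)
  have hcases := hI.cases hv hne
  have haS : ∀ x ∈ S', x ∈ A := fun x hx => hI.alive x (hI.subset x hx)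
  have harr := hI.arrS.frame j3 (by omega) (by omega)
  have hfr := hI.frame.trans j3 (by omega)
  refine (Halts.of_wp (c := .cond 23 (.add 26 23 12 ;; .store 26 0) .skip) ?_).mono
    (by simp [Cmd.size]) fun _ h => h
  have h23 : s₃.reg 23 = h.elim 0 L.va := by rw [j5 23 (by norm_num), hI.r23]
  cases h with
  | none =>
    simp only [wp, h23, Option.elim_none]
    refine ⟨fun h => absurd rfl h, fun _ => ⟨S', Q, none, hI.pre,
      ⟨hB3, hN.graph.frame hfr (by omega), harr, hI.nodupS, haS, hI.connS, ?_, ?_, hI.lenS⟩,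
      hI.nodup, j1, hfr, ?_, h23, hI.sol, ?_, ?_, hcases⟩⟩
    · rw [j5 14 (by norm_num), hI.r14]
    · simpa using j2
    · rw [j5 22 (by norm_num), hI.r22]
    · rw [j4, hI.out]
    · intro r hr hr'
      rw [j5 r (by omega), hI.regs r hr hr']
  | some v =>
    have hvl := L.va_lt v
    have hvl' := L.le_va v
    have h23' : s₃.reg 23 = L.va v := h23
    simp [wp, h23', hB3.r12, hB3.r0]
    refine ⟨fun _ => ⟨by omega, by omega, S', Q, some v, hI.pre,
      ⟨hB3.congr ?_, ?_, harr.update (by omega), hI.nodupS, haS, hI.connS, ?_, ?_, hI.lenS⟩,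
      hI.nodup, j1.update (by omega), hfr.update (Or.inr ⟨_, rfl⟩), ?_, ?_, hI.sol, ?_, ?_,
        hcases⟩, by omega⟩
    · intro r hr
      simp [show r ≠ 26 by omega]
    · exact hN.graph.frame (hfr.update (Or.inr ⟨_, rfl⟩)) (by omega)
    · simp; rw [j5 14 (by norm_num), hI.r14]
    · have := j2.erase v
      rwa [show ((some v).toFinset ∪ Q.toFinset) \ Q.toFinset = {v} by
        rw [Finset.union_sdiff_right, Option.toFinset_some, Finset.sdiff_eq_self_of_disjoint]
        simpa using (hI.hole v rfl).2.1, Finset.erase_singleton] at this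
    · simp; rw [j5 22 (by norm_num), hI.r22]
    · simp [h23']
    · exact j4.trans hI.out
    · intro r hr hr'
      simp [show r ≠ 26 by omega]
      rw [j5 r (by omega), hI.regs r hr hr']

/-- The blocks list the members of the family `F`, each of them once. -/
def Lists (blocks : List (List (Fin n))) (F : Finset (Finset (Fin n))) : Prop :=
  (∀ b ∈ blocks, b.Nodup) ∧ (blocks.map List.toFinset).Nodup ∧
    ∀ T, T ∈ blocks.map List.toFinset ↔ T ∈ F

/-- The output words for a list of blocks. -/
def blockWords (blocks : List (List (Fin n))) : List ℕ :=
  blocks.flatMap fun b => b.map Fin.val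

lemma Lists.append {b₁ b₂ : List (List (Fin n))} {F₁ F₂ : Finset (Finset (Fin n))}
    (h₁ : Lists b₁ F₁) (h₂ : Lists b₂ F₂) (hd : Disjoint F₁ F₂) :
    Lists (b₁ ++ b₂) (F₁ ∪ F₂) := by
  refine ⟨fun b hb => ?_, ?_, fun T => ?_⟩
  · rcases List.mem_append.1 hb with hb | hb
    · exact h₁.1 b hb
    · exact h₂.1 b hb
  · rw [List.map_append, List.nodup_append]
    refine ⟨h₁.2.1, h₂.2.1, ?_⟩
    rintro a ha b hb rfl
    exact Finset.disjoint_left.1 hd ((h₁.2.2 a).1 ha) ((h₂.2.2 a).1 hb)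
  · rw [List.map_append, List.mem_append, Finset.mem_union, h₁.2.2, h₂.2.2]

@[simp] lemma blockWords_append (b₁ b₂ : List (List (Fin n))) :
    blockWords (b₁ ++ b₂) = blockWords b₁ ++ blockWords b₂ := by
  simp [blockWords]

/-- A vertex of a connected set of fewer than `k` vertices has few alive neighbors. -/
lemma arcs_length_le {A : Finset (Fin n)} {S : Finset (Fin n)} {v : Fin n} (hS : Conn G S)
    (hne : (Sol G L.k A S).Nonempty) (hk : S.card < L.k) (hv : v ∈ S) :
    (L.arcs A v).length ≤ L.k + L.k * (Sol G L.k A S).card := by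
  rw [← List.length_map (f := L.tgt), ← List.toFinset_card_of_nodup L.map_tgt_nodup]
  refine degree_le_card_Sol hS hne hk hv fun x hx => ?_
  rw [List.mem_toFinset, List.mem_map] at hx
  obtain ⟨a, ha, rfl⟩ := hx
  exact ⟨(L.mem_arcs.1 ha).2.2, L.adj_of_mem_arcs ha⟩

/-- Output the queue. -/
def uniqueC : Cmd := .add 30 8 0 ;; .add 31 22 0 ;; emitC ;; .const 16 0

lemma uniqueC_spec (hF : Fits L cells w) {s : State} (hB : Base L s) {A : Finset (Fin n)}
    (hG : L.GraphMem A s.mem) {Q : List (Fin n)} (hQ : L.Arr s.mem L.qb Q) (hn : Q.length ≤ n)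
    (h22 : s.reg 22 = L.qb + Q.length) :
    Halts cells w uniqueC s (7 * Q.length + 5) (fun s' => s'.mem = s.mem ∧
      s'.out = s.out ++ blockWords [Q] ∧ s'.reg 16 = 0 ∧ ∀ r < 20,
        r ≠ 16 → s'.reg r = s.reg r) := by
  have h1 := hF.mem_le; have h2 := hF.word_le
  obtain ⟨o1, o2, o3⟩ := L.order
  refine (Halts.wp_seq (c := .add 30 8 0) (B := 1 + (7 * Q.length + 2 + 1)) ?_).mono
    (by simp only [Cmd.size]; omega) (fun _ h => h)
  refine ⟨by rw [hB.r8, hB.r0]; omega, Halts.wp_seq (c := .add 31 22 0) ⟨?_, ?_⟩⟩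
  · simp [hB.r0, h22]; omega
  change Halts cells w (emitC ;; .const 16 0) _ _ _
  refine (emitC_spec hF (S := Q) (A := A) (b := L.qb) (hB.congr fun r hr => ?_) ?_ ?_ (by omega) ?_
    ?_).seq ?_
  · simp [show r ≠ 31 by omega, show r ≠ 30 by omega]
  · exact hG
  · exact hQ
  · simp [hB.r8, hB.r0]
  · simp [h22, hB.r0]
  · rintro s₁ ⟨i1, i2, i3⟩
    refine Halts.of_wp (c := .const 16 0) ⟨by positivity, i1, by simpa [blockWords] using i2,
      by simp, fun r hr hr' => ?_⟩
    rw [State.setReg_reg, Function.update_of_ne hr', i3 r (by omega)]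
    simp [show r ≠ 31 by omega, show r ≠ 30 by omega]

/-- For each vertex from register 32 up to the end of the queue, output the connected set together
with that vertex. -/
def leafEmitC : Cmd :=
  (.add 32 19 0 ;; .sub 33 22 32) ;; .loop 33
    ((.add 30 7 0 ;; .add 31 14 0) ;; emitC ;; (.load 27 32 ;; .add 26 27 13 ;; .load 27 26 ;;
      .emit 27 ;;
      .add 32 32 1 ;; .sub 33 22 32))

lemma leafEmitC_spec (hF : Fits L cells w) {s : State} (hB : Base L s) {A : Finset (Fin n)}
    (hG : L.GraphMem A s.mem) {S N : List (Fin n)} (hS : L.Arr s.mem L.st S) (hSn : S.length ≤ n)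
    (hSk : S.length ≤ L.k)
    (h14 : s.reg 14 = L.st + S.length) (hQ : L.Arr s.mem L.qb (S ++ N)) (hn : (S ++ N).length ≤ n)
    (h19 : s.reg 19 = L.qb + S.length) (h22 : s.reg 22 = L.qb + (S ++ N).length) :
    Halts cells w leafEmitC s ((7 * L.k + 11) * N.length + 3) (fun s' => s'.mem = s.mem ∧
      s'.out = s.out ++ blockWords (N.map fun x => S ++ [x]) ∧
      ∀ r < 24, s'.reg r = s.reg r) := by
  have h1 := hF.mem_le; have h2 := hF.word_le
  obtain ⟨o1, o2, o3⟩ := L.order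
  have hh := L.hdr_le_ord
  rw [List.length_append] at hn h22
  refine (Halts.wp_seq (B := (7 * L.k + 11) * N.length + 1) (P := fun s' => s'.mem = s.mem ∧
      s'.out = s.out ++ blockWords (N.map fun x => S ++ [x]) ∧
      ∀ r < 24, s'.reg r = s.reg r)
      ?_).mono (by simp only [Cmd.size]; omega) (fun _ h => h)
  simp [wp, hB.r0, h19, h22]
  refine ⟨by omega, ?_⟩
  refine (Halts.loop (T₀ := 0) (B := (7 * L.k + 11) * N.length)
    (fun T s' => ∃ p q, N = p ++ q ∧ T = (7 * L.k + 11) * p.length ∧ s'.mem = s.mem ∧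
      s'.reg 32 = L.qb + S.length + p.length ∧ s'.reg 33 = q.length ∧
      s'.out = s.out ++ blockWords (p.map fun x => S ++ [x]) ∧ ∀ r < 24, s'.reg r = s.reg r)
      ?_ ?_ ?_).mono le_rfl ?_
  · refine ⟨[], N, rfl, rfl, rfl, by simp, by simp; omega, by simp [blockWords], fun r hr => ?_⟩
    simp [show r ≠ 33 by omega, show r ≠ 32 by omega]
  · rintro T s' ⟨p, q, rfl, rfl, -⟩
    rw [Nat.zero_add]; exact Nat.mul_le_mul_left _ (by simp)
  · rintro T s' ⟨p, q, hpq, rfl, i1, i2, i3, i4, i5⟩ h7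
    have hB' : Base L s' := hB.congr fun r hr => i5 r (by omega)
    cases q with
    | nil => simp at i3; omega
    | cons x q =>
      have hlen := congrArg List.length hpq
      simp only [List.length_append, List.length_cons] at hlen
      have hx : s.mem (L.qb + S.length + p.length) = L.va x := by
        have := hQ (S.length + p.length) (by rw [List.length_append]; omega)
        rw [← add_assoc] at this
        rw [this]
        simp [hpq]
      have hxlt := L.va_lt x
      refine ⟨7 * L.k + 10, (Halts.wp_seq (c := .add 30 7 0 ;; .add 31 14 0)
        (B := 7 * S.length + 2 + 6) ?_).mono (by simp only [Cmd.size]; omega) fun _ h => h⟩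
      simp [wp, hB'.r7, hB'.r0, i5, h14]
      refine ⟨by omega, by omega, ?_⟩
      refine (emitC_spec hF (S := S) (A := A) (b := L.st) (hB'.congr fun r hr => ?_) ?_ ?_
        (by omega) ?_ ?_).seq ?_
      · simp [show r ≠ 31 by omega, show r ≠ 30 by omega]
      · simpa [i1] using hG
      · simpa [i1] using hS
      · simp
      · simp
      · rintro s₁ ⟨j1, j2, j3⟩
        simp only [State.setReg_mem, State.setReg_out, State.setReg_reg] at j1 j2 j3
        have hB1 : Base L s₁ := hB'.congr fun r hr => by
          rw [j3 r (by omega)]; simp [show r ≠ 31 by omega, show r ≠ 30 by omega]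
        have h32 : s₁.reg 32 = L.qb + S.length + p.length := by
          rw [j3 32 (by omega)]; simp [i2]
        have h22' : s₁.reg 22 = L.qb + (S.length + N.length) := by
          rw [j3 22 (by omega)]; simp [i5, h22]
        have hm : s₁.mem = s.mem := by rw [j1, i1]
        refine Halts.of_wp (c := .load 27 32 ;; .add 26 27 13 ;; .load 27 26 ;; .emit 27 ;;
          .add 32 32 1 ;; .sub 33 22 32) ?_
        simp [wp, h32, hm, hx, hB1.r13, hB1.r1, hG.label, h22']
        refine ⟨by omega, by omega, by omega, by omega, p ++ [x], q, by simpa using hpq, ?_, ?_, ?_,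
          ?_, ?_⟩
        · simp; ring
        · simp; omega
        · omega
        · rw [j2, i4]; simp [blockWords]
        · intro r hr
          repeat rw [Function.update_of_ne (by omega)]
          rw [j3 r (by omega)]
          simp [show r ≠ 31 by omega, show r ≠ 30 by omega, i5 r hr]
  · rintro s' ⟨h0, T, p, q, hpq, rfl, i1, i2, i3, i4, i5⟩
    rw [h0] at i3
    obtain rfl := List.length_eq_zero_iff.1 i3.symm
    rw [List.append_nil] at hpq
    subst hpq
    exact ⟨i1, i4, i5⟩

/-- Output all solutions when the connected set lacks one vertex only. -/
def leafC : Cmd := copyC ;; .add 19 22 0 ;; scanC 19 ;; leafEmitC ;; clearC ;; .const 16 0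

lemma leafC_spec (hF : Fits L cells w) {s : State} {A : Finset (Fin n)}
    {S : List (Fin n)} (hN : Node L A S s) (hne : (Sol G L.k A S.toFinset).Nonempty)
    (hk : S.length = L.k - 1) :
    Halts cells w leafC s (100 * (L.k * L.k) * (Sol G L.k A S.toFinset).card) (fun s' =>
      ∃ blocks, Lists blocks (Sol G L.k A S.toFinset) ∧ s'.out = s.out ++ blockWords blocks ∧
        L.Frame L.qb s.mem s'.mem ∧ L.Marks s'.mem ∅ ∧ s'.reg 16 = 0 ∧
        ∀ r < 19, r ≠ 16 → s'.reg r = s.reg r) := by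
  have h1 := hF.mem_le; have h2 := hF.word_le; have hk2 := hF.two_le; have hkn := hF.le
  obtain ⟨o1, o2, o3⟩ := L.order
  have hh := L.hdr_le_ord
  have hSn := length_le_of_nodup hN.nodup
  set f := (Sol G L.k A S.toFinset).card with hf
  have hf1 : 1 ≤ f := Finset.card_pos.2 hne
  have hScard : S.toFinset.card = L.k - 1 := by rw [List.toFinset_card_of_nodup hN.nodup, hk]
  refine ((copyC_spec hF hN.base hN.arr hSn hN.r14 hN.marks).seq
    (B' := 1 + ((19 * (L.k * (L.k + L.k * f + 1)) + 6) + ((7 * L.k + 11) * f + 3 + (6 * (L.k + f) + 3 + 1))))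
    ?_).mono ?_ (fun _ h => h)
  swap
  · have e1 : L.k * (L.k + L.k * f + 1) = L.k * L.k + L.k * L.k * f + L.k := by ring
    have e2 : (7 * L.k + 11) * f = 7 * (L.k * f) + 11 * f := by ring
    have e3 : L.k * L.k * 1 ≤ L.k * L.k * f := Nat.mul_le_mul_left _ hf1
    have e4 : 2 * L.k ≤ L.k * L.k := Nat.mul_le_mul_right _ hk2
    have e5 : 2 * L.k * f ≤ L.k * L.k * f := Nat.mul_le_mul_right _ e4
    have e6 : 2 * f ≤ L.k * f := Nat.mul_le_mul_right _ hk2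
    have e7 : 2 * L.k * f = 2 * (L.k * f) := by ring
    have e8 : 100 * (L.k * L.k) * f = 100 * (L.k * L.k * f) := by ring
    omega
  rintro s₁ ⟨i1, i2, i3, i4, i5, i6⟩
  have hB1 : Base L s₁ := hN.base.congr fun r hr => i6 r (by omega)
  refine Halts.wp_seq (c := .add 19 22 0) ?_
  simp only [wp, hB1.r0, i4, add_zero]
  refine ⟨by omega, ?_⟩
  refine (scanC_spec (lim := 19) (S := S) (A := A) hF (hB1.congr fun r hr => ?_) ?_ ?_ hN.nodup hN.alive hN.conn
    ?_ ?_ (Or.inr ⟨by norm_num, by norm_num⟩) ?_ (B := L.k * (L.k + L.k * f + 1)) ?_).seq ?_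
  · simp [show r ≠ 19 by omega]
  · exact hN.graph.frame i3 (by omega)
  · exact i1
  · exact i2
  · simp [i4]
  · simp
  · intro P hP hPS
    have h3 : ∀ y ∈ P.map (fun u => (L.arcs A u).length + 1), y ≤ L.k + L.k * f + 1 := by
      intro y hy
      obtain ⟨u, hu, rfl⟩ := List.mem_map.1 hy
      have := arcs_length_le hN.conn hne (by omega) (List.mem_toFinset.2 (hPS (by norm_num) hu))
      rw [← hf] at this
      omega
    have h4 := List.sum_le_card_nsmul _ _ h3
    rw [List.length_map, smul_eq_mul] at h4
    have h5 : P.length ≤ S.length := (hP.subperm (hPS (by norm_num))).length_le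
    exact h4.trans (Nat.mul_le_mul_right _ (by omega))
  · rintro s₂ ⟨Q, P, hI, hP, -⟩
    obtain rfl := hP (by norm_num)
    obtain ⟨N, rfl⟩ := hI.pre
    have hB2 : Base L s₂ := hB1.congr fun r hr => by
      rw [hI.regs r (by omega)]; simp [show r ≠ 19 by omega]
    have hQn := length_le_of_nodup hI.nodup
    have hnd := hI.nodup
    rw [List.nodup_append] at hnd
    have hfr : L.Frame L.qb s.mem s₂.mem := i3.trans hI.frame le_rfl
    have h14 : s₂.reg 14 = L.st + P.length := by
      rw [hI.regs 14 (by norm_num)]; simp [i6, hN.r14]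
    have h19 : s₂.reg 19 = L.qb + P.length := by
      rw [hI.regs 19 (by norm_num)]; simp
    have hS2 := hN.arr.frame hfr (by omega) (by omega)
    have hG2 := hN.graph.frame hfr (by omega)
    have hsol := Sol_last (k := L.k) (A := A) hN.conn (by omega)
      (fun x hx => hN.alive x (List.mem_toFinset.1 hx)) N.toFinset (by
        intro x
        rw [List.mem_toFinset]
        constructor
        · intro hx
          have hxP : x ∉ P := fun h => hnd.2.2 x h x hx rfl
          obtain ⟨u, hu, hux⟩ := hI.new x (by simp [hx]) hxP
          exact ⟨hI.alive x (by simp [hx]), by simpa using hxP, u, by simpa using hu, hux⟩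
        · rintro ⟨hxA, hxP, u, hu, hux⟩
          rw [List.mem_toFinset] at hxP hu
          rcases hI.closed u hu x hxA hux with h | ⟨b, hb, -⟩
          · exact (List.mem_append.1 h).resolve_left hxP
          · simp at hb)
    have hinj : ∀ x ∈ N, ∀ y ∈ N, insert x P.toFinset = insert y P.toFinset → x = y := by
      intro x hx y hy hxy
      have : x ∈ insert y P.toFinset := hxy ▸ Finset.mem_insert_self _ _
      rcases Finset.mem_insert.1 this with h | h
      · exact h
      · exact absurd rfl (hnd.2.2 x (List.mem_toFinset.1 h) x hx)
    have hNf : N.length = f := by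
      rw [hf, hsol, Finset.card_image_of_injOn, List.toFinset_card_of_nodup hnd.2.1]
      intro x hx y hy hxy
      exact hinj x (by simpa using hx) y (by simpa using hy) hxy
    refine ((leafEmitC_spec hF hB2 hG2 hS2 hSn (by omega) h14 hI.arr hQn h19 hI.r22).mono
      (B' := (7 * L.k + 11) * f + 3) (by rw [hNf]) fun _ h => h).seq ?_
    rintro s₃ ⟨j1, j2, j3⟩
    have hB3 : Base L s₃ := hB2.congr fun r hr => j3 r (by omega)
    refine ((clearC_spec (Q := P ++ N) (D := (P ++ N).toFinset) hF hB3 (by rw [j1]; exact hI.arr) hQn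
      (by rw [j3 _ (by norm_num), hI.r22]) (by rw [j1]; exact hI.marks)).mono
      (B' := 6 * (L.k + f) + 3) (by rw [List.length_append]; omega) fun _ h => h).seq ?_
    rintro s₄ ⟨l1, l2, l3, l4, l5⟩
    refine Halts.of_wp (c := .const 16 0) ⟨by positivity, N.map fun x => P ++ [x], ?_, ?_, ?_, ?_,
      ?_,
      ?_⟩
    · refine ⟨?_, ?_, ?_⟩
      · intro b hb
        obtain ⟨x, hx, rfl⟩ := List.mem_map.1 hb
        rw [List.nodup_append]
        refine ⟨hnd.1, List.nodup_singleton _, fun a ha b hb => ?_⟩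
        rw [List.mem_singleton.1 hb]
        exact hnd.2.2 a ha x hx
      · rw [List.map_map]
        refine hnd.2.1.map_on fun x hx y hy hxy => hinj x hx y hy ?_
        simpa only [Function.comp, toFinset_concat] using hxy
      · intro T
        rw [hsol]
        simp only [List.map_map, List.mem_map, Function.comp, toFinset_concat, Finset.mem_image,
          List.mem_toFinset]
    · simp only [State.setReg_out]
      rw [l4, j2, hI.out]
      simp [i5]
    · simp only [State.setReg_mem]
      refine hfr.trans (?_ : L.Frame L.qb _ _) le_rfl
      rw [← j1]; exact l3
    · simpa using l2
    · simp
    · intro r hr hr'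
      rw [State.setReg_reg, Function.update_of_ne hr', l5 r (by omega), j3 r (by omega),
        hI.regs r (by omega)]
      simp [show r ≠ 19 by omega, i6 r (by omega)]

end GraphletEnum

namespace GraphletEnum

/-! ### The traversal of the tree of subproblems -/

variable {n : ℕ} {G : SimpleGraph (Fin n)} {L : Layout G} {cells w : ℕ}

open Layout

/-- Branch on the candidate: record it together with the size of the connected set on the trail,
and add it to the connected set. -/
def branchC : Cmd :=
  .store 15 23 ;; .add 26 15 1 ;; .store 26 14 ;; .add 15 15 12 ;; .store 14 23 ;; .add 14 14 1

/-- Treat a subproblem: output its solutions, or branch and pass to the solutions with the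
candidate. -/
def forwardC : Cmd :=
  prepC ;; .sub 28 10 14 ;; .cond 28 (.cond 23 branchC uniqueC) leafC

/-- Treat the last entry of the trail: after the solutions with a candidate, delete it and pass to
the solutions without it; after those, revert the deletion. -/
def backC : Cmd :=
  .sub 28 15 9 ;; .cond 28
    ((.sub 15 15 12 ;; .load 25 15 ;; .add 26 15 1 ;; .load 35 26) ;;
      .cond 35
        (.add 14 35 0 ;; deleteC ;; (.add 26 15 1 ;; .store 26 0 ;; .add 15 15 12 ;; .const 16 1))
        undeleteC)
    (.const 17 0)

/-- One step of the depth-first traversal of the tree of subproblems. -/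
def stepC : Cmd := .cond 16 forwardC backC

namespace Layout

/-- The memories agree before `p` and in the trail before `q`. -/
def Same (L : Layout G) (p q : ℕ) (m m' : ℕ → ℕ) : Prop :=
  ∀ x, x < p ∨ (L.tr ≤ x ∧ x < q) → m' x = m x

lemma Frame.same {p q : ℕ} {m m' : ℕ → ℕ} (h : L.Frame p m m') {D : Finset (Fin n)}
    (hm : L.Marks m D) (hm' : L.Marks m' D) : L.Same p q m m' := by
  intro x hx
  by_cases hu : ∃ u, x = L.va u + 2
  · obtain ⟨u, rfl⟩ := hu
    rw [hm, hm']
  · push Not at hu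
    exact h x (by omega) hu

lemma Same.trans {p q p' q' : ℕ} {m m' m'' : ℕ → ℕ} (h : L.Same p q m m')
    (h' : L.Same p' q' m' m'') (hp : p ≤ p') (hq : q ≤ q') : L.Same p q m m'' := fun x hx => by
  rw [h' x (by omega), h x hx]

lemma Same.marks {p q : ℕ} {m m' : ℕ → ℕ} (h : L.Same p q m m') (hp : L.ord ≤ p)
    {D : Finset (Fin n)} (hm : L.Marks m D) : L.Marks m' D := fun u => by
  have := L.va_lt u; have := L.hdr_le_ord
  rw [h _ (by omega), hm u]

lemma Same.arr {p q : ℕ} {m m' : ℕ → ℕ} (h : L.Same p q m m') {b : ℕ} {l : List (Fin n)}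
    (hp : b + l.length ≤ p) (hm : L.Arr m b l) : L.Arr m' b l :=
  hm.congr fun i hi => h _ (by omega)

lemma Same.graph {p q : ℕ} {m m' : ℕ → ℕ} (h : L.Same p q m m') (hp : L.ord ≤ p)
    {A : Finset (Fin n)} (hm : L.GraphMem A m) : L.GraphMem A m' :=
  hm.congr fun x hx _ => h x (by omega)

end Layout

/-- The subproblem `(A, S)` has been treated completely, starting from `s`. -/
structure Done (L : Layout G) (A : Finset (Fin n)) (S : List (Fin n)) (s s' : State) : Prop where
  same : L.Same (L.st + S.length) (s.reg 15) s.mem s'.mem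
  r16 : s'.reg 16 = 0
  regs : ∀ r < 19, r ≠ 14 → r ≠ 16 → s'.reg r = s.reg r
  out : ∃ blocks, Lists blocks (Sol G L.k A S.toFinset) ∧ s'.out = s.out ++ blockWords blocks

/-- The subproblem `(A, S)` has been branched on the vertex `v`, after the extension of `S` to
`S'`. -/
structure Branch (L : Layout G) (A : Finset (Fin n)) (S S' : List (Fin n)) (v : Fin n)
    (s s' : State) : Prop where
  pre : S <+: S'
  sol : Sol G L.k A S'.toFinset = Sol G L.k A S.toFinset
  mem : v ∈ A
  nonempty : (Sol G L.k (A.erase v) S'.toFinset).Nonempty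
  nonempty' : (Sol G L.k A (insert v S'.toFinset)).Nonempty
  conn : Conn G S'.toFinset
  len : S'.length < L.k - 1
  node : Node L A (S' ++ [v]) s'
  same : L.Same (L.st + S.length) (s.reg 15) s.mem s'.mem
  tr0 : s'.mem (s.reg 15) = L.va v
  tr1 : s'.mem (s.reg 15 + 1) = L.st + S'.length
  r15 : s'.reg 15 = s.reg 15 + 2
  out : s'.out = s.out
  regs : ∀ r < 20, r ≠ 14 → r ≠ 15 → s'.reg r = s.reg r

/-- A subproblem is treated completely, or it is branched on a vertex such that both parts have
solutions. -/
lemma forwardC_spec (hH : 0 < L.H) (hF : Fits L cells w) {s : State} {A : Finset (Fin n)}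
    {S : List (Fin n)} (hN : Node L A S s) (hne : (Sol G L.k A S.toFinset).Nonempty)
    (h15 : L.tr ≤ s.reg 15) (h15' : s.reg 15 + 2 * (A.card - S.length) ≤ L.tr + 2 * n) :
    Halts cells w forwardC s
        (170 * (L.k * L.k) + 100 * (L.k * L.k) * (Sol G L.k A S.toFinset).card)
        (Done L A S s) ∨
      Halts cells w forwardC s (170 * (L.k * L.k))
        (fun s' => ∃ S' v, Branch L A S S' v s s') := by
  have h1 := hF.mem_le; have h2 := hF.word_le; have hk2 := hF.two_le; have hkn := hF.le
  obtain ⟨o1, o2, o3⟩ := L.order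
  have hh := L.hdr_le_ord
  have hkk : 2 * L.k ≤ L.k * L.k := Nat.mul_le_mul_right _ hk2
  obtain ⟨t, s₁, ex, ht, S', Q, h, hP⟩ := prepC_spec hH hF hN hne
  have hprep : ∀ {B : ℕ} {Post : State → Prop} {c : Cmd}, Halts cells w c s₁ B Post →
      Halts cells w (prepC ;; c) s (150 * (L.k * L.k) + B) Post := by
    rintro B Post c ⟨t', s', ex', ht', hp'⟩
    exact ⟨_, _, ex.seq ex', by omega, hp'⟩
  have hB1 := hP.node.base
  have hS'n := length_le_of_nodup hP.node.nodup
  have hpl := hP.pre.length_le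
  have hsame1 : ∀ q, L.Same (L.st + S.length) q s.mem s₁.mem := fun q =>
    hP.frame.same hN.marks hP.node.marks
  have hr28 : ∀ v, Base L (s₁.setReg 28 v) := fun v => hB1.congr fun r hr => by
    simp [show r ≠ 28 by omega]
  rcases hP.cases with hc | ⟨hc, v, rfl, hvA, hvS, ⟨u, hu, huv⟩, hne'⟩ | ⟨hc, rfl, hQk, hQ⟩
  · -- the connected set lacks one vertex only
    left
    have hval : L.st + (L.k - 1) - (L.st + S'.length) = 0 := by omega
    have hN' : Node L A S' (s₁.setReg 28 0) :=
      { hP.node with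
        base := hr28 0
        r14 := by simp [hP.node.r14] }
    have := leafC_spec hF hN' (by rwa [hP.sol]) hc
    rw [hP.sol] at this
    refine (hprep (Halts.wp_seq (c := .sub 28 10 14) (B := 1 + 100 * (L.k * L.k) *
      (Sol G L.k A S.toFinset).card) ?_)).mono ?_ fun _ h => h
    · simp only [wp, hB1.r10, hP.node.r14, hval]
      refine Halts.condFalse (by simp) (this.mono le_rfl ?_)
      rintro s' ⟨blocks, i1, i2, i3, i4, i5, i6⟩
      refine ⟨?_, i5, fun r hr h14 h16 => ?_, blocks, i1, ?_⟩
      · exact (hsame1 _).trans (i3.same (q := s.reg 15) hP.node.marks i4) (by omega) le_rfl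
      · rw [i6 r hr h16, State.setReg_reg, Function.update_of_ne (by omega),
          hP.regs r (by omega) h14]
      · rw [i2, State.setReg_out, hP.out]
    · simp only [Cmd.size]; omega
  · -- the candidate is branched on
    right
    have hval : L.st + (L.k - 1) - (L.st + S'.length) ≠ 0 := by omega
    have hvv := L.va_lt v
    have hvl := L.le_va v
    have hva0 : L.va v ≠ 0 := by omega
    have h23 : s₁.reg 23 = L.va v := hP.r23
    have hr15 : s₁.reg 15 = s.reg 15 := hP.regs 15 (by norm_num) (by norm_num)
    have hnd : (S' ++ [v]).Nodup := by
      rw [List.nodup_append]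
      exact ⟨hP.node.nodup, List.nodup_singleton _, by simp; rintro b hb rfl; exact hvS hb⟩
    have hcard : S'.length + 1 ≤ A.card := by
      have h3 : (S' ++ [v]).toFinset ⊆ A := by
        intro x hx
        rw [List.mem_toFinset, List.mem_append, List.mem_singleton] at hx
        rcases hx with hx | rfl
        · exact hP.node.alive x hx
        · exact hvA
      have h4 := Finset.card_le_card h3
      rw [List.toFinset_card_of_nodup hnd] at h4
      simpa using h4
    have hins : (Sol G L.k A (insert v S'.toFinset)).Nonempty := by
      refine Sol_insert_nonempty hP.node.conn (by rwa [hP.sol]) ?_ (List.mem_toFinset.2 hu) huv hvA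
      rw [List.toFinset_card_of_nodup hP.node.nodup]; omega
    have hnn := length_le_of_nodup hnd
    rw [List.length_append, List.length_singleton] at hnn
    refine (hprep (Halts.wp_seq (c := .sub 28 10 14) (B := 1 + (1 + branchC.size)) ?_)).mono ?_
      fun _ h => h
    · simp only [wp, hB1.r10, hP.node.r14]
      refine Halts.condTrue (by simp; omega) (Halts.condTrue (by simp [h23, hva0]) (Halts.of_wp ?_))
      simp [wp, branchC, h23, hr15, hB1.r1, hB1.r12, hP.node.r14]
      refine ⟨by omega, by omega, by omega, by omega, by omega, by omega, S', v, hP.pre, hP.sol,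
        hvA, hne', hins, hP.node.conn, hc, ⟨hB1.congr ?_, ?_, ?_, hnd, ?_, ?_, ?_, ?_, ?_⟩, ?_, ?_,
        ?_, ?_, hP.out, ?_⟩
      · intro r hr
        simp only [State.setReg_reg, State.setMem_reg]
        repeat rw [Function.update_of_ne (by omega)]
      · refine hP.node.graph.congr fun x hx _ => ?_
        simp only [State.setReg_mem, State.setMem_mem]
        repeat rw [Function.update_of_ne (by omega)]
      · simp only [State.setReg_mem, State.setMem_mem]
        exact ((hP.node.arr.update (by omega)).update (by omega)).push rfl
      · simp only [List.mem_append, List.mem_singleton]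
        rintro x (hx | rfl)
        · exact hP.node.alive x hx
        · exact hvA
      · rw [toFinset_concat]
        exact hP.node.conn.insert_of_adj (List.mem_toFinset.2 hu) huv
      · simp; omega
      · simp only [State.setReg_mem, State.setMem_mem]
        exact ((hP.node.marks.frame_update (by omega)).frame_update (by omega)).frame_update
          (by omega)
      · simp; omega
      · intro x hx
        simp only [State.setReg_mem, State.setMem_mem]
        rw [← hsame1 (s.reg 15) x hx]
        repeat rw [Function.update_of_ne (by omega)]
      · simp only [State.setReg_mem, State.setMem_mem]
        rw [Function.update_of_ne (by omega), Function.update_of_ne (by omega),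
          Function.update_self]
      · simp only [State.setReg_mem, State.setMem_mem]
        rw [Function.update_of_ne (by omega), Function.update_self]
      · simp
      · intro r hr h14 h15
        simp only [State.setReg_reg, State.setMem_reg]
        repeat rw [Function.update_of_ne (by omega)]
        exact hP.regs r hr h14
    · simp only [Cmd.size, branchC]; omega
  · -- the queue is the only solution
    left
    have hval : L.st + (L.k - 1) - (L.st + S'.length) ≠ 0 := by omega
    have h23 : s₁.reg 23 = 0 := hP.r23
    refine (hprep (Halts.wp_seq (c := .sub 28 10 14) (B := 1 + (1 + (7 * Q.length + 5))) ?_)).mono ?_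
      fun _ h => h
    · simp only [wp, hB1.r10, hP.node.r14]
      refine Halts.condTrue (by simp; omega) (Halts.condFalse (by simp [h23])
        ((uniqueC_spec hF (Q := Q) (A := A) (hr28 _) hP.node.graph hP.arrQ (by omega)
          (by simp [hP.r22])).mono le_rfl ?_))
      rintro s' ⟨i1, i2, i3, i4⟩
      refine ⟨?_, i3, fun r hr h14 h16 => ?_, [Q], ⟨by simpa using hP.nodupQ, by simp, ?_⟩, ?_⟩
      · rw [i1]; exact hsame1 _
      · rw [i4 r (by omega) h16, State.setReg_reg, Function.update_of_ne (by omega),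
          hP.regs r (by omega) h14]
      · intro T; rw [← hP.sol, hQ]; simp
      · rw [i2, State.setReg_out, hP.out]
    · simp only [Cmd.size]; omega

/-- Back from the solutions with the candidate `v`: pass to those without it. -/
lemma backC_delete (hF : Fits L cells w) {s : State} (hB : Base L s) {A : Finset (Fin n)}
    (hG : L.GraphMem A s.mem) {v : Fin n} (hv : v ∈ A) {tp c : ℕ} (h15 : s.reg 15 = tp + 2)
    (htp : L.tr ≤ tp) (htp' : tp + 2 ≤ L.tr + 2 * n) (h0 : s.mem tp = L.va v)
    (h1 : s.mem (tp + 1) = c) (hc : c ≠ 0) (hc' : c < cells) :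
    Halts cells w backC s (11 * (L.arcs A v).length + 15) (fun s' =>
      s'.mem = Function.update (L.delMem s.mem (L.arcs A v)) (tp + 1) 0 ∧ s'.reg 14 = c ∧
      s'.reg 15 = tp + 2 ∧ s'.reg 16 = 1 ∧ s'.out = s.out ∧
      ∀ r < 20, r ≠ 14 → r ≠ 15 → r ≠ 16 → s'.reg r = s.reg r) := by
  have hm := hF.mem_le; have hw := hF.word_le
  have hval : tp + 2 - L.tr ≠ 0 := by omega
  refine (Halts.wp_seq (c := .sub 28 15 9) (B := 1 + (4 + (1 +
    (1 + ((11 * (L.arcs A v).length + 3) + 4))))) ?_).mono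
    (by simp only [Cmd.size]; omega) fun _ h => h
  simp only [wp, h15, hB.r9]
  refine Halts.condTrue (by simpa using hval) ?_
  refine Halts.wp_seq (c := .sub 15 15 12 ;; .load 25 15 ;; .add 26 15 1 ;; .load 35 26) ?_
  simp [wp, h15, hB.r12, hB.r1, h0, h1]
  refine ⟨by omega, by omega, by omega, ?_⟩
  refine Halts.condTrue (by simpa using hc) ?_
  refine Halts.wp_seq (c := .add 14 35 0) ?_
  simp [wp, hB.r0]
  refine ⟨by omega, ?_⟩
  refine Halts.seq (deleteC_spec hF (A := A) (v := v) (hB.congr fun r hr => ?_) ?_ hv ?_) ?_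
  · simp [show r ≠ 14 by omega, show r ≠ 35 by omega, show r ≠ 26 by omega, show r ≠ 25 by omega,
      show r ≠ 15 by omega, show r ≠ 28 by omega]
  · exact hG
  · simp
  · rintro s₁ ⟨i1, i2, i3⟩
    refine Halts.of_wp (c := .add 26 15 1 ;; .store 26 0 ;; .add 15 15 12 ;; .const 16 1) ?_
    simp only [State.setReg_mem, State.setReg_out] at i1 i2
    simp [wp, i3, hB.r1, hB.r0, hB.r12, i1, i2]
    refine ⟨by omega, by omega, by omega, by rintro rfl; omega, ?_⟩
    intro r hr h14 h15 h16
    repeat rw [Function.update_of_ne (by omega)]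
    rw [i3 r hr]
    simp [h14, h15, show r ≠ 35 by omega, show r ≠ 26 by omega, show r ≠ 25 by omega,
      show r ≠ 28 by omega]

/-- Back from the solutions without the candidate `v`: revert its deletion. -/
lemma backC_undelete (hF : Fits L cells w) {s : State} (hB : Base L s) {A : Finset (Fin n)}
    {m : ℕ → ℕ} (hG : L.GraphMem A m) {v : Fin n} (hv : v ∈ A) {tp : ℕ} (h15 : s.reg 15 = tp + 2)
    (htp : L.tr ≤ tp) (htp' : tp + 2 ≤ L.tr + 2 * n) (h0 : s.mem tp = L.va v)
    (h1 : s.mem (tp + 1) = 0) (hm : ∀ y < L.ord, s.mem y = L.delMem m (L.arcs A v) y) :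
    Halts cells w backC s (12 * (L.arcs A v).length + 11) (fun s' =>
      (∀ y < L.ord, s'.mem y = m y) ∧ (∀ y, L.ord ≤ y → s'.mem y = s.mem y) ∧
      s'.reg 15 = tp ∧ s'.out = s.out ∧ ∀ r < 20, r ≠ 15 → s'.reg r = s.reg r) := by
  have hm1 := hF.mem_le; have hw := hF.word_le
  have hval : tp + 2 - L.tr ≠ 0 := by omega
  refine (Halts.wp_seq (c := .sub 28 15 9) (B := 1 + (4 + (1 +
    (12 * (L.arcs A v).length + 4)))) ?_).mono
    (by simp only [Cmd.size]; omega) fun _ h => h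
  simp only [wp, h15, hB.r9]
  refine Halts.condTrue (by simpa using hval) ?_
  refine Halts.wp_seq (c := .sub 15 15 12 ;; .load 25 15 ;; .add 26 15 1 ;; .load 35 26) ?_
  simp [wp, h15, hB.r12, hB.r1, h0, h1]
  refine ⟨by omega, by omega, by omega, ?_⟩
  refine Halts.condFalse (by simp) ?_
  refine Halts.mono (undeleteC_spec hF (A := A) (v := v) (hB.congr fun r hr => ?_) hG hv (by simp)
    hm) le_rfl ?_
  · simp [show r ≠ 35 by omega, show r ≠ 26 by omega, show r ≠ 25 by omega,
      show r ≠ 15 by omega, show r ≠ 28 by omega]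
  · rintro s₁ ⟨i1, i2, i3, i4⟩
    refine ⟨i1, i2, by simp [i4], i3, fun r hr h15 => ?_⟩
    rw [i4 r hr]
    simp [h15, show r ≠ 35 by omega, show r ≠ 26 by omega, show r ≠ 25 by omega,
      show r ≠ 28 by omega]

/-- A bound for the time to treat a subproblem with `f` solutions whose connected set lacks `d`
vertices. The first summand pays for the `2 * f - 1` nodes of the tree of subproblems. The second
one pays for deletions: each time the connected set grows, each solution pays for `O(k)` arcs. -/
def cost (k d f : ℕ) : ℕ := 300 * (k * k) * (2 * f - 1) + 23 * k * d * f

lemma cost_leaf {k d f : ℕ} (hk : 2 ≤ k) (hf : 0 < f) :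
    170 * (k * k) + 100 * (k * k) * f + 2 ≤ cost k d f := by
  obtain ⟨f, rfl⟩ : ∃ g, f = g + 1 := ⟨f - 1, by omega⟩
  unfold cost
  have : 2 * (f + 1) - 1 = 2 * f + 1 := by omega
  rw [this]
  have h4 : 4 ≤ k * k := Nat.mul_le_mul hk hk
  nlinarith [Nat.zero_le (k * k * f), Nat.zero_le (23 * k * d * (f + 1))]

/-- The cost of a branch: the search, the part with the candidate, its deletion with `l` unlinked
arcs, the part without it, and the reversal of the deletion. -/
lemma cost_branch {k d d' f₁ f₂ l : ℕ} (hk : 2 ≤ k) (h₁ : 0 < f₁) (h₂ : 0 < f₂) (hd : d' ≤ d)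
    (hd' : 1 ≤ d') (hl : l ≤ k + k * f₁) :
    (170 * (k * k) + 2) + (cost k (d' - 1) f₁ + ((11 * l + 17) + (cost k d' f₂ + (12 * l + 13)))) ≤
      cost k d (f₁ + f₂) := by
  obtain ⟨g₁, rfl⟩ : ∃ g, f₁ = g + 1 := ⟨f₁ - 1, by omega⟩
  obtain ⟨g₂, rfl⟩ : ∃ g, f₂ = g + 1 := ⟨f₂ - 1, by omega⟩
  obtain ⟨e, rfl⟩ : ∃ g, d' = g + 1 := ⟨d' - 1, by omega⟩
  obtain ⟨e', rfl⟩ : ∃ g, d = e + 1 + g := ⟨d - (e + 1), by omega⟩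
  unfold cost
  have e1 : 2 * (g₁ + 1) - 1 = 2 * g₁ + 1 := by omega
  have e2 : 2 * (g₂ + 1) - 1 = 2 * g₂ + 1 := by omega
  have e3 : 2 * (g₁ + 1 + (g₂ + 1)) - 1 = 2 * g₁ + 2 * g₂ + 3 := by omega
  rw [e1, e2, e3, Nat.add_sub_cancel]
  have h4 : 4 ≤ k * k := Nat.mul_le_mul hk hk
  have h5 : 2 * k ≤ k * k := Nat.mul_le_mul_right _ hk
  have h6 : 23 * k * (e + 1 + e') * (g₁ + 1 + (g₂ + 1)) =
    23 * k * e * (g₁ + 1) + 23 * (k + k * g₁) +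
    23 * k * (e + 1) * (g₂ + 1) + 23 * k * e' * (g₁ + 1 + (g₂ + 1)) := by ring
  have h7 : 300 * (k * k) * (2 * g₁ + 2 * g₂ + 3) = 300 * (k * k) * (2 * g₁ + 1) +
    300 * (k * k) * (2 * g₂ + 1) + 300 * (k * k) := by ring
  have h8 : k * (g₁ + 1) = k + k * g₁ := by ring
  rw [h6, h7]
  rw [h8] at hl
  have h9 := Nat.zero_le (23 * k * e' * (g₁ + 1 + (g₂ + 1)))
  omega

/-- The traversal treats a subproblem completely, in time linear in the number of its solutions. -/
theorem run_spec (hH : 0 < L.H) (hF : Fits L cells w) {s : State} {A : Finset (Fin n)}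
    {S : List (Fin n)} (hN : Node L A S s) (hne : (Sol G L.k A S.toFinset).Nonempty)
    (h15 : L.tr ≤ s.reg 15) (h15' : s.reg 15 + 2 * (A.card - S.length) ≤ L.tr + 2 * n)
    (h16 : s.reg 16 ≠ 0) (h17 : s.reg 17 ≠ 0) :
    Reaches cells w 17 stepC s (cost L.k (L.k - S.length) (Sol G L.k A S.toFinset).card)
      (Done L A S s) := by
  induction hf : (Sol G L.k A S.toFinset).card using Nat.strong_induction_on
    generalizing s A S with
  | _ f ih =>
    have h1 := hF.mem_le; have h2 := hF.word_le; have hk2 := hF.two_le; have hkn := hF.le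
    obtain ⟨o1, o2, o3⟩ := L.order
    have hh := L.hdr_le_ord
    have hf0 : 0 < f := hf ▸ Finset.card_pos.2 hne
    rcases forwardC_spec hH hF hN hne h15 h15' with h | h
    · rw [hf] at h
      refine (Reaches.one h17 (Halts.condTrue h16 h)).mono ?_ fun _ h => h
      have := cost_leaf (d := L.k - S.length) hk2 hf0
      omega
    · -- both branches have solutions
      set d := L.k - S.length with hd
      have key : ∀ s₁ S' v, Branch L A S S' v s s₁ → Reaches cells w 17 stepC s₁
          (cost L.k d f - (170 * (L.k * L.k) + 2)) (Done L A S s) ∧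
          170 * (L.k * L.k) + 2 ≤ cost L.k d f := by
        intro s₁ S' v hb
        have hSl := hb.pre.length_le
        have hS'nd : S'.Nodup := hb.node.nodup.of_append_left
        have hcS' : S'.toFinset.card = S'.length := List.toFinset_card_of_nodup hS'nd
        have hvS' : v ∉ S' := by
          have := hb.node.nodup
          rw [List.nodup_append] at this
          exact fun h => this.2.2 v h v (by simp) rfl
        have hcard : S'.length + 1 ≤ A.card := by
          have h3 : (S' ++ [v]).toFinset ⊆ A := fun x hx =>
            hb.node.alive x (List.mem_toFinset.1 hx)
          have h4 := Finset.card_le_card h3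
          rw [List.toFinset_card_of_nodup hb.node.nodup] at h4
          simpa using h4
        have hn' : S'.length + 1 ≤ n := hcard.trans ((Finset.card_le_univ A).trans (by simp))
        have hblen := hb.len
        set f₁ := (Sol G L.k A (insert v S'.toFinset)).card with hf1
        set f₂ := (Sol G L.k (A.erase v) S'.toFinset).card with hf2
        have hfs : f = f₁ + f₂ := by
          rw [← hf, ← hb.sol, card_Sol_insert L.k A S'.toFinset v]
        have hp1 : 0 < f₁ := Finset.card_pos.2 hb.nonempty'
        have hp2 : 0 < f₂ := Finset.card_pos.2 hb.nonempty
        have hl : (L.arcs A v).length ≤ L.k + L.k * f₁ := by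
          have hc := hb.node.conn
          rw [toFinset_concat] at hc
          refine arcs_length_le hc hb.nonempty' ?_ (Finset.mem_insert_self _ _)
          have := Finset.card_insert_le v S'.toFinset
          omega
        have hcost := cost_branch (d := d) (d' := L.k - S'.length) (l := (L.arcs A v).length) hk2
          hp1 hp2 (by omega) (by omega) hl
        rw [← hfs] at hcost
        refine ⟨?_, by omega⟩
        -- the solutions with `v`
        have r1 : Reaches cells w 17 stepC s₁ (cost L.k (L.k - S'.length - 1) f₁)
            (Done L A (S' ++ [v]) s₁) := by
          have := ih f₁ (by omega) (s := s₁) (A := A) (S := S' ++ [v]) hb.node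
            (by rw [toFinset_concat]; exact hb.nonempty') (by rw [hb.r15]; omega)
            (by rw [hb.r15, List.length_append, List.length_singleton]; omega)
            (by rwa [hb.regs 16 (by norm_num) (by norm_num) (by norm_num)])
            (by rwa [hb.regs 17 (by norm_num) (by norm_num) (by norm_num)])
            (by rw [toFinset_concat])
          rwa [List.length_append, List.length_singleton, ← Nat.sub_sub] at this
        refine (r1.trans (B' := (11 * (L.arcs A v).length + 17) +
          (cost L.k (L.k - S'.length) f₂ + (12 * (L.arcs A v).length + 13))) ?_).mono (by omega)
          fun _ h => h
        intro s₂ hD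
        obtain ⟨b₁, hL1, hO1⟩ := hD.out
        have hsm := hD.same
        rw [hb.r15, List.length_append, List.length_singleton] at hsm
        have hB2 : Base L s₂ := hb.node.base.congr fun r hr =>
          hD.regs r (by omega) (by omega) (by omega)
        have hG2 := hsm.graph (by omega) hb.node.graph
        have hr15 : s₂.reg 15 = s.reg 15 + 2 := by
          rw [hD.regs 15 (by norm_num) (by norm_num) (by norm_num), hb.r15]
        have ht0 : s₂.mem (s.reg 15) = L.va v := by rw [hsm _ (by omega), hb.tr0]
        have ht1 : s₂.mem (s.reg 15 + 1) = L.st + S'.length := by rw [hsm _ (by omega), hb.tr1]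
        have hr17 : s₂.reg 17 ≠ 0 := by
          rwa [hD.regs 17 (by norm_num) (by norm_num) (by norm_num),
            hb.regs 17 (by norm_num) (by norm_num) (by norm_num)]
        have r2 := Reaches.one hr17 (Halts.condFalse (d := backC) (c := forwardC) hD.r16
          (backC_delete hF hB2 hG2 hb.mem hr15 h15 (by omega) ht0 ht1 (by omega) (by omega)))
        refine (r2.trans (B' := cost L.k (L.k - S'.length) f₂ +
          (12 * (L.arcs A v).length + 13)) ?_).mono (by omega) fun _ h => h
        rintro s₃ ⟨i1, i2, i3, i4, i5, i6⟩
        -- the solutions without `v`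
        have hB3 : Base L s₃ := hB2.congr fun r hr =>
          i6 r (by omega) (by omega) (by omega) (by omega)
        have hdel := (delMem_spec (L := L) hb.mem hG2.lists (List.append_nil _).symm).1
        have hm3 : ∀ x, L.ord ≤ x → x ≠ s.reg 15 + 1 → s₃.mem x = s₂.mem x := by
          intro x hx hx'
          rw [i1, Function.update_of_ne hx', hdel x (noLink_of_mod (by omega))]
        have hm3' : ∀ x, x < L.ord → s₃.mem x = L.delMem s₂.mem (L.arcs A v) x := by
          intro x hx
          rw [i1, Function.update_of_ne (by omega)]
        have hN3 : Node L (A.erase v) S' s₃ := by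
          refine ⟨hB3, ?_, ?_, hS'nd, ?_, hb.conn, i2, ?_, by omega⟩
          · exact (hG2.delete hb.mem).congr fun x hx _ => hm3' x hx
          · have ha : L.Arr s₂.mem L.st S' :=
              (hsm.arr (by simp) hb.node.arr).of_prefix (List.prefix_append _ _)
            exact ha.congr fun i hi => hm3 _ (by omega) (by omega)
          · intro x hx
            rw [Finset.mem_erase]
            exact ⟨by rintro rfl; exact hvS' hx, hb.node.alive x (by simp [hx])⟩
          · intro u
            have := L.va_lt u
            rw [hm3' _ (by omega), hdel (L.va u + 2) (noLink_of_mod (Or.inl ⟨u, rfl⟩))]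
            exact (hsm.marks (by omega) hb.node.marks) u
        have r3 := ih f₂ (by omega) (s := s₃) (A := A.erase v) (S := S') hN3 hb.nonempty
          (by rw [i3]; omega) (by rw [i3, Finset.card_erase_of_mem hb.mem]; omega) (by rw [i4]; norm_num)
          (by rwa [i6 17 (by norm_num) (by norm_num) (by norm_num) (by norm_num)]) rfl
        refine (r3.trans (B' := 12 * (L.arcs A v).length + 13) ?_).mono le_rfl fun _ h => h
        intro s₄ hD'
        obtain ⟨b₂, hL2, hO2⟩ := hD'.out
        have hsm' := hD'.same
        rw [i3] at hsm'
        have hB4 : Base L s₄ := hB3.congr fun r hr =>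
          hD'.regs r (by omega) (by omega) (by omega)
        have hr15' : s₄.reg 15 = s.reg 15 + 2 := by
          rw [hD'.regs 15 (by norm_num) (by norm_num) (by norm_num), i3]
        have ht0' : s₄.mem (s.reg 15) = L.va v := by
          rw [hsm' _ (by omega), hm3 _ (by omega) (by omega), ht0]
        have ht1' : s₄.mem (s.reg 15 + 1) = 0 := by
          rw [hsm' _ (by omega), i1, Function.update_self]
        have hr17' : s₄.reg 17 ≠ 0 := by
          rwa [hD'.regs 17 (by norm_num) (by norm_num) (by norm_num),
            i6 17 (by norm_num) (by norm_num) (by norm_num) (by norm_num)]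
        refine (Reaches.one hr17' (Halts.condFalse (d := backC) (c := forwardC) hD'.r16
          (backC_undelete hF hB4 hG2 hb.mem hr15' h15 (by omega) ht0' ht1' ?_))).mono
          (by omega) ?_
        · intro y hy
          rw [hsm' y (by omega), hm3' y hy]
        · rintro s₅ ⟨j1, j2, j3, j4, j5⟩
          refine ⟨?_, ?_, ?_, b₁ ++ b₂, ?_, ?_⟩
          · intro x hx
            rw [← hb.same x hx, ← hsm x (by omega)]
            by_cases hxo : x < L.ord
            · rw [j1 x hxo]
            · rw [j2 x (by omega), hsm' x (by omega), hm3 x (by omega) (by omega)]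
          · rw [j5 16 (by norm_num) (by norm_num), hD'.r16]
          · intro r hr h14 h16
            by_cases hr15 : r = 15
            · rw [hr15, j3]
            · rw [j5 r (by omega) hr15, hD'.regs r hr h14 h16, i6 r (by omega) h14 hr15 h16,
                hD.regs r hr h14 h16, hb.regs r (by omega) h14 hr15]
          · rw [← hb.sol, Sol_insert_union L.k A S'.toFinset v]
            rw [toFinset_concat] at hL1
            exact hL1.append hL2 (Sol_insert_disjoint _ _ _ _)
          · rw [j4, hO2, i5, hO1, hb.out, blockWords_append, List.append_assoc]
      obtain ⟨t, s₁, ex, ht, S', v, hb⟩ := h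
      obtain ⟨k1, k2⟩ := key s₁ S' v hb
      refine ((Reaches.one h17 (Halts.condTrue h16 (B := 170 * (L.k * L.k)) (P := fun s' => s' = s₁)
        ⟨t, s₁, ex, ht, rfl⟩)).trans (P := fun s' => s' =
          s₁) (B' := cost L.k d f - (170 * (L.k * L.k) + 2)) ?_).mono
        (by omega)
        fun _ h => h
      rintro _ rfl
      exact k1

end GraphletEnum

namespace GraphletEnum

/-! ### The roots -/

variable {n : ℕ} {G : SimpleGraph (Fin n)} {L : Layout G} {cells w : ℕ}

open Layout

/-- The traversal ends when the trail is empty. -/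
lemma backC_nil (hF : Fits L cells w) {s : State} (hB : Base L s) (h15 : s.reg 15 = L.tr) :
    Halts cells w backC s 3 (fun s' => s'.mem = s.mem ∧ s'.out = s.out ∧ s'.reg 17 = 0 ∧
      ∀ r < 20, r ≠ 17 → s'.reg r = s.reg r) := by
  have hw := hF.word_le
  refine (Halts.wp_seq (c := .sub 28 15 9) (B := 1 + 1) ?_).mono (by simp [Cmd.size]) fun _ h => h
  simp only [wp, h15, hB.r9]
  refine Halts.condFalse (by simp) (Halts.of_wp (c := .const 17 0) ?_)
  simp only [wp]
  refine ⟨by omega, rfl, rfl, by simp, fun r hr h17 => ?_⟩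
  simp [h17, show r ≠ 28 by omega]

/-- Enumerate the graphlets whose last vertex in the order is the one in the cell before the
address in register 18, and delete that vertex. -/
def rootC : Cmd :=
  (.sub 18 18 1 ;; .load 25 18 ;; .store 7 25 ;; .add 14 7 1 ;; .add 15 9 0 ;; .const 16 1 ;;
    .const 17 1) ;;
  .loop 17 stepC ;; .load 25 18 ;; deleteC

/-- The test whether the prefix of the order that ends before the address in register 18 has at
least as many vertices as a graphlet. -/
def rootTest : Cmd := .add 24 6 3 ;; .sub 24 24 1 ;; .sub 24 18 24

/-- Enumerate all graphlets, where register 18 holds the address of the end of the order. -/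
def rootsC : Cmd := rootTest ;; .loop 24 (rootC ;; rootTest)

/-- The machine is about to treat the last vertex of the prefix `p` of the order; `F` are the
graphlets that have been output. -/
structure RootInv (L : Layout G) (p : List (Fin n)) (F : Finset (Finset (Fin n))) (s : State) :
    Prop where
  base : Base L s
  graph : L.GraphMem p.toFinset s.mem
  marks : L.Marks s.mem ∅
  arr : L.Arr s.mem L.ord p
  nodup : p.Nodup
  conn : ∀ q, q <+: p → q ≠ [] → Conn G q.toFinset
  r18 : s.reg 18 = L.ord + p.length
  out : ∃ blocks, Lists blocks F ∧ s.out = blockWords blocks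

lemma rootC_spec (hH : 0 < L.H) (hF : Fits L cells w) {s : State} {p : List (Fin n)} {v : Fin n}
    {F : Finset (Finset (Fin n))} (h : RootInv L (p ++ [v]) F s) (hk : L.k ≤ p.length + 1)
    (hd : Disjoint F (Sol G L.k (p ++ [v]).toFinset {v})) :
    0 < (Sol G L.k (p ++ [v]).toFinset {v}).card ∧
    Halts cells w rootC s (690 * (L.k * L.k) * (Sol G L.k (p ++ [v]).toFinset {v}).card)
      (RootInv L p (F ∪ Sol G L.k (p ++ [v]).toFinset {v})) := by
  have h1 := hF.mem_le; have h2 := hF.word_le; have hk2 := hF.two_le; have hkn := hF.le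
  obtain ⟨o1, o2, o3⟩ := L.order
  have hh := L.hdr_le_ord
  set A := (p ++ [v]).toFinset with hA
  set f := (Sol G L.k A {v}).card with hf
  have hB := h.base
  have hlen := length_le_of_nodup h.nodup
  have hlA : A.card = p.length + 1 := by
    rw [hA, List.toFinset_card_of_nodup h.nodup]; simp
  rw [List.length_append, List.length_singleton] at hlen
  have hvA : v ∈ A := by rw [hA]; simp
  have hvp : v ∉ p := by
    have := h.nodup
    rw [List.nodup_append] at this
    exact fun h => this.2.2 v h v (by simp) rfl
  have hne : (Sol G L.k A {v}).Nonempty :=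
    Sol_nonempty_of_subset (conn_singleton v) (h.conn _ List.prefix_rfl (by simp))
      (Finset.singleton_subset_iff.2 hvA) subset_rfl (by simp; omega) (hk.trans hlA.ge)
  have hf0 : 0 < f := Finset.card_pos.2 hne
  have harc : (L.arcs A v).length ≤ L.k + L.k * f :=
    arcs_length_le (conn_singleton v) hne (by simp; omega) (Finset.mem_singleton_self v)
  refine ⟨hf0, ?_⟩
  refine (Halts.wp_seq (c := .sub 18 18 1 ;; .load 25 18 ;; .store 7 25 ;; .add 14 7 1 ;;
    .add 15 9 0 ;; .const 16 1 ;; .const 17 1) (B := ((cost L.k (L.k - 1) f + (3 + 1 + 1)) + 1) +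
      (1 + (11 * (L.arcs A v).length + 3))) ?_).mono ?_ fun _ h => h
  swap
  · -- the deletion takes at most `22 * k * f` steps, by the bound on the number of arcs
    have e1 : L.k * f ≤ L.k * L.k * f := by
      rw [mul_assoc]; exact Nat.mul_le_mul_left _ (Nat.le_mul_of_pos_left _ (by omega))
    have e2 : L.k ≤ L.k * f := Nat.le_mul_of_pos_right _ hf0
    have e3 : cost L.k (L.k - 1) f ≤ 623 * (L.k * L.k * f) := by
      unfold cost
      have e4 : 300 * (L.k * L.k) * (2 * f - 1) ≤ 300 * (L.k * L.k) * (2 * f) :=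
        Nat.mul_le_mul_left _ (by omega)
      have e5 : 23 * L.k * (L.k - 1) * f ≤ 23 * L.k * L.k * f :=
        Nat.mul_le_mul_right _ (Nat.mul_le_mul_left _ (by omega))
      calc _ ≤ 300 * (L.k * L.k) * (2 * f) + 23 * L.k * L.k * f := Nat.add_le_add e4 e5
        _ = _ := by ring
    have e6 : 4 ≤ L.k * L.k * f := by
      have : 2 * 2 ≤ L.k * L.k := Nat.mul_le_mul hk2 hk2
      nlinarith
    have e7 : 2 * (L.k * f) ≤ L.k * L.k * f := by
      rw [mul_assoc]; exact Nat.mul_le_mul_right _ hk2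
    have e8 : 690 * (L.k * L.k) * f = 690 * (L.k * L.k * f) := by ring
    simp only [Cmd.size]
    omega
  have hx : s.mem (L.ord + p.length) = L.va v := by
    have := h.arr p.length (by simp)
    simpa using this
  have hvl := L.va_lt v
  have h18 : s.reg 18 - 1 = L.ord + p.length := by rw [h.r18]; simp
  simp [wp, h18, hB.r1, hB.r7, hB.r0, hB.r9, hx]
  refine ⟨by omega, by omega, by omega, by omega, by rintro rfl; omega, ?_⟩
  refine Halts.seq (P := fun s' => L.Same (L.st + 1) L.tr (Function.update s.mem L.st (L.va v)) s'.mem ∧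
      (∀ r < 14, s'.reg r = s.reg r) ∧ s'.reg 18 = L.ord + p.length ∧ s'.reg 17 = 0 ∧
      ∃ blocks, Lists blocks (Sol G L.k A {v}) ∧ s'.out = s.out ++ blockWords blocks) ?_ ?_
  · refine Reaches.halts (Reaches.trans (run_spec hH hF (A := A) (S := [v])
      (s := _) ⟨hB.congr fun r hr => ?_, ?_, ?_, by simp, ?_, ?_, ?_, ?_, ?_⟩ ?_ ?_ ?_ ?_ ?_)
      (B' := 3 + 1 + 1) fun s₁ hD => ?_) fun s' hs' => hs'.2.2.2.1
    · simp [show r ≠ 17 by omega, show r ≠ 16 by omega, show r ≠ 15 by omega, show r ≠ 14 by omega,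
        show r ≠ 25 by omega, show r ≠ 18 by omega]
    · refine h.graph.congr fun x hx _ => ?_
      simp only [State.setReg_mem, State.setMem_mem]
      rw [Function.update_of_ne (by omega)]
    · intro i hi
      simp at hi; subst hi
      simp
    · simp [hvA]
    · simpa using conn_singleton v
    · simp
    · exact h.marks.frame_update (by omega)
    · simp; omega
    · simpa using hne
    · simp
    · simp [hlA]; omega
    · simp
    · simp
    · have hbl : ∀ r < 14, s₁.reg r = s.reg r := by
        intro r hr
        rw [hD.regs r (by omega) (by omega) (by omega)]
        simp [show r ≠ 17 by omega, show r ≠ 16 by omega, show r ≠ 15 by omega,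
          show r ≠ 14 by omega, show r ≠ 25 by omega, show r ≠ 18 by omega]
      have h15 : s₁.reg 15 = L.tr := by
        rw [hD.regs 15 (by norm_num) (by norm_num) (by norm_num)]; simp
      have h17 : s₁.reg 17 ≠ 0 := by
        rw [hD.regs 17 (by norm_num) (by norm_num) (by norm_num)]; simp
      refine Reaches.one h17 (Halts.condFalse (d := backC) (c := forwardC) hD.r16
        ((backC_nil hF (hB.congr hbl) h15).mono le_rfl ?_))
      rintro s₂ ⟨i1, i2, i3, i4⟩
      refine ⟨?_, fun r hr => ?_, ?_, i3, ?_⟩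
      · rw [i1]; have := hD.same; simpa using this
      · rw [i4 r (by omega) (by omega), hbl r hr]
      · rw [i4 18 (by norm_num) (by norm_num), hD.regs 18 (by norm_num) (by norm_num) (by norm_num)]
        simp
      · obtain ⟨b, hb, ho⟩ := hD.out
        refine ⟨b, by simpa using hb, ?_⟩
        rw [i2, ho]; simp
  · rintro s₁ ⟨i1, i2, i3, i4, b, hb, ho⟩
    have hlow : ∀ x < L.st, s₁.mem x = s.mem x := by
      intro x hx
      rw [i1 x (by omega), Function.update_of_ne (by omega)]
    have hG1 : L.GraphMem A s₁.mem := h.graph.congr fun x hx _ => hlow x (by omega)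
    have hB1 : Base L s₁ := hB.congr i2
    refine Halts.wp_seq (c := .load 25 18) ?_
    have hx1 := hlow (L.ord + p.length) (by omega)
    simp only [wp, i3, hx1, hx]
    refine ⟨by omega, ?_⟩
    refine Halts.mono (deleteC_spec hF (A := A) (v := v) (hB1.congr fun r hr => ?_) ?_ hvA ?_)
      le_rfl ?_
    · simp [show r ≠ 25 by omega]
    · exact hG1
    · simp
    · rintro s₂ ⟨j1, j2, j3⟩
      have hreg : ∀ r < 20, s₂.reg r = s₁.reg r := fun r hr => by
        rw [j3 r hr]; simp [show r ≠ 25 by omega]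
      rw [State.setReg_mem] at j1
      have hdel := (delMem_spec (L := L) hvA hG1.lists (List.append_nil _).symm).1
      have hAe : A.erase v = p.toFinset := by
        rw [hA, toFinset_concat, Finset.erase_insert (by simpa using hvp)]
      refine ⟨hB1.congr fun r hr => hreg r (by omega), ?_, ?_, ?_, ?_, ?_, ?_, ?_⟩
      · rw [← hAe, j1]; exact hG1.delete hvA
      · intro u
        have := L.va_lt u
        rw [j1, hdel (L.va u + 2) (noLink_of_mod (Or.inl ⟨u, rfl⟩)), hlow _ (by omega), h.marks u]
      · refine (h.arr.of_prefix (List.prefix_append _ _)).congr fun i hi => ?_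
        rw [j1, hdel _ (noLink_of_mod (by omega)), hlow _ (by omega)]
      · exact h.nodup.of_append_left
      · exact fun q hq => h.conn q (hq.trans (List.prefix_append _ _))
      · rw [hreg 18 (by norm_num), i3]
      · obtain ⟨b', hb', ho'⟩ := h.out
        exact ⟨b' ++ b, hb'.append hb hd, by rw [j2, State.setReg_out, ho, ho', blockWords_append]⟩

lemma rootTest_wp (hF : Fits L cells w) {s : State} {p : List (Fin n)}
    {F : Finset (Finset (Fin n))} (h : RootInv L p F s) {Q : State → Prop}
    (hQ : ∀ s', RootInv L p F s' → s'.reg 24 = p.length + 1 - L.k → Q s') :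
    wp cells w rootTest Q s := by
  have h1 := hF.mem_le; have h2 := hF.word_le; have hk2 := hF.two_le; have hkn := hF.le
  obtain ⟨o1, o2, o3⟩ := L.order
  have hB := h.base
  simp [wp, rootTest, hB.r6, hB.r3, hB.r1, h.r18]
  refine ⟨by omega, hQ _ ⟨hB.congr fun r hr => ?_, h.graph, h.marks, h.arr, h.nodup, h.conn, ?_,
    h.out⟩
    ?_⟩
  · simp [show r ≠ 24 by omega]
  · simp [h.r18]
  · simp; omega

lemma rootsC_spec (hH : 0 < L.H) (hF : Fits L cells w) {s : State} {p : List (Fin n)}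
    (h : RootInv L p ∅ s) :
    Halts cells w rootsC s (700 * (L.k * L.k) * (Sol G L.k p.toFinset ∅).card + 4) (fun s' =>
      ∃ blocks, Lists blocks (Sol G L.k p.toFinset ∅) ∧ s'.out = blockWords blocks) := by
  have hk2 := hF.two_le
  refine (Halts.wp_seq (c := rootTest) (B := 700 * (L.k * L.k) * (Sol G L.k p.toFinset ∅).card + 1)
    ?_).mono (by simp [Cmd.size, rootTest]; omega) fun _ h => h
  refine rootTest_wp hF h fun s₁ hI₁ h24 => ?_
  refine (Halts.loop (T₀ := 0) (B := 700 * (L.k * L.k) * (Sol G L.k p.toFinset ∅).card)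
    (fun T s' => ∃ q F, RootInv L q F s' ∧ s'.reg 24 = q.length + 1 - L.k ∧
      Disjoint F (Sol G L.k q.toFinset ∅) ∧
      F ∪ Sol G L.k q.toFinset ∅ = Sol G L.k p.toFinset ∅ ∧
      T ≤ 700 * (L.k * L.k) * F.card) ?_ ?_ ?_).mono le_rfl ?_
  · exact ⟨p, ∅, hI₁, h24, by simp, by simp, by simp⟩
  · rintro T s' ⟨q, F, -, -, -, hu, hT⟩
    rw [Nat.zero_add]
    exact hT.trans (Nat.mul_le_mul_left _ (Finset.card_le_card (hu ▸ Finset.subset_union_left)))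
  · rintro T s' ⟨q, F, hI, h24, hd, hu, hT⟩ h0
    cases q using List.reverseRecOn with
    | nil => simp at h24; omega
    | append_singleton q v =>
      rw [List.length_append, List.length_singleton] at h24
      have hvq : v ∉ q := by
        have := hI.nodup
        rw [List.nodup_append] at this
        exact fun h => this.2.2 v h v (by simp) rfl
      have hsplit := Sol_insert_union (G := G) L.k (q ++ [v]).toFinset ∅ v
      have hdis := Sol_insert_disjoint (G := G) L.k (q ++ [v]).toFinset ∅ v
      have hAe : (q ++ [v]).toFinset.erase v = q.toFinset := by
        rw [toFinset_concat, Finset.erase_insert (by simpa using hvq)]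
      rw [hAe, insert_empty_eq] at hsplit hdis
      rw [hsplit, Finset.disjoint_union_right] at hd
      obtain ⟨hf0, hr⟩ := rootC_spec hH hF hI (by omega) hd.1
      refine ⟨_, hr.seq (B' := 3) fun s₂ hI₂ => (Halts.of_wp (rootTest_wp hF hI₂
        fun s₃ hI₃ h24' => ⟨q, _, hI₃, h24', ?_, ?_, ?_⟩)).mono (by simp [Cmd.size, rootTest])
        fun _ h => h⟩
      · rw [Finset.disjoint_union_left]; exact ⟨hd.2, hdis⟩
      · rw [Finset.union_assoc, ← hsplit, hu]
      · rw [Finset.card_union_of_disjoint hd.1]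
        have h4 : 4 ≤ L.k * L.k := Nat.mul_le_mul hk2 hk2
        have h5 : L.k * L.k ≤ L.k * L.k * (Sol G L.k (q ++ [v]).toFinset {v}).card :=
          Nat.le_mul_of_pos_right _ hf0
        rw [mul_assoc 690, mul_add, mul_assoc 700 _ (Finset.card (Sol _ _ _ {v}))]
        omega
  · rintro s' ⟨h0, T, q, F, hI, h24, hd, hu, hT⟩
    have hemp : Sol G L.k q.toFinset ∅ = ∅ := by
      refine Finset.eq_empty_of_forall_notMem fun T hT => ?_
      obtain ⟨t1, -, t3, -⟩ := mem_Sol.1 hT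
      have := Finset.card_le_card t1
      rw [List.toFinset_card_of_nodup hI.nodup] at this
      omega
    rw [hemp, Finset.union_empty] at hu
    rw [← hu]
    exact hI.out

end GraphletEnum

namespace GraphletEnum

/-! ### The order of the vertices -/

variable {n : ℕ} {G : SimpleGraph (Fin n)} {L : Layout G} {cells w : ℕ}

open Layout

/-- In a connected graph a nonempty vertex set that is closed under adjacency is everything. -/
lemma eq_univ_of_closed (hG : G.Connected) {R : Finset (Fin n)} (hne : R.Nonempty)
    (hcl : ∀ u ∈ R, ∀ x, G.Adj u x → x ∈ R) : R = Finset.univ := by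
  refine Finset.eq_univ_of_forall fun y => ?_
  obtain ⟨x, hx⟩ := hne
  obtain ⟨p⟩ := hG.preconnected x y
  induction p with
  | nil => exact hx
  | cons hadj _ ih => exact ih (hcl _ hx _ hadj)

lemma sum_arcs_le {P : List (Fin n)} (hP : P.Nodup) (A : Finset (Fin n)) :
    (P.map fun u => (L.arcs A u).length + 1).sum ≤ n + L.M := by
  have h1 : (P.map fun u => (L.arcs A u).length + 1).sum =
      ∑ u ∈ P.toFinset, ((L.arcs A u).length + 1) := (List.sum_toFinset _ hP).symm
  have h2 : ∀ u, (L.arcs A u).length ≤ ((Finset.range L.M).filter fun a => L.src a = u).card := by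
    intro u
    rw [← List.toFinset_card_of_nodup (L.arcs_nodup A u)]
    refine Finset.card_le_card fun a ha => ?_
    rw [List.mem_toFinset, L.mem_arcs] at ha
    simp [ha.1, ha.2.1]
  have h3 : L.M = ∑ u : Fin n, ((Finset.range L.M).filter fun a => L.src a = u).card := by
    have := Finset.card_eq_sum_card_fiberwise (s := Finset.range L.M) (t := Finset.univ)
      (f := L.src) (fun _ _ => by simp)
    rwa [Finset.card_range] at this
  calc _ ≤ ∑ u : Fin n, ((L.arcs A u).length + 1) := by
        rw [h1]; exact Finset.sum_le_sum_of_subset (Finset.subset_univ _)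
    _ ≤ ∑ u : Fin n, (((Finset.range L.M).filter fun a => L.src a = u).card + 1) :=
        Finset.sum_le_sum fun u _ => Nat.add_le_add_right (h2 u) 1
    _ = n + L.M := by
        rw [Finset.sum_add_distrib, ← h3]; simp [add_comm]

/-- Copy the queue to the array that holds the order of the vertices. -/
def saveC : Cmd :=
  (.add 30 8 0 ;; .add 31 6 0 ;; .sub 24 22 30) ;; .loop 24
    (.load 27 30 ;; .store 31 27 ;; .add 30 30 1 ;; .add 31 31 1 ;; .sub 24 22 30)

lemma saveC_spec (hF : Fits L cells w) {s : State} (hB : Base L s) {Q : List (Fin n)}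
    (hQ : L.Arr s.mem L.qb Q) (hn : Q.length ≤ n) (h22 : s.reg 22 = L.qb + Q.length) :
    Halts cells w saveC s (6 * Q.length + 4) (fun s' =>
      L.Arr s'.mem L.ord Q ∧ (∀ x, x < L.ord ∨ L.st ≤ x → s'.mem x = s.mem x) ∧
      s'.out = s.out ∧ (∀ r < 24, s'.reg r = s.reg r)) := by
  have h1 := hF.mem_le; have h2 := hF.word_le
  obtain ⟨o1, o2, o3⟩ := L.order
  have hh := L.hdr_le_ord
  refine (Halts.wp_seq (B := 6 * Q.length + 1) (P := fun s' =>
      L.Arr s'.mem L.ord Q ∧ (∀ x, x < L.ord ∨ L.st ≤ x → s'.mem x = s.mem x) ∧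
      s'.out = s.out ∧ (∀ r < 24, s'.reg r = s.reg r))
      ?_).mono (by simp only [Cmd.size]; omega) (fun _ h => h)
  simp [wp, hB.r0, hB.r8, hB.r6, h22]
  refine ⟨by omega, by omega, ?_⟩
  refine (Halts.loop (T₀ := 0) (B := 6 * Q.length)
    (fun T s' => ∃ p q, Q = p ++ q ∧ T = 6 * p.length ∧ L.Arr s'.mem L.ord p ∧
      (∀ x, x < L.ord ∨ L.st ≤ x → s'.mem x = s.mem x) ∧
      s'.reg 30 = L.qb + p.length ∧ s'.reg 31 = L.ord + p.length ∧ s'.reg 24 = q.length ∧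
      s'.out = s.out ∧ ∀ r < 24, s'.reg r = s.reg r) ?_ ?_ ?_).mono le_rfl ?_
  · refine ⟨[], Q, rfl, rfl, Arr.nil _ _, fun _ _ => rfl, by simp, by simp, by simp,
      rfl, fun r hr => ?_⟩
    simp [show r ≠ 24 by omega, show r ≠ 30 by omega, show r ≠ 31 by omega]
  · rintro T s' ⟨p, q, rfl, rfl, -⟩
    simp
  · rintro T s' ⟨p, q, hpq, rfl, i1, i2, i5, i5', i6, i7, i8⟩ h7
    have hB' : Base L s' := hB.congr fun r hr => i8 r (by omega)
    cases q with
    | nil => simp at i6; omega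
    | cons x q =>
      have hlen := congrArg List.length hpq
      simp only [List.length_append, List.length_cons] at hlen
      have hx : s'.mem (L.qb + p.length) = L.va x := by
        rw [i2 _ (by omega), hQ p.length (by omega)]
        simp [hpq]
      have hxlt := L.va_lt x
      refine ⟨_, Halts.of_wp ?_⟩
      simp [wp, i5, i5', hx, hB'.r1, i8 22]
      refine ⟨by omega, by omega, by omega, by omega, p ++ [x], q,
        by simpa using hpq, ?_, i1.push rfl, fun y hy => ?_, ?_, ?_, ?_, i7, ?_⟩
      · simp [Cmd.size]; ring
      · rw [Function.update_of_ne (by omega), i2 y hy]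
      · simp; omega
      · simp; omega
      · rw [h22]; omega
      · intro r hr
        repeat rw [Function.update_of_ne (by omega)]
        exact i8 r hr
  · rintro s' ⟨h0, T, p, q, hpq, rfl, i1, i2, i5, i5', i6, i7, i8⟩
    rw [h0] at i6
    obtain rfl := List.length_eq_zero_iff.1 i6.symm
    rw [List.append_nil] at hpq
    subst hpq
    exact ⟨i1, i2, i7, i8⟩

/-- Order the vertices by a search from the vertex `0`. -/
def orderC : Cmd :=
  (.store 8 4 ;; .add 26 4 12 ;; .store 26 1 ;; .add 22 8 1) ;; scanC 22 ;; saveC ;; clearC ;;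
    .add 18 6 2

lemma orderC_spec (hG : G.Connected) (hF : Fits L cells w) {s : State} (hB : Base L s)
    (hm : L.GraphMem Finset.univ s.mem) (hM : L.Marks s.mem ∅) (ho : s.out = []) :
    Halts cells w orderC s (19 * (n + L.M) + 12 * n + 18) (fun s' =>
      ∃ p : List (Fin n), p.toFinset = Finset.univ ∧ RootInv L p ∅ s') := by
  have h1 := hF.mem_le; have h2 := hF.word_le
  obtain ⟨o1, o2, o3⟩ := L.order
  have hh := L.hdr_le_ord
  have hn : 0 < n := by have := hF.two_le; have := hF.le; omega
  set z : Fin n := ⟨0, hn⟩ with hz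
  have hz' : L.va z = L.H := by simp [va, hz]
  refine (Halts.wp_seq (c := .store 8 4 ;; .add 26 4 12 ;; .store 26 1 ;; .add 22 8 1)
    (B := (19 * (n + L.M) + 6) + ((6 * n + 4) + ((6 * n + 3) + 1))) ?_).mono
    (by simp only [Cmd.size]; omega) fun _ h => h
  simp [wp, hB.r8, hB.r4, hB.r12, hB.r1]
  refine ⟨by omega, by omega, by omega, by omega, ?_⟩
  refine Halts.seq (scanC_spec hF (A := Finset.univ) (S := [z]) (lim := 22)
    (hB.congr fun r hr => ?_) ?_ ?_ (by simp) (by simp) (by simpa using conn_singleton z) ?_ ?_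
    (Or.inl rfl) ?_ (fun P hP _ => sum_arcs_le hP _)) ?_
  · simp [show r ≠ 22 by omega, show r ≠ 26 by omega]
  · refine hm.congr fun x hx hu => ?_
    simp only [State.setReg_mem, State.setMem_mem]
    have := hu z
    rw [hz'] at this
    rw [Function.update_of_ne this, Function.update_of_ne (by omega)]
  · intro i hi
    simp at hi; subst hi
    simp [hz']
    rw [Function.update_of_ne (by omega)]; simp
  · have := (hM.frame_update (x := L.qb) (v := L.H) (by omega)).insert z
    simpa [hz'] using this
  · simp
  · simp
  rintro s₁ ⟨Q, P, hI, -, hPQ⟩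
  obtain rfl := hPQ rfl
  have hQn := length_le_of_nodup hI.nodup
  have hB1 : Base L s₁ := hB.congr fun r hr => by
    rw [hI.regs r (by omega)]; simp [show r ≠ 22 by omega, show r ≠ 26 by omega]
  have hQu : P.toFinset = Finset.univ := by
    refine eq_univ_of_closed hG ⟨z, ?_⟩ fun u hu x hux => ?_
    · exact List.mem_toFinset.2 (hI.pre.subset (by simp))
    · have := hI.closed u (List.mem_toFinset.1 hu) x (by simp) hux
      simpa using this
  refine Halts.seq ((saveC_spec hF hB1 hI.arr hQn hI.r22).mono (B' := 6 * n + 4) (by omega)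
    fun _ h => h) ?_
  rintro s₂ ⟨i1, i2, i3, i4⟩
  have hB2 : Base L s₂ := hB1.congr fun r hr => i4 r (by omega)
  refine Halts.seq ((clearC_spec hF hB2 (Q := P) (D := P.toFinset)
    (hI.arr.congr fun i hi => i2 _ (by omega)) hQn (by rw [i4 22 (by norm_num), hI.r22])
    (fun u => ?_)).mono (B' := 6 * n + 3) (by omega) fun _ h => h) ?_
  · have := L.va_lt u
    rw [i2 _ (by omega), hI.marks u]
  rintro s₃ ⟨j1, j2, j3, j4, j5⟩
  have hB3 : Base L s₃ := hB2.congr fun r hr => j5 r (by omega)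
  refine Halts.of_wp (c := .add 18 6 2) ?_
  have hout : s₃.out = [] := by
    rw [j4, i3, hI.out]; simpa using ho
  simp [wp, hB3.r6, hB3.r2]
  have hPn : P.length = n := by
    rw [← List.toFinset_card_of_nodup hI.nodup, hQu]; simp
  refine ⟨by omega, P, hQu, hB3.congr fun r hr => ?_, ?_, ?_, ?_, hI.nodup, fun q hq hq0 => ?_, ?_,
    [], ⟨by simp, by simp, by simp⟩, by simp [hout, blockWords]⟩
  · simp [show r ≠ 18 by omega]
  · rw [hQu]
    refine GraphMem.congr hm fun x hx hu => ?_
    rw [State.setReg_mem, j3 x (by omega) hu, i2 x (by omega), hI.frame x (by omega) hu]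
    simp only [State.setReg_mem, State.setMem_mem]
    have := hu z
    rw [hz'] at this
    rw [Function.update_of_ne this, Function.update_of_ne (by omega)]
  · simpa using j2
  · exact i1.frame j3 (by omega) (by omega)
  · exact hI.conn q hq (Nat.succ_le_of_lt (List.length_pos_iff.2 hq0))
  · simp [hPn]

end GraphletEnum

namespace GraphletEnum

/-! ### Insertion of arcs -/

variable {n : ℕ} {G : SimpleGraph (Fin n)} {L : Layout G} {cells w : ℕ}

open Layout

namespace Layout

/-- The first `j` arcs that start from `u`, in the order of their list. -/
def firstArcs (L : Layout G) (j : ℕ) (u : Fin n) : List ℕ :=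
  (List.range j).reverse.filter fun a => L.src a = u

/-- The memory represents the graph that is formed by the first `j` arcs. -/
structure PartMem (L : Layout G) (j : ℕ) (m : ℕ → ℕ) : Prop where
  label : ∀ u, m (L.va u + 3) = u
  marks : L.Marks m ∅
  target : ∀ a < j, m (L.na a + 2) = L.va (L.tgt a)
  twin : ∀ a < j, m (L.na a + 3) = L.na (L.mate a)
  lists : ∀ u, L.ArcList m u (L.firstArcs j u)

lemma PartMem.graph {m : ℕ → ℕ} (h : L.PartMem L.M m) : L.GraphMem Finset.univ m := by
  refine ⟨h.label, h.target, h.twin, fun u _ => ?_⟩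
  have : L.arcs Finset.univ u = L.firstArcs L.M u := by simp [arcs, firstArcs]
  rw [this]; exact h.lists u

/-- Write the record of the arc at address `b` from the vertex with address `x` to the one with
address `y`, with mate at address `c`, and insert it at the head of the list of `x`. -/
def addArc (m : ℕ → ℕ) (x b y c : ℕ) : ℕ → ℕ :=
  Function.update (Function.update (insertHead m x b) (b + 2) y) (b + 3) c

lemma mem_firstArcs {j a : ℕ} {u : Fin n} : a ∈ L.firstArcs j u ↔ a < j ∧ L.src a = u := by
  simp [firstArcs]

/-- Arcs are inserted at the head of the lists, in the order of their numbers. -/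
lemma firstArcs_succ (L : Layout G) (j : ℕ) (u : Fin n) :
    L.firstArcs (j + 1) u = if L.src j = u then j :: L.firstArcs j u else L.firstArcs j u := by
  simp only [firstArcs, List.range_succ, List.reverse_append, List.reverse_singleton,
    List.singleton_append, List.filter_cons, decide_eq_true_eq]

lemma PartMem.addArc {m : ℕ → ℕ} {j : ℕ} (h : L.PartMem j m) :
    L.PartMem (j + 1) (addArc m (L.va (L.src j)) (L.na j) (L.va (L.tgt j)) (L.na (L.mate j))) ∧
      ∀ y < L.H, addArc m (L.va (L.src j)) (L.na j) (L.va (L.tgt j)) (L.na (L.mate j)) y = m y := by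
  set x := L.va (L.src j) with hx
  have hxl := L.le_va (L.src j)
  have hxu := L.va_lt (L.src j)
  have hb := L.le_na j
  -- the old head of the list is the record of a vertex or of one of the first `j` arcs
  have hfirst : m x = x ∨ ∃ a < j, L.src a = L.src j ∧ m x = L.na a := by
    have := (h.lists (L.src j)).first
    rw [← hx] at this
    cases hl : L.firstArcs j (L.src j) with
    | nil => left; rw [this, hl]; rfl
    | cons a l =>
      right
      have ha := mem_firstArcs.1 (hl ▸ List.mem_cons_self : a ∈ L.firstArcs j (L.src j))
      exact ⟨a, ha.1, ha.2, by rw [this, hl]; rfl⟩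
  -- the cells that change
  have hsame : ∀ y, y ≠ x → y ≠ m x + 1 → (y < L.na j ∨ L.na j + 4 ≤ y) →
      Layout.addArc m x (L.na j) (L.va (L.tgt j)) (L.na (L.mate j)) y = m y := by
    intro y h1 h2 h3
    unfold Layout.addArc insertHead
    rw [Function.update_of_ne (by omega), Function.update_of_ne (by omega),
      Function.update_of_ne h1, Function.update_of_ne h2, Function.update_of_ne (by omega),
      Function.update_of_ne (by omega)]
  have hrec : ∀ a < j, ∀ i, 2 ≤ i → i < 4 →
      Layout.addArc m x (L.na j) (L.va (L.tgt j)) (L.na (L.mate j)) (L.na a + i) =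
        m (L.na a + i) := by
    intro a ha i hi hi'
    have hxv : x = L.H + 4 * (L.src j : ℕ) := rfl
    have hmx : ∃ q, m x = L.H + 4 * q := by
      rcases hfirst with h1 | ⟨a', -, -, h1⟩
      · exact ⟨_, h1.trans hxv⟩
      · exact ⟨n + a', by rw [h1, na]; ring⟩
    obtain ⟨q, hq⟩ := hmx
    refine hsame _ ?_ ?_ ?_ <;> simp only [na] at * <;> omega
  have hvrec : ∀ u : Fin n, ∀ i, 2 ≤ i → i < 4 →
      Layout.addArc m x (L.na j) (L.va (L.tgt j)) (L.na (L.mate j)) (L.va u + i) =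
        m (L.va u + i) := by
    intro u i hi hi'
    have hxv : x = L.H + 4 * (L.src j : ℕ) := rfl
    have hul := L.va_lt u
    have hmx : ∃ q, m x = L.H + 4 * q := by
      rcases hfirst with h1 | ⟨a', -, -, h1⟩
      · exact ⟨_, h1.trans hxv⟩
      · exact ⟨n + a', by rw [h1, na]; ring⟩
    obtain ⟨q, hq⟩ := hmx
    refine hsame _ ?_ ?_ (by omega) <;> simp only [va] at * <;> omega
  refine ⟨⟨fun u => ?_, fun u => ?_, fun a ha => ?_, fun a ha => ?_, fun u => ?_⟩, fun y hy => ?_⟩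
  · rw [hvrec u 3 (by norm_num) (by norm_num), h.label u]
  · rw [hvrec u 2 (by norm_num) (by norm_num), h.marks u]
  · rcases Nat.lt_succ_iff_lt_or_eq.1 ha with ha | rfl
    · rw [hrec a ha 2 (by norm_num) (by norm_num), h.target a ha]
    · unfold Layout.addArc
      rw [Function.update_of_ne (by omega), Function.update_self]
  · rcases Nat.lt_succ_iff_lt_or_eq.1 ha with ha | rfl
    · rw [hrec a ha 3 (by norm_num) (by norm_num), h.twin a ha]
    · unfold Layout.addArc
      rw [Function.update_self]
  · rw [firstArcs_succ]
    split_ifs with hu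
    · subst hu
      have hnd : (j :: L.firstArcs j (L.src j)).Nodup := by
        refine List.nodup_cons.2 ⟨fun hm => ?_, (List.nodup_reverse.2 List.nodup_range).filter _⟩
        have := (mem_firstArcs.1 hm).1
        omega
      have hnd' : (L.na j :: x :: (L.firstArcs j (L.src j)).map L.na).Nodup := by
        have := nodes_nodup (L := L) (u := L.src j) hnd
        rw [List.map_cons] at this
        exact (List.Perm.swap _ _ _).nodup_iff.1 this
      have hal : Aligned L.H (L.na j :: x :: (L.firstArcs j (L.src j)).map L.na) := by
        have := nodes_aligned (L := L) (L.src j) (j :: L.firstArcs j (L.src j))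
        rw [List.map_cons] at this
        intro y hy
        exact this y (by simp only [List.mem_cons] at hy ⊢; tauto)
      have hd := Dll.insertHead (h.lists (L.src j)) hnd' hal
      have hne : ∀ y, (∃ q, y = L.H + 4 * q) →
          Layout.addArc m x (L.na j) (L.va (L.tgt j)) (L.na (L.mate j)) y =
            insertHead m x (L.na j) y ∧
          Layout.addArc m x (L.na j) (L.va (L.tgt j)) (L.na (L.mate j)) (y + 1) =
            insertHead m x (L.na j) (y + 1) := by
        rintro y ⟨q, rfl⟩
        unfold Layout.addArc
        constructor
        · rw [Function.update_of_ne (by simp only [na]; omega),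
            Function.update_of_ne (by simp only [na]; omega)]
        · rw [Function.update_of_ne (by simp only [na]; omega),
            Function.update_of_ne (by simp only [na]; omega)]
      refine Dll.congr hd (fun y hy => (hne y ?_).1) (fun y hy => (hne y ?_).2)
      all_goals
        refine hal y ?_
        simp only [List.map_cons, List.mem_cons] at hy ⊢
        tauto
    · refine (h.lists u).congr ?_ fun a ha => ?_
      · have hul := L.va_lt u
        have huv : (u : ℕ) ≠ (L.src j : ℕ) := fun e => hu (Fin.ext e).symm
        have h1 : L.va u ≠ m x ∧ L.va u ≠ x ∧ L.va u ≠ m x + 1 ∧ L.va u + 1 ≠ x := by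
          rcases hfirst with h1 | ⟨a', -, -, h1⟩
          · rw [h1]; simp only [hx, va]; omega
          · rw [h1]; simp only [hx, va, na]; omega
        exact ⟨hsame _ h1.2.1 h1.2.2.1 (by omega), hsame _ h1.2.2.2 (by omega) (by omega)⟩
      · have ha := mem_firstArcs.1 ha
        have hlt : L.na a + 4 ≤ L.na j := by simp only [na]; omega
        have hna := L.le_na a
        have h1 : L.na a ≠ m x ∧ L.na a ≠ m x + 1 := by
          rcases hfirst with h1 | ⟨a', -, hs, h1⟩
          · rw [h1]; omega
          · rw [h1]
            have : a ≠ a' := by rintro rfl; exact hu (hs.symm.trans ha.2)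
            simp only [na]; omega
        exact ⟨hsame _ (by omega) h1.2 (by omega), hsame _ (by omega) (by omega) (by omega)⟩
  · refine hsame y (by omega) ?_ (by omega)
    rcases hfirst with h1 | ⟨a, -, -, h1⟩
    · omega
    · have := L.le_na a; omega

end Layout

/-- Add an arc; the registers `x`, `b`, `y`, `c` hold the addresses of the records of the source,
of the arc, of the target, and of the mate of the arc. -/
def addArcC (x b y c : ℕ) : Cmd :=
  .load 30 x ;; .store b 30 ;; .add 31 b 1 ;; .store 31 x ;; .add 31 30 1 ;; .store 31 b ;;
    .store x b ;; .add 31 b 12 ;; .store 31 y ;; .add 31 31 1 ;; .store 31 c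

lemma addArcC_wp {x b y c : ℕ} (hx : x < 30) (hb : b < 30) (hy : y < 30) (hc : c < 30) {s : State}
    (h1 : s.reg 1 = 1) (h12 : s.reg 12 = 2) (hw : cells ≤ 2 ^ w) (hbc : s.reg b + 3 < cells)
    (hxc : s.reg x < cells) (hmx : s.mem (s.reg x) + 1 < cells) {Q : State → Prop}
    (hQ : ∀ s', s'.mem = addArc s.mem (s.reg x) (s.reg b) (s.reg y) (s.reg c) → s'.out = s.out →
      (∀ r < 30, s'.reg r = s.reg r) → Q s') : wp cells w (addArcC x b y c) Q s := by
  simp [wp, addArcC, h1, h12, show x ≠ 30 by omega, show x ≠ 31 by omega, show b ≠ 30 by omega,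
    show b ≠ 31 by omega, show y ≠ 30 by omega, show y ≠ 31 by omega, show c ≠ 30 by omega,
    show c ≠ 31 by omega]
  refine ⟨by omega, by omega, by omega, by omega, by omega, by omega, by omega, by omega, by omega,
    by omega, by omega, hQ _ rfl rfl fun r hr => ?_⟩
  simp [show r ≠ 30 by omega, show r ≠ 31 by omega]

end GraphletEnum

namespace GraphletEnum

/-! ### The layout given by adjacency lists, and counting -/

variable {n : ℕ} {G : SimpleGraph (Fin n)}

/-- The edges found in the adjacency lists of the vertices `us`, each from its smaller end. -/
def pairs (adj : Fin n → List (Fin n)) (us : List (Fin n)) : List (Fin n × Fin n) :=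
  us.flatMap fun u => ((adj u).filter (u < ·)).map fun v => (u, v)

/-- The edges of the graph, in the order in which they are found in the input. -/
def edgeList (adj : Fin n → List (Fin n)) : List (Fin n × Fin n) := pairs adj (List.finRange n)

lemma mem_edgeList {adj : Fin n → List (Fin n)} (h : IsAdjLists G adj) {e : Fin n × Fin n} :
    e ∈ edgeList adj ↔ e.1 < e.2 ∧ G.Adj e.1 e.2 := by
  obtain ⟨u, v⟩ := e
  simp only [edgeList, pairs, List.mem_flatMap, List.mem_finRange, true_and, List.mem_map,
    List.mem_filter, decide_eq_true_eq, Prod.mk.injEq]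
  constructor
  · rintro ⟨a, b, ⟨h1, h2⟩, rfl, rfl⟩
    exact ⟨h2, ((h _).2 _).1 h1⟩
  · rintro ⟨h1, h2⟩
    exact ⟨u, v, ⟨((h _).2 _).2 h2, h1⟩, rfl, rfl⟩

lemma nodup_edgeList {adj : Fin n → List (Fin n)} (h : IsAdjLists G adj) :
    (edgeList adj).Nodup := by
  rw [edgeList, pairs, List.nodup_flatMap]
  refine ⟨fun u _ => ((h u).1.filter _).map fun a b hab => (Prod.mk.inj hab).2, ?_⟩
  refine (List.nodup_finRange n).imp fun {a b} hab => ?_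
  rw [Function.onFun, List.disjoint_left]
  intro e h1 h2
  obtain ⟨x, -, rfl⟩ := List.mem_map.1 h1
  obtain ⟨y, -, h3⟩ := List.mem_map.1 h2
  exact hab (Prod.mk.inj h3).1.symm

lemma length_edgeList_le {adj : Fin n → List (Fin n)} (h : IsAdjLists G adj) :
    (edgeList adj).length ≤ numEdges G := by
  classical
  rw [← List.toFinset_card_of_nodup (nodup_edgeList h), numEdges, ← Set.ncard_coe_finset]
  refine Set.ncard_le_ncard_of_injOn (fun e => s(e.1, e.2)) (fun e he => ?_) ?_ (Set.toFinite _)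
  · rw [Finset.mem_coe, List.mem_toFinset, mem_edgeList h] at he
    exact he.2
  · intro e he f hf hef
    rw [Finset.mem_coe, List.mem_toFinset, mem_edgeList h] at he hf
    rcases Sym2.eq_iff.1 hef with ⟨h1, h2⟩ | ⟨h1, h2⟩
    · exact Prod.ext h1 h2
    · have := he.1; have := hf.1
      rw [h1, h2] at *
      omega

lemma sum_length_adj {adj : Fin n → List (Fin n)} (h : IsAdjLists G adj) :
    ((List.finRange n).map fun u => (adj u).length).sum = 2 * numEdges G := by
  classical
  have h1 : ∀ u, (adj u).length = G.degree u := fun u => by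
    rw [← List.toFinset_card_of_nodup (h u).1, ← SimpleGraph.card_neighborFinset_eq_degree]
    congr 1
    ext v
    rw [List.mem_toFinset, (h u).2, SimpleGraph.mem_neighborFinset]
  simp only [h1]
  have h2 := G.sum_degrees_eq_twice_card_edges
  rw [numEdges, ← SimpleGraph.coe_edgeFinset, Set.ncard_coe_finset, ← h2,
    ← List.sum_toFinset _ (List.nodup_finRange n)]
  congr 1
  ext; simp

/-- The layout of the graph that is given by adjacency lists: the `i`-th edge of `edgeList adj`
gives the arcs `2 * i` and `2 * i + 1`. The vertex `z` is a default value. -/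
def layoutOf (G : SimpleGraph (Fin n)) (adj : Fin n → List (Fin n)) (hadj : IsAdjLists G adj)
    (z : Fin n) (H k : ℕ) : Layout G where
  H := H
  M := 2 * (edgeList adj).length
  k := k
  src a := if a % 2 = 0 then ((edgeList adj).getD (a / 2) (z, z)).1
    else ((edgeList adj).getD (a / 2) (z, z)).2
  tgt a := if a % 2 = 0 then ((edgeList adj).getD (a / 2) (z, z)).2
    else ((edgeList adj).getD (a / 2) (z, z)).1
  mate a := if a % 2 = 0 then a + 1 else a - 1
  mate_lt a ha := by split_ifs <;> omega
  mate_mate a ha := by split_ifs <;> omega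
  src_mate a ha := by
    rcases Nat.mod_two_eq_zero_or_one a with h | h
    · simp [h, show (a + 1) % 2 = 1 by omega, show (a + 1) / 2 = a / 2 by omega]
    · simp [h, show (a - 1) % 2 = 0 by omega, show (a - 1) / 2 = a / 2 by omega]
  tgt_mate a ha := by
    rcases Nat.mod_two_eq_zero_or_one a with h | h
    · simp [h, show (a + 1) % 2 = 1 by omega, show (a + 1) / 2 = a / 2 by omega]
    · simp [h, show (a - 1) % 2 = 0 by omega, show (a - 1) / 2 = a / 2 by omega]
  inj a ha b hb h1 h2 := by
    have ha' : a / 2 < (edgeList adj).length := by omega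
    have hb' : b / 2 < (edgeList adj).length := by omega
    rw [List.getD_eq_getElem _ _ ha', List.getD_eq_getElem _ _ hb'] at h1 h2
    have l1 := ((mem_edgeList hadj).1 (List.getElem_mem ha')).1
    have l2 := ((mem_edgeList hadj).1 (List.getElem_mem hb')).1
    have key : (edgeList adj)[a / 2] = (edgeList adj)[b / 2] → a / 2 = b / 2 := fun h =>
      (nodup_edgeList hadj).getElem_inj_iff.1 h
    split_ifs at h1 h2 with h3 h4
    · have := key (Prod.ext h1 h2); omega
    · rw [h1, h2] at l1; exact absurd l1 l2.asymm
    · rw [h1, h2] at l1; exact absurd l1 l2.asymm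
    · have := key (Prod.ext h2 h1); omega
  adj_iff u v := by
    constructor
    · intro huv
      rcases lt_trichotomy u v with h | rfl | h
      · obtain ⟨i, hi, he⟩ := List.getElem_of_mem ((mem_edgeList hadj (e := (u, v))).2 ⟨h, huv⟩)
        refine ⟨2 * i, by omega, ?_⟩
        simp [he, hi]
      · exact absurd huv (G.loopless.irrefl _)
      · obtain ⟨i, hi, he⟩ := List.getElem_of_mem ((mem_edgeList hadj (e := (v, u))).2
          ⟨h, huv.symm⟩)
        refine ⟨2 * i + 1, by omega, ?_⟩
        simp [show (2 * i + 1) / 2 = i by omega, Nat.add_mod, he, hi]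
    · rintro ⟨a, ha, h1, h2⟩
      have ha' : a / 2 < (edgeList adj).length := by omega
      rw [List.getD_eq_getElem _ _ ha'] at h1 h2
      have l1 := ((mem_edgeList hadj).1 (List.getElem_mem ha')).2
      split_ifs at h1 h2
      · rwa [h1, h2] at l1
      · rw [h1, h2] at l1; exact l1.symm

lemma layoutOf_pair (hadj : IsAdjLists G adj) (z : Fin n) (H k : ℕ) {p q : List (Fin n × Fin n)}
    {u v : Fin n} (h : edgeList adj = p ++ (u, v) :: q) :
    (layoutOf G adj hadj z H k).src (2 * p.length) = u ∧
    (layoutOf G adj hadj z H k).tgt (2 * p.length) = v ∧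
    (layoutOf G adj hadj z H k).mate (2 * p.length) = 2 * p.length + 1 ∧
    (layoutOf G adj hadj z H k).src (2 * p.length + 1) = v ∧
    (layoutOf G adj hadj z H k).tgt (2 * p.length + 1) = u ∧
    (layoutOf G adj hadj z H k).mate (2 * p.length + 1) = 2 * p.length := by
  simp [layoutOf, h, Nat.add_mod, show (2 * p.length + 1) / 2 = p.length by omega]

/-- A graphlet contains at most `k ^ 2` edges, and every edge of a connected graph lies in a
graphlet. -/
lemma numEdges_le (hG : G.Connected) {k : ℕ} (hk : 2 ≤ k) (hkn : k ≤ n) :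
    numEdges G ≤ k ^ 2 * (Sol G k Finset.univ ∅).card := by
  classical
  have huniv : Conn G (Finset.univ : Finset (Fin n)) := by
    refine conn_iff.2 ⟨⟨⟨0, by omega⟩, Finset.mem_univ _⟩, fun U _ hne hcl => ?_⟩
    exact eq_univ_of_closed hG hne fun u hu x hux => hcl u hu x (Finset.mem_univ _) hux
  have h1 : G.edgeSet ⊆ ((Sol G k Finset.univ ∅).biUnion fun S =>
      (S ×ˢ S).image fun e => s(e.1, e.2) : Finset (Sym2 (Fin n))) := by
    intro e he
    induction e with
    | _ u v =>
    have huv : G.Adj u v := he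
    have hc : Conn G {v, u} := (conn_singleton u).insert_of_adj (Finset.mem_singleton_self u) huv
    obtain ⟨T, hT⟩ := Sol_nonempty_of_subset (k := k) (A := Finset.univ) hc huniv
      (Finset.subset_univ _) subset_rfl ((Finset.card_le_two).trans hk) (by simpa using hkn)
    obtain ⟨t1, t2, t3, t4⟩ := mem_Sol.1 hT
    rw [Finset.mem_coe, Finset.mem_biUnion]
    refine ⟨T, mem_Sol.2 ⟨t1, Finset.empty_subset _, t3, t4⟩, Finset.mem_image.2 ⟨(u, v), ?_, rfl⟩⟩
    rw [Finset.mem_product]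
    exact ⟨t2 (by simp), t2 (by simp)⟩
  have h2 := Set.ncard_le_ncard h1 (Finset.finite_toSet _)
  rw [Set.ncard_coe_finset] at h2
  refine h2.trans ?_
  rw [mul_comm]
  refine Finset.card_biUnion_le_card_mul _ _ _ fun T hT => Finset.card_image_le.trans ?_
  rw [Finset.card_product, (mem_Sol.1 hT).2.2.1, sq]

/-- A connected graph has a spanning tree. -/
lemma le_numEdges_add_one (hG : G.Connected) : n ≤ numEdges G + 1 := by
  have := hG.card_vert_le_card_edgeSet_add_one
  simpa [numEdges, Set.ncard_eq_toFinset_card', Nat.card_eq_fintype_card] using this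

lemma numGraphlets_eq (k : ℕ) : numGraphlets G k = (Sol G k Finset.univ ∅).card := by
  rw [numGraphlets, ← Set.ncard_coe_finset]
  congr 1
  ext S
  simp [mem_Sol, IsKGraphlet, Conn]

end GraphletEnum

namespace GraphletEnum

/-! ### Reading the input -/

variable {n : ℕ} {G : SimpleGraph (Fin n)} {cells w : ℕ}

open Layout

/-- The input words for the vertices `us`. -/
def rows (adj : Fin n → List (Fin n)) (us : List (Fin n)) : List ℕ :=
  us.flatMap fun u => (adj u).length :: (adj u).map Fin.val

lemma rows_append (adj : Fin n → List (Fin n)) (us vs : List (Fin n)) :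
    rows adj (us ++ vs) = rows adj us ++ rows adj vs := by simp [rows]

lemma rows_cons (adj : Fin n → List (Fin n)) (u : Fin n) (vs : List (Fin n)) :
    rows adj (u :: vs) = (adj u).length :: (adj u).map Fin.val ++ rows adj vs := by simp [rows]

lemma length_rows (adj : Fin n → List (Fin n)) (us : List (Fin n)) :
    (rows adj us).length = us.length + (us.map fun u => (adj u).length).sum := by
  induction us with
  | nil => rfl
  | cons u us ih => rw [rows_cons]; simp [ih]; ring

/-- The rows of the input are in memory, from address `2` on. -/
def InputMem (adj : Fin n → List (Fin n)) (m : ℕ → ℕ) : Prop :=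
  ∀ i (h : i < (rows adj (List.finRange n)).length), m (2 + i) = (rows adj (List.finRange n))[i]

lemma InputMem.get {adj : Fin n → List (Fin n)} {m : ℕ → ℕ} (h : InputMem adj m) {p q : List ℕ}
    {x : ℕ} (he : rows adj (List.finRange n) = p ++ x :: q) : m (2 + p.length) = x := by
  rw [h p.length (by simp [he])]
  simp [he]

lemma InputMem.congr {adj : Fin n → List (Fin n)} {m m' : ℕ → ℕ} (h : InputMem adj m)
    (h' : ∀ x < 2 + (rows adj (List.finRange n)).length, m' x = m x) : InputMem adj m' :=
  fun i hi => by rw [h' _ (by omega), h i hi]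

/-- A vertex is the number of vertices that precede it. -/
lemma val_eq_length {us vs : List (Fin n)} {u : Fin n} (h : List.finRange n = us ++ u :: vs) :
    (u : ℕ) = us.length := by
  have h1 : us.length < (List.finRange n).length := by rw [h]; simp
  have h2 : (List.finRange n)[us.length] = u := by simp [h]
  rw [List.getElem_finRange] at h2
  rw [← h2]; simp

/-- Walk over the input to find its end; load its address to register 4. -/
def measureC : Cmd :=
  (.const 20 2 ;; .add 21 2 0) ;;
  .loop 21 (.load 22 20 ;; .add 20 20 22 ;; .add 20 20 1 ;; .sub 21 21 1) ;; .add 4 20 0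

lemma measureC_spec {adj : Fin n → List (Fin n)} {s : State} (hI : InputMem adj s.mem)
    (h0 : s.reg 0 = 0) (h1 : s.reg 1 = 1) (h2 : s.reg 2 = n)
    (hc : 2 + (rows adj (List.finRange n)).length ≤ cells) (hw : cells + 2 < 2 ^ w)
    (hn : n < 2 ^ w) :
    Halts cells w measureC s (5 * n + 4) (fun s' => s'.mem = s.mem ∧ s'.out = s.out ∧
      s'.reg 4 = 2 + (rows adj (List.finRange n)).length ∧ ∀ r < 20,
        r ≠ 4 → s'.reg r = s.reg r) := by
  refine (Halts.wp_seq (c := .const 20 2 ;; .add 21 2 0) (B := (5 * n + 1) + 1) ?_).mono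
    (by simp only [Cmd.size]; omega) fun _ h => h
  simp [wp, h0, h2]
  refine ⟨by omega, hn, ?_⟩
  refine Halts.seq (Halts.loop (T₀ := 0) (B := 5 * n) (fun T s' => ∃ us vs,
    List.finRange n = us ++ vs ∧ T = 5 * us.length ∧ s'.mem = s.mem ∧ s'.out = s.out ∧
    s'.reg 20 = 2 + (rows adj us).length ∧ s'.reg 21 = vs.length ∧
    ∀ r < 20, s'.reg r = s.reg r) ?_ ?_ ?_) ?_
  · refine ⟨[], List.finRange n, rfl, rfl, rfl, rfl, by simp [rows], by simp, fun r hr => ?_⟩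
    simp [show r ≠ 21 by omega, show r ≠ 20 by omega]
  · rintro T s' ⟨us, vs, e, rfl, -⟩
    have := congrArg List.length e
    simp at this; omega
  · rintro T s' ⟨us, vs, e, rfl, i1, i2, i3, i4, i5⟩ h7
    cases vs with
    | nil => simp at i4; omega
    | cons u vs =>
      have he : rows adj (List.finRange n) =
          rows adj us ++ (adj u).length :: ((adj u).map Fin.val ++ rows adj vs) := by
        rw [e, rows_append, rows_cons]; simp
      have hl := congrArg List.length he
      simp only [List.length_append, List.length_cons, List.length_map] at hl
      have hx := hI.get he
      refine ⟨_, Halts.of_wp ?_⟩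
      simp [wp, i3, i1, i4, hx, i5 1, h1]
      refine ⟨by omega, by omega, by omega, us ++ [u], vs, by simpa using e, ?_, i2, ?_, rfl,
        fun r hr => ?_⟩
      · simp [Cmd.size]; ring
      · rw [rows_append, rows_cons]; simp [rows]; ring
      · simp [show r ≠ 21 by omega, show r ≠ 20 by omega, show r ≠ 22 by omega, i5 r hr]
  · rintro s' ⟨h7, T, us, vs, e, rfl, i1, i2, i3, i4, i5⟩
    rw [h7] at i4
    obtain rfl := List.length_eq_zero_iff.1 i4.symm
    rw [List.append_nil] at e
    refine Halts.of_wp (c := .add 4 20 0) ?_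
    simp [wp, i3, i5 0, h0]
    refine ⟨by rw [← e]; omega, i1, i2, by rw [e], fun r hr h4 => ?_⟩
    simp [h4, i5 r hr]

/-- What the registers hold while the graph is built in memory. -/
structure Setup (L : Layout G) (s : State) : Prop where
  r0 : s.reg 0 = 0
  r1 : s.reg 1 = 1
  r2 : s.reg 2 = n
  r3 : s.reg 3 = L.k
  r4 : s.reg 4 = L.H
  r12 : s.reg 12 = 2
  r13 : s.reg 13 = 3
  r14 : s.reg 14 = 4

lemma Setup.congr {L : Layout G} {s s' : State} (h : Setup L s)
    (h' : ∀ r < 20, s'.reg r = s.reg r) : Setup L s' := by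
  constructor <;> rw [h' _ (by norm_num)]
  exacts [h.r0, h.r1, h.r2, h.r3, h.r4, h.r12, h.r13, h.r14]

/-- Write the records of the vertices, with empty lists. -/
def recordsC : Cmd :=
  (.add 20 4 0 ;; .const 21 0 ;; .sub 24 2 21) ;;
  .loop 24 (.store 20 20 ;; .add 22 20 1 ;; .store 22 20 ;; .add 22 20 12 ;; .store 22 0 ;;
    .add 22 20 13 ;; .store 22 21 ;; .add 20 20 14 ;; .add 21 21 1 ;; .sub 24 2 21)

lemma recordsC_spec {L : Layout G} (hF : Fits L cells w) {s : State} (hS : Setup L s) :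
    Halts cells w recordsC s (11 * n + 4) (fun s' => L.PartMem 0 s'.mem ∧
      (∀ x < L.H, s'.mem x = s.mem x) ∧ s'.out = s.out ∧ s'.reg 20 = L.na 0 ∧
      ∀ r < 20, s'.reg r = s.reg r) := by
  have h1 := hF.mem_le; have h2 := hF.word_le
  obtain ⟨o1, o2, o3⟩ := L.order
  have hh := L.hdr_le_ord
  refine (Halts.wp_seq (c := .add 20 4 0 ;; .const 21 0 ;; .sub 24 2 21) (B := 11 * n + 1) ?_).mono
    (by simp only [Cmd.size]; omega) fun _ h => h
  simp [wp, hS.r0, hS.r2, hS.r4]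
  refine ⟨by omega, ?_⟩
  refine (Halts.loop (T₀ := 0) (B := 11 * n) (fun T s' => ∃ i ≤ n, T = 11 * i ∧
    (∀ u : Fin n, u < i → s'.mem (L.va u) = L.va u ∧ s'.mem (L.va u + 1) = L.va u ∧
      s'.mem (L.va u + 2) = 0 ∧ s'.mem (L.va u + 3) = u) ∧
    (∀ x < L.H, s'.mem x = s.mem x) ∧ s'.out = s.out ∧
    s'.reg 20 = L.H + 4 * i ∧ s'.reg 21 = i ∧ s'.reg 24 = n - i ∧
    ∀ r < 20, s'.reg r = s.reg r) ?_ ?_ ?_).mono le_rfl ?_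
  · refine ⟨0, Nat.zero_le _, rfl, by simp, fun _ _ => rfl, rfl, by simp, by simp, by simp,
      fun r hr => ?_⟩
    simp [show r ≠ 21 by omega, show r ≠ 20 by omega, show r ≠ 24 by omega]
  · rintro T s' ⟨i, hi, rfl, -⟩
    omega
  · rintro T s' ⟨i, hi, rfl, i1, i2, i3, i4, i5, i6, i7⟩ h7
    have hS' := hS.congr i7
    refine ⟨_, Halts.of_wp ?_⟩
    simp [wp, i4, i5, hS'.r0, hS'.r1, hS'.r2, hS'.r12, hS'.r13, hS'.r14]
    refine ⟨by omega, by omega, by omega, by omega, by omega, by omega, by omega, by omega,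
      by omega,
      by omega, ?_, fun u hu => ?_, fun x hx => ?_, i3, ?_, fun r hr => ?_⟩
    · simp [Cmd.size]; ring
    · rcases Nat.lt_or_eq_of_le hu with hu | hu
      · have hlt : L.va u + 3 < L.H + 4 * i := by simp only [va]; omega
        obtain ⟨g1, g2, g3, g4⟩ := i1 u hu
        refine ⟨?_, ?_, ?_, ?_⟩
        · repeat rw [Function.update_of_ne (by omega)]
          exact g1
        · repeat rw [Function.update_of_ne (by omega)]
          exact g2
        · repeat rw [Function.update_of_ne (by omega)]
          exact g3
        · repeat rw [Function.update_of_ne (by omega)]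
          exact g4
      · subst hu
        have hva : L.va u = L.H + 4 * u := rfl
        rw [hva]
        simp
    · repeat rw [Function.update_of_ne (by omega)]
      exact i2 x hx
    · ring
    · repeat rw [Function.update_of_ne (by omega)]
      exact i7 r hr
  · rintro s' ⟨h0, T, i, hi, rfl, i1, i2, i3, i4, i5, i6, i7⟩
    obtain rfl : i = n := by omega
    refine ⟨⟨fun u => (i1 u u.2).2.2.2, fun u => by simpa using (i1 u u.2).2.2.1, by simp, by simp,
      fun u => ?_⟩, i2, i3, by simp [i4, na], i7⟩
    have := i1 u u.2
    rintro ⟨y, z⟩ hyz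
    simp [firstArcs] at hyz
    obtain ⟨rfl, rfl⟩ := hyz
    exact ⟨this.1, this.2.1⟩

/-- Add the two arcs of the edge between the vertex in register 21, with the address of its record
in register 22, and the vertex in register 26. Register 23 holds the address of the next arc. -/
def pairC : Cmd :=
  .add 28 26 26 ;; .add 28 28 28 ;; .add 28 4 28 ;; .add 29 23 14 ;; addArcC 22 23 28 29 ;;
    addArcC 28 29 22 23 ;; .add 23 29 14

lemma Layout.PartMem.head_lt {L : Layout G} {j : ℕ} {m : ℕ → ℕ} (h : L.PartMem j m) (hj : j ≤ L.M)
    (u : Fin n) : m (L.va u) + 3 < L.ord := by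
  have := (h.lists u).first
  rw [this]
  exact cur_lt fun a ha => by have := (mem_firstArcs.1 ha).1; omega

lemma pairC_wp {L : Layout G} (hF : Fits L cells w) {s : State} (hS : Setup L s) {j : ℕ}
    (hj : j + 1 < L.M) (hm : L.PartMem j s.mem) {u v : Fin n} (hu : L.src j = u) (hv : L.tgt j = v)
    (hu' : L.src (j + 1) = v) (hv' : L.tgt (j + 1) = u) (hj1 : L.mate j = j + 1)
    (hj2 : L.mate (j + 1) = j) (h22 : s.reg 22 = L.va u) (h23 : s.reg 23 = L.na j)
    (h26 : s.reg 26 = v) {Q : State → Prop}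
    (hQ : ∀ s', L.PartMem (j + 2) s'.mem → (∀ x < L.H, s'.mem x = s.mem x) → s'.out = s.out →
      s'.reg 23 = L.na (j + 2) → (∀ r < 28, r ≠ 23 → s'.reg r = s.reg r) → Q s') :
    wp cells w pairC Q s := by
  have h1 := hF.mem_le; have h2 := hF.word_le
  obtain ⟨o1, o2, o3⟩ := L.order
  have hh := L.hdr_le_ord
  have hna := L.na_lt hj
  have hna1 : L.na (j + 1) = L.na j + 4 := by simp only [na]; ring
  have hna2 : L.na (j + 2) = L.na j + 8 := by simp only [na]; ring
  have hvl := L.va_lt v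
  have hul := L.va_lt u
  have hva : L.H + (v + v + (v + v) : ℕ) = L.va v := by simp only [va]; ring
  have hv4 := v.2
  unfold pairC
  simp only [wp]
  simp [h26, hS.r4, h23, hS.r14, hva]
  refine ⟨by omega, by omega, by omega, by omega, ?_⟩
  have hd1 := hm.head_lt (by omega) u
  refine addArcC_wp (by norm_num) (by norm_num) (by norm_num) (by norm_num) (by simp [hS.r1])
    (by simp [hS.r12]) (by omega) (by simp [h23]; omega) (by simp [h22]; omega)
    (by simp [h22]; omega) fun s₁ e1 e2 e3 => ?_
  simp [h22, h23] at e1 e2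
  obtain ⟨hp1, hp2⟩ := hm.addArc
  rw [hu, hv, hj1, hna1, ← e1] at hp1 hp2
  have hd2 := hp1.head_lt (by omega) v
  have f22 : s₁.reg 22 = L.va u := by rw [e3 22 (by norm_num)]; simp [h22]
  have f23 : s₁.reg 23 = L.na j := by rw [e3 23 (by norm_num)]; simp [h23]
  have f28 : s₁.reg 28 = L.va v := by rw [e3 28 (by norm_num)]; simp
  have f29 : s₁.reg 29 = L.na (j + 1) := by rw [e3 29 (by norm_num), hna1]; simp
  have f14 : s₁.reg 14 = 4 := by rw [e3 14 (by norm_num)]; simp [hS.r14]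
  refine addArcC_wp (by norm_num) (by norm_num) (by norm_num) (by norm_num)
    (by rw [e3 1 (by norm_num)]; simp [hS.r1]) (by rw [e3 12 (by norm_num)]; simp [hS.r12])
    (by omega) (by rw [f29]; omega) (by rw [f28]; omega) (by rw [f28]; omega)
    fun s₂ g1 g2 g3 => ?_
  rw [f22, f23, f28, f29] at g1
  obtain ⟨hq1, hq2⟩ := hp1.addArc
  rw [hu', hv', hj2, ← g1] at hq1 hq2
  rw [g3 29 (by norm_num), g3 14 (by norm_num), f29, f14]
  refine ⟨by omega, hQ _ hq1 (fun x hx => ?_) ?_ ?_ fun r hr h23 => ?_⟩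
  · rw [State.setReg_mem, hq2 x hx, hp2 x hx]
  · rw [State.setReg_out, g2, e2]
  · simp; omega
  · simp only [State.setReg_reg]
    rw [Function.update_of_ne h23, g3 r (by omega), e3 r (by omega)]
    simp [show r ≠ 29 by omega, show r ≠ 28 by omega]

end GraphletEnum

namespace GraphletEnum

/-! ### Building the graph in memory -/

variable {n : ℕ} {G : SimpleGraph (Fin n)} {cells w : ℕ}

open Layout

lemma pairs_append (adj : Fin n → List (Fin n)) (us vs : List (Fin n)) :
    pairs adj (us ++ vs) = pairs adj us ++ pairs adj vs := by simp [pairs]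

/-- Read the row of the vertex in register 21, from the address in register 20 on, and add the arcs
of its edges to larger vertices. -/
def rowC : Cmd :=
  (.load 25 20 ;; .add 20 20 1) ;;
  .loop 25 (.load 26 20 ;; .sub 27 26 21 ;; .cond 27 pairC .skip ;; .add 20 20 1 ;; .sub 25 25 1) ;;
  .add 21 21 1 ;; .add 22 22 14

/-- The arcs of the edges `E` have been added, and the input has been read up to address `p`. -/
structure ArcsInv (L : Layout G) (s₀ : State) (E : List (Fin n × Fin n)) (p : ℕ) (s : State) :
    Prop where
  part : L.PartMem (2 * E.length) s.mem
  low : ∀ x < L.H, s.mem x = s₀.mem x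
  out : s.out = s₀.out
  r20 : s.reg 20 = p
  r23 : s.reg 23 = L.na (2 * E.length)
  regs : ∀ r < 20, s.reg r = s₀.reg r

lemma rowC_spec {adj : Fin n → List (Fin n)} (hadj : IsAdjLists G adj) {z : Fin n} {H k : ℕ}
    (hH : H = 2 + (rows adj (List.finRange n)).length)
    (hF : Fits (layoutOf G adj hadj z H k) cells w)
    {s₀ s : State} (hS : Setup (layoutOf G adj hadj z H k) s₀) (hin : InputMem adj s₀.mem)
    {us vs : List (Fin n)} {u : Fin n} (he : List.finRange n = us ++ u :: vs)
    (hI : ArcsInv (layoutOf G adj hadj z H k) s₀ (pairs adj us) (2 + (rows adj us).length) s)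
    (h21 : s.reg 21 = us.length) (h22 : s.reg 22 = H + 4 * us.length) :
    Halts cells w rowC s (34 * (adj u).length + 5) (fun s' =>
      ArcsInv (layoutOf G adj hadj z H k) s₀ (pairs adj (us ++ [u]))
        (2 + (rows adj (us ++ [u])).length) s' ∧
      s'.reg 21 = us.length + 1 ∧ s'.reg 22 = H + 4 * (us.length + 1)) := by
  set L := layoutOf G adj hadj z H k with hL
  have h1 := hF.mem_le; have h2 := hF.word_le
  obtain ⟨o1, o2, o3⟩ := L.order
  have hh := L.hdr_le_ord
  have hLH : L.H = H := rfl
  have hu := val_eq_length he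
  have hul := u.2
  have hrow : rows adj (List.finRange n) =
      rows adj us ++ (adj u).length :: ((adj u).map Fin.val ++ rows adj vs) := by
    rw [he, rows_append, rows_cons]; simp
  have hlen := congrArg List.length hrow
  simp only [List.length_append, List.length_cons, List.length_map] at hlen
  have hx : s.mem (2 + (rows adj us).length) = (adj u).length := by
    rw [hI.low _ (by omega)]; exact hin.get hrow
  refine (Halts.wp_seq (c := .load 25 20 ;; .add 20 20 1) (B := (34 * (adj u).length + 1) + 2)
    ?_).mono (by simp only [Cmd.size]; omega) fun _ h => h
  simp [wp, hI.r20, hx, hI.regs 1, hS.r1]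
  refine ⟨by omega, by omega, ?_⟩
  refine Halts.seq (Halts.loop (T₀ := 0) (B := 34 * (adj u).length) (fun T s' => ∃ ps qs,
    adj u = ps ++ qs ∧ T ≤ 34 * ps.length ∧
    ArcsInv L s₀ (pairs adj us ++ (ps.filter (u < ·)).map fun v => (u, v))
      (2 + (rows adj us).length + 1 + ps.length) s' ∧
    s'.reg 21 = us.length ∧ s'.reg 22 = L.va u ∧ s'.reg 25 = qs.length) ?_ ?_ ?_) ?_
  · refine ⟨[], adj u, rfl, by simp, ⟨by simpa using hI.part, hI.low, hI.out, by simp,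
      by simpa using hI.r23, fun r hr => ?_⟩, by simp [h21], by simp [h22, va, hu, hLH], by simp⟩
    simpa [show r ≠ 20 by omega, show r ≠ 25 by omega] using hI.regs r hr
  · rintro T s' ⟨ps, qs, e, hT, -⟩
    rw [e, List.length_append]; omega
  · rintro T s' ⟨ps, qs, e, hT, i1, i2, i3, i4⟩ h7
    have hS' := hS.congr i1.regs
    cases qs with
    | nil => simp at i4; omega
    | cons v qs =>
      have hlen' := congrArg List.length e
      simp only [List.length_append, List.length_cons] at hlen'
      have hv : s'.mem (2 + (rows adj us).length + 1 + ps.length) = v := by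
        rw [i1.low _ (by omega)]
        have := hin.get (p := rows adj us ++ (adj u).length :: ps.map Fin.val)
          (q := qs.map Fin.val ++ rows adj vs) (x := v) (by rw [hrow, e]; simp)
        rw [← this]
        congr 1
        simp; ring
      set E := pairs adj us ++ (ps.filter (u < ·)).map fun v => (u, v) with hE
      refine ⟨33, (Halts.of_wp (c := .load 26 20 ;; .sub 27 26 21 ;; .cond 27 pairC .skip ;;
        .add 20 20 1 ;; .sub 25 25 1) ?_).mono (by simp [Cmd.size, pairC, addArcC]) fun _ h => h⟩
      simp only [wp, i1.r20, hv, State.setReg_reg, Function.update_self, ← hu]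
      rw [Function.update_of_ne (by norm_num), i2, ← hu]
      refine ⟨by omega, fun hne => ?_, fun hne => ?_⟩
      · -- an edge
        have huv : u < v := Fin.lt_def.2 (by omega)
        have hedge : edgeList adj = E ++ (u, v) :: ((qs.filter (u < ·)).map (fun v => (u, v)) ++
            pairs adj vs) := by
          rw [edgeList, he, pairs_append, hE]
          simp [pairs, e, huv]
        obtain ⟨l1, l2, l3, l4, l5, l6⟩ := layoutOf_pair hadj z H k hedge
        have hM : 2 * E.length + 1 < L.M := by
          have := congrArg List.length hedge
          simp only [List.length_append, List.length_cons] at this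
          change _ < 2 * (edgeList adj).length
          omega
        refine pairC_wp (s := (s'.setReg 26 v).setReg 27 (v - u)) hF (hS'.congr fun r hr => ?_) hM i1.part l1 l2 l4 l5 l3 l6 ?_ ?_ ?_
          fun s₁ j1 j2 j3 j4 j5 => ?_
        · simp [show r ≠ 27 by omega, show r ≠ 26 by omega]
        · simpa using i3
        · simpa using i1.r23
        · simp
        have hE' : pairs adj us ++ ((ps ++ [v]).filter (u < ·)).map (fun v => (u, v)) =
            E ++ [(u, v)] := by
          rw [hE]; simp [huv]
        have k20 : s₁.reg 20 = 2 + (rows adj us).length + 1 + ps.length := by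
          rw [j5 20 (by norm_num) (by norm_num)]; simp [i1.r20]
        have k25 : s₁.reg 25 = qs.length + 1 := by
          rw [j5 25 (by norm_num) (by norm_num)]; simp [i4]
        have k1 : s₁.reg 1 = 1 := by
          rw [j5 1 (by norm_num) (by norm_num)]; simp [hS'.r1]
        rw [k20, k1, Function.update_of_ne (by norm_num), Function.update_of_ne (by norm_num),
          k25, k1]
        refine ⟨by omega, ps ++ [v], qs, by simpa using e, by simp; omega, ⟨?_, ?_, ?_, ?_, ?_, ?_⟩,
          ?_, ?_, ?_⟩
        · rw [hE', List.length_append, List.length_singleton, mul_add]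
          exact j1
        · intro x hx
          rw [← i1.low x hx]; exact j2 x hx
        · rw [← i1.out]; exact j3
        · simp; ring
        · rw [hE', List.length_append, List.length_singleton, mul_add]
          simpa using j4
        · intro r hr
          simp only [State.setReg_reg]
          rw [Function.update_of_ne (by omega), Function.update_of_ne (by omega),
            j5 r (by omega) (by omega)]
          simp [show r ≠ 27 by omega, show r ≠ 26 by omega, i1.regs r hr]
        · simp [j5, i2, hu]
        · simp [j5, i3]
        · simp
      · have huv : ¬ u < v := fun h => by rw [Fin.lt_def] at h; omega
        have hE' : pairs adj us ++ ((ps ++ [v]).filter (u < ·)).map (fun v => (u, v)) = E := by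
          rw [hE]; simp [huv]
        simp [i1.r20, hS'.r1, i4]
        refine ⟨by omega, ps ++ [v], qs, by simpa using e, by simp; omega, ⟨?_, i1.low, i1.out,
          ?_, ?_,
          fun r hr => ?_⟩, i2.trans hu.symm, i3, rfl⟩
        · have := i1.part; rw [← hE'] at this; simpa using this
        · simp; ring
        · have := i1.r23; rw [← hE'] at this; simpa using this
        · simp [show r ≠ 27 by omega, show r ≠ 26 by omega, show r ≠ 25 by omega,
            show r ≠ 20 by omega, i1.regs r hr]
  · rintro s' ⟨h7, T, ps, qs, e, hT, i1, i2, i3, i4⟩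
    rw [h7] at i4
    obtain rfl := List.length_eq_zero_iff.1 i4.symm
    rw [List.append_nil] at e
    have hS' := hS.congr i1.regs
    have hE' : pairs adj us ++ (ps.filter (u < ·)).map (fun v => (u, v)) =
        pairs adj (us ++ [u]) := by
      rw [pairs_append, ← e]; simp [pairs]
    rw [hE'] at i1
    have hva : L.va u = H + 4 * us.length := by rw [← hu]; rfl
    refine Halts.of_wp (c := .add 21 21 1 ;; .add 22 22 14) ?_
    simp [wp, i2, i3, hS'.r1, hS'.r14, hva]
    refine ⟨by omega, by omega, ⟨i1.part, i1.low, i1.out, ?_, ?_, fun r hr => ?_⟩, by ring⟩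
    · simp [i1.r20, rows_append, rows_cons, e]; simp [rows]; ring
    · simpa using i1.r23
    · simp [show r ≠ 22 by omega, show r ≠ 21 by omega, i1.regs r hr]

/-- Add the arcs of all edges. -/
def arcsC : Cmd :=
  (.add 23 20 0 ;; .const 20 2 ;; .const 21 0 ;; .add 22 4 0 ;; .sub 24 2 21) ;;
  .loop 24 (rowC ;; .sub 24 2 21)

lemma arcsC_spec {adj : Fin n → List (Fin n)} (hadj : IsAdjLists G adj) {z : Fin n} {H k : ℕ}
    (hH : H = 2 + (rows adj (List.finRange n)).length)
    (hF : Fits (layoutOf G adj hadj z H k) cells w)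
    {s : State} (hS : Setup (layoutOf G adj hadj z H k) s) (hin : InputMem adj s.mem)
    (hm : (layoutOf G adj hadj z H k).PartMem 0 s.mem)
    (h20 : s.reg 20 = (layoutOf G adj hadj z H k).na 0) :
    Halts cells w arcsC s (34 * (2 * numEdges G) + 7 * n + 6) (fun s' =>
      (layoutOf G adj hadj z H k).PartMem (layoutOf G adj hadj z H k).M s'.mem ∧
      s'.out = s.out ∧ s'.reg 23 = (layoutOf G adj hadj z H k).ord ∧
      ∀ r < 20, s'.reg r = s.reg r) := by
  set L := layoutOf G adj hadj z H k with hL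
  have h1 := hF.mem_le; have h2 := hF.word_le
  obtain ⟨o1, o2, o3⟩ := L.order
  have hh := L.hdr_le_ord
  have hLH : L.H = H := rfl
  have hsum := sum_length_adj hadj
  refine (Halts.wp_seq (c := .add 23 20 0 ;; .const 20 2 ;; .const 21 0 ;; .add 22 4 0 ;;
    .sub 24 2 21)
    (B := 34 * (2 * numEdges G) + 7 * n + 1) ?_).mono (by simp only [Cmd.size]; omega) fun _ h => h
  have hna0 : L.na 0 = L.H + 4 * n := by simp [na]
  simp [wp, h20, hS.r0, hS.r2, hS.r4]
  refine ⟨by omega, by omega, by omega, ?_⟩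
  refine (Halts.loop (T₀ := 0) (B := 34 * (2 * numEdges G) + 7 * n) (fun T s' => ∃ us vs,
    List.finRange n = us ++ vs ∧ T = 34 * (us.map fun u => (adj u).length).sum + 7 * us.length ∧
    ArcsInv L s (pairs adj us) (2 + (rows adj us).length) s' ∧
    s'.reg 21 = us.length ∧ s'.reg 22 = H + 4 * us.length ∧ s'.reg 24 = vs.length) ?_ ?_ ?_).mono
    le_rfl ?_
  · refine ⟨[], List.finRange n, rfl, by simp, ⟨by simpa [pairs] using hm, fun _ _ => rfl, rfl,
      by simp [rows], by simp [pairs], fun r hr => ?_⟩, by simp, by simp [hLH], by simp⟩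
    simp [show r ≠ 24 by omega, show r ≠ 22 by omega, show r ≠ 21 by omega, show r ≠ 20 by omega,
      show r ≠ 23 by omega]
  · rintro T s' ⟨us, vs, e, rfl, -⟩
    have hl := congrArg List.length e
    rw [← hsum, e, List.map_append, List.sum_append]
    simp at hl
    omega
  · rintro T s' ⟨us, vs, e, rfl, i1, i2, i3, i4⟩ h7
    cases vs with
    | nil => simp at i4; omega
    | cons u vs =>
      have hl := congrArg List.length e
      simp at hl
      refine ⟨_, (rowC_spec hadj hH hF hS hin e i1 i2 i3).seq fun s₁ hs₁ =>
        Halts.of_wp (c := .sub 24 2 21) ?_⟩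
      obtain ⟨j1, j2, j3⟩ := hs₁
      simp only [wp]
      refine ⟨us ++ [u], vs, by simpa using e, ?_, ⟨j1.part, j1.low, j1.out, ?_, ?_,
        fun r hr => ?_⟩,
        ?_, ?_, ?_⟩
      · simp [Cmd.size]; ring
      · simp [j1.r20]
      · simpa using j1.r23
      · simp [show r ≠ 24 by omega, j1.regs r hr]
      · simp [j2]
      · simp [j3]
      · simp [j2, j1.regs 2, hS.r2]; omega
  · rintro s' ⟨h7, T, us, vs, e, rfl, i1, i2, i3, i4⟩
    rw [h7] at i4
    obtain rfl := List.length_eq_zero_iff.1 i4.symm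
    rw [List.append_nil] at e
    subst e
    exact ⟨i1.part, i1.out, i1.r23, i1.regs⟩

/-- Load the addresses of the arrays to registers. -/
def baseC : Cmd :=
  .add 20 2 2 ;; .add 20 20 20 ;; .add 5 4 20 ;; .sub 5 5 1 ;; .add 6 23 0 ;; .add 7 6 2 ;;
    .add 8 7 2 ;; .add 9 8 2 ;; .sub 20 3 1 ;; .add 10 7 20 ;; .add 11 8 3

lemma baseC_spec {L : Layout G} (hF : Fits L cells w) {s : State} (hS : Setup L s)
    (h23 : s.reg 23 = L.ord) :
    Halts cells w baseC s 11 (fun s' => Base L s' ∧ s'.mem = s.mem ∧ s'.out = s.out) := by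
  have h1 := hF.mem_le; have h2 := hF.word_le; have h3 := hF.le
  obtain ⟨o1, o2, o3⟩ := L.order
  have hh := L.hdr_le_ord
  refine Halts.of_wp (c := baseC) ?_
  simp [wp, baseC, hS.r0, hS.r1, hS.r2, hS.r3, hS.r4, h23]
  refine ⟨by omega, by omega, by omega, by omega, by omega, by omega, by omega, by omega,
    by omega, ?_⟩
  constructor <;> simp [hS.r0, hS.r1, hS.r2, hS.r3, hS.r4, hS.r12, hS.r13] <;> omega

end GraphletEnum

namespace GraphletEnum

/-! ### The enumeration program -/

variable {n : ℕ} {G : SimpleGraph (Fin n)} {cells w : ℕ}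

open Layout

/-- Output all vertices. -/
def verticesC : Cmd :=
  (.const 20 0 ;; .sub 24 2 20) ;; .loop 24 (.emit 20 ;; .add 20 20 1 ;; .sub 24 2 20)

lemma verticesC_spec {s : State} (h1 : s.reg 1 = 1) (h2 : s.reg 2 = n) (hw : n < 2 ^ w) :
    Halts cells w verticesC s (4 * n + 3) (fun s' => s'.out = s.out ++ List.range n) := by
  refine (Halts.wp_seq (c := .const 20 0 ;; .sub 24 2 20) (B := 4 * n + 1) ?_).mono
    (by simp only [Cmd.size]; omega) fun _ h => h
  simp [wp, h2]
  refine (Halts.loop (T₀ := 0) (B := 4 * n) (fun T s' => ∃ i ≤ n, T = 4 * i ∧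
    s'.out = s.out ++ List.range i ∧ s'.reg 20 = i ∧ s'.reg 24 = n - i ∧ s'.reg 1 = 1 ∧
    s'.reg 2 = n) ?_ ?_ ?_).mono le_rfl ?_
  · exact ⟨0, Nat.zero_le _, by simp [h1, h2]⟩
  · rintro T s' ⟨i, hi, rfl, -⟩
    omega
  · rintro T s' ⟨i, hi, rfl, i1, i2, i3, i4, i5⟩ h7
    refine ⟨_, Halts.of_wp (c := .emit 20 ;; .add 20 20 1 ;; .sub 24 2 20) ?_⟩
    simp only [wp, State.write_reg, i2, i4]
    refine ⟨by omega, i + 1, by omega, ?_, ?_, by simp, by simp [i5], by simp [i4], by simp [i5]⟩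
    · simp [Cmd.size]; ring
    · simp [i1, List.range_succ]
  · rintro s' ⟨h0, T, i, hi, rfl, i1, i2, i3, i4, i5⟩
    obtain rfl : i = n := by omega
    exact i1

/-- Enumerate the `k`-graphlets, for `2 ≤ k ≤ n`. -/
def enumC : Cmd :=
  (.const 12 2 ;; .const 13 3 ;; .const 14 4) ;; measureC ;; recordsC ;; arcsC ;; baseC ;;
    orderC ;; rootsC

lemma enumC_spec (hG : G.Connected) {adj : Fin n → List (Fin n)} (hadj : IsAdjLists G adj) {k : ℕ}
    (hk : 2 ≤ k) (hkn : k ≤ n) {s : State} (hin : InputMem adj s.mem) (h0 : s.reg 0 = 0)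
    (h1 : s.reg 1 = 1) (h2 : s.reg 2 = n) (h3 : s.reg 3 = k) (ho : s.out = [])
    (hc : 10 * n + 10 * numEdges G + 10 ≤ cells) (hw : cells + k + 8 ≤ 2 ^ w) :
    Halts cells w enumC s
      (54 * n + 106 * numEdges G + 50 + 700 * (k * k) * (Sol G k Finset.univ ∅).card) (fun s' =>
        ∃ blocks, Lists blocks (Sol G k Finset.univ ∅) ∧ s'.out = blockWords blocks) := by
  set H := 2 + (rows adj (List.finRange n)).length with hH
  have hHm : H = 2 + n + 2 * numEdges G := by
    rw [hH, length_rows, sum_length_adj hadj]; simp; ring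
  set L := layoutOf G adj hadj ⟨0, by omega⟩ H k with hL
  have hlen := length_edgeList_le hadj
  have hLM : L.M = 2 * (edgeList adj).length := rfl
  have hLH : L.H = H := rfl
  have hLk : L.k = k := rfl
  have hF : Fits L cells w := by
    refine ⟨?_, hw, hk, hkn⟩
    simp only [tr, hLM, hLH]
    omega
  refine (Halts.wp_seq (c := .const 12 2 ;; .const 13 3 ;; .const 14 4)
    (B := (5 * n + 4) + ((11 * n + 4) + ((34 * (2 * numEdges G) + 7 * n + 6) + (11 +
      ((19 * (n + L.M) + 12 * n + 18) +
        (700 * (k * k) * (Sol G k Finset.univ ∅).card + 4)))))) ?_).mono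
    (by simp only [Cmd.size]; omega) fun _ h => h
  simp only [wp]
  refine ⟨by omega, by omega, by omega, ?_⟩
  refine Halts.seq (measureC_spec (adj := adj) ?_ (by simp [h0]) (by simp [h1]) (by simp [h2])
    (by omega) (by omega) (by omega)) fun s₁ hs₁ => ?_
  · exact hin
  obtain ⟨a1, a2, a3, a4⟩ := hs₁
  simp only [State.setReg_mem, State.setReg_out] at a1 a2
  have hS : Setup L s₁ := by
    refine ⟨?_, ?_, ?_, ?_, a3, ?_, ?_, ?_⟩ <;> rw [a4 _ (by norm_num) (by norm_num)] <;>
      simp [h0, h1, h2, h3, hLk]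
  refine Halts.seq (recordsC_spec hF hS) fun s₂ hs₂ => ?_
  obtain ⟨b1, b2, b3, b4, b5⟩ := hs₂
  have hin₂ : InputMem adj s₂.mem := hin.congr fun x hx => by rw [b2 x hx, a1]
  refine Halts.seq (arcsC_spec hadj hH hF (hS.congr b5) hin₂ b1 b4) fun s₃ hs₃ => ?_
  obtain ⟨c1, c2, c3, c4⟩ := hs₃
  refine Halts.seq (baseC_spec hF ((hS.congr b5).congr c4) c3) fun s₄ hs₄ => ?_
  obtain ⟨d1, d2, d3⟩ := hs₄
  have hmem : L.PartMem L.M s₄.mem := by rw [d2]; exact c1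
  refine Halts.seq (orderC_spec hG hF d1 hmem.graph hmem.marks (by rw [d3, c2, b3, a2, ho]))
    fun s₅ hs₅ => ?_
  obtain ⟨p, hp, hI⟩ := hs₅
  have := rootsC_spec (by rw [hLH]; omega) hF hI
  rwa [hp] at this

/-- The enumeration program. Its special cases are `k = 1`, where the vertices are the graphlets,
and `k > n`, where there are no graphlets. -/
def graphletC : Cmd :=
  (.const 1 1 ;; .load 2 0 ;; .load 3 1 ;; .sub 24 3 1) ;;
    .cond 24 (.sub 24 3 2 ;; .cond 24 .skip enumC) verticesC

lemma inputMem_init (adj : Fin n → List (Fin n)) (k : ℕ) :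
    InputMem adj (State.init (inputWords adj k)).mem := fun i hi => by
  have : inputWords adj k = n :: k :: rows adj (List.finRange n) := rfl
  simp only [State.init, this]
  rw [show 2 + i = i + 1 + 1 by ring, List.getD_cons_succ, List.getD_cons_succ,
    List.getD_eq_getElem _ _ hi]

lemma ListsGraphlets.of_lists {blocks : List (List (Fin n))} {k : ℕ}
    (h : Lists blocks (Sol G k Finset.univ ∅)) : ListsGraphlets G k (blockWords blocks) := by
  refine ⟨blocks, rfl, h.1, h.2.1, fun S => ?_⟩
  rw [h.2.2, mem_Sol]
  simp [IsKGraphlet, Conn]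

lemma Sol_one : Sol G 1 Finset.univ ∅ = Finset.univ.image fun u => {u} := by
  ext T
  simp only [mem_Sol, Finset.subset_univ, Finset.empty_subset, true_and, Finset.mem_image,
    Finset.mem_univ, Finset.card_eq_one]
  constructor
  · rintro ⟨⟨u, rfl⟩, -⟩; exact ⟨u, rfl⟩
  · rintro ⟨u, rfl⟩; exact ⟨⟨u, rfl⟩, conn_singleton u⟩

lemma lists_singletons :
    Lists ((List.finRange n).map fun u => [u]) (Sol G 1 Finset.univ ∅) := by
  refine ⟨by simp, ?_, fun T => ?_⟩
  · rw [List.map_map]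
    exact (List.nodup_finRange n).map fun a b hab => by simpa using hab
  · rw [Sol_one]; simp

lemma graphletC_spec (hG : G.Connected) {adj : Fin n → List (Fin n)} (hadj : IsAdjLists G adj)
    {k : ℕ} (hk : 0 < k) (hc : 10 * n + 10 * numEdges G + 10 ≤ cells)
    (hw : cells + k + 8 ≤ 2 ^ w) :
    ∃ t s', Exec cells w graphletC (State.init (inputWords adj k)) t s' ∧
      ListsGraphlets G k s'.out ∧
      t ≤ 1000 * (n + numEdges G + k ^ 2 * numGraphlets G k) ∧
      (0 < numGraphlets G k → t ≤ 1000 * (k ^ 2 * numGraphlets G k)) := by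
  have hn : 0 < n := by
    obtain ⟨z⟩ := hG.nonempty
    exact z.pos
  rw [numGraphlets_eq]
  set N := (Sol G k Finset.univ ∅).card with hN
  have hin := inputMem_init adj k
  have hm0 : (State.init (inputWords adj k)).mem 0 = n := rfl
  have hm1 : (State.init (inputWords adj k)).mem 1 = k := rfl
  have key : ∀ B, Halts cells w (.cond 24 (.sub 24 3 2 ;; .cond 24 .skip enumC) verticesC)
      (((((State.init (inputWords adj k)).setReg 1 1).setReg 2 n).setReg 3 k).setReg 24 (k - 1)) B
      (fun s' => ListsGraphlets G k s'.out) →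
      Halts cells w graphletC (State.init (inputWords adj k)) (4 + B)
        (fun s' => ListsGraphlets G k s'.out) := by
    intro B h
    refine (Halts.wp_seq (c := .const 1 1 ;; .load 2 0 ;; .load 3 1 ;; .sub 24 3 1) (B := B)
      ?_).mono (by simp only [Cmd.size]; omega) fun _ h => h
    have hr0 : (State.init (inputWords adj k)).reg 0 = 0 := rfl
    simp only [wp, State.setReg_reg, State.setReg_mem, Function.update_self]
    rw [Function.update_of_ne (by norm_num), Function.update_of_ne (by norm_num), hr0, hm0,
      Function.update_self, Function.update_of_ne (by norm_num),
        Function.update_of_ne (by norm_num),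
      Function.update_self, hm1]
    exact ⟨by omega, by omega, by omega, h⟩
  have hmE : 2 ≤ k → k ≤ n → numEdges G ≤ k ^ 2 * N := numEdges_le hG
  have hnm := le_numEdges_add_one hG
  suffices h : ∃ B, Halts cells w graphletC (State.init (inputWords adj k)) B
      (fun s' => ListsGraphlets G k s'.out) ∧ B ≤ 1000 * (n + numEdges G + k ^ 2 * N) ∧
      (0 < N → B ≤ 1000 * (k ^ 2 * N)) by
    obtain ⟨B, ⟨t, s', h1, h2, h3⟩, h4, h5⟩ := h
    exact ⟨t, s', h1, h3, h2.trans h4, fun h => h2.trans (h5 h)⟩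
  rcases Nat.lt_or_ge k 2 with hk1 | hk2
  · -- the vertices are the graphlets
    obtain rfl : k = 1 := by omega
    have hNn : N = n := by
      rw [hN, Sol_one, Finset.card_image_of_injective _ Finset.singleton_injective]; simp
    refine ⟨_, key _ (Halts.condFalse (by simp) ((verticesC_spec (n := n) (by simp) (by simp)
      (by omega)).mono le_rfl fun s' h => ?_)), ?_, fun _ => ?_⟩
    · have := ListsGraphlets.of_lists (lists_singletons (G := G))
      rw [h]
      convert this using 1
      simp [blockWords, State.init, List.flatMap_map, ← List.map_eq_flatMap]
    · omega
    · omega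
  · rcases Nat.lt_or_ge n k with hkn | hkn
    · -- there are no graphlets
      have hN0 : Sol G k Finset.univ ∅ = ∅ := by
        refine Finset.eq_empty_of_forall_notMem fun T hT => ?_
        have h1 := (mem_Sol.1 hT).2.2.1
        have h2 := Finset.card_le_univ T
        rw [Fintype.card_fin] at h2
        omega
      refine ⟨_, key _ (Halts.condTrue (by simp; omega) (Halts.wp_seq (c := .sub 24 3 2)
        (B := 1 + 1) ?_)), ?_, fun h => ?_⟩
      · simp only [wp]
        refine Halts.condTrue (by simp; omega) ⟨1, _, .skip _, le_rfl, ?_⟩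
        have : Lists (n := n) [] (Sol G k Finset.univ ∅) := by rw [hN0]; exact ⟨by simp, by simp,
          by simp⟩
        exact ListsGraphlets.of_lists this
      · simp only [Cmd.size]; omega
      · rw [hN, hN0] at h; simp at h
    · have hE := hmE hk2 hkn
      have hN0 : 0 < k ^ 2 * N := by omega
      have hsq : 700 * (k * k) * N = 700 * (k ^ 2 * N) := by ring
      refine ⟨_, key _ (Halts.condTrue (by simp; omega) (Halts.wp_seq (c := .sub 24 3 2)
        (B := 1 + (54 * n + 106 * numEdges G + 50 + 700 * (k * k) * N)) ?_)), ?_, fun _ => ?_⟩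
      · simp only [wp]
        refine Halts.condFalse (by simp; omega) ((enumC_spec hG hadj hk2 hkn ?_ (by simp [State.init])
          (by simp) (by simp) (by simp) (by simp [State.init]) hc hw).mono le_rfl ?_)
        · exact hin
        · rintro s' ⟨blocks, hb, ho⟩
          rw [ho]; exact ListsGraphlets.of_lists hb
      · simp only [Cmd.size, hsq]; omega
      · simp only [Cmd.size, hsq]; omega

/-- A machine with `1000 * (n + m)` cells and words of `1000` times the length of `n + m + k` is
large enough for the layout. -/
lemma fits_bound {n m k : ℕ} (hn : 0 < n) (hk : 0 < k) :
    10 * n + 10 * m + 10 ≤ 1000 * (n + m) ∧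
      1000 * (n + m) + k + 8 ≤ 2 ^ (1000 * Nat.size (n + m + k)) := by
  refine ⟨by omega, ?_⟩
  have h1 : n + m + k < 2 ^ Nat.size (n + m + k) := Nat.lt_size_self _
  have h2 : 0 < Nat.size (n + m + k) := Nat.size_pos.2 (by omega)
  calc 1000 * (n + m) + k + 8 ≤ 2 ^ 10 * 2 ^ Nat.size (n + m + k) := by omega
    _ = 2 ^ (10 + Nat.size (n + m + k)) := (pow_add _ _ _).symm
    _ ≤ _ := Nat.pow_le_pow_right (by norm_num) (by omega)

end GraphletEnum

theorem mainTheorem2 :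
    ∃ (prog : GraphletEnum.Cmd) (C : ℕ),
      ∀ (n k : ℕ) (G : SimpleGraph (Fin n)) (adj : Fin n → List (Fin n)),
        G.Connected → 0 < k → GraphletEnum.IsAdjLists G adj →
        ∃ (t : ℕ) (s : GraphletEnum.State),
          GraphletEnum.Exec
            (C * (n + GraphletEnum.numEdges G))
            (C * Nat.size (n + GraphletEnum.numEdges G + k))
            prog (GraphletEnum.State.init (GraphletEnum.inputWords adj k)) t s ∧
          GraphletEnum.ListsGraphlets G k s.out ∧
          t ≤ C * (n + GraphletEnum.numEdges G + k ^ 2 * GraphletEnum.numGraphlets G k) ∧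
          (0 < GraphletEnum.numGraphlets G k →
            t ≤ C * (k ^ 2 * GraphletEnum.numGraphlets G k)) := by
  refine ⟨GraphletEnum.graphletC, 1000, fun n k G adj hG hk hadj => ?_⟩
  obtain ⟨z⟩ := hG.nonempty
  obtain ⟨h1, h2⟩ := GraphletEnum.fits_bound (m := GraphletEnum.numEdges G) z.pos hk
  exact GraphletEnum.graphletC_spec hG hadj hk h1 h2
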